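/- Let $\rho\in(0,1)$ and $a>b>0$ be constants, and for each $n$ let $K=\rho\frac{n}{\log n}$ (rounded to an integer in any way), $p=a\frac{(\log n)^2}{n}$ and $q=b\frac{(\log n)^2}{n}$. A community $C^*$ is drawn uniformly among the $K$-element subsets of $\{1,\dots,n\}$; node $i$ has label $x_i=1$ if $i\in C^*$ and $x_i=0$ otherwise. Given $C^*$, a graph $G$ on the $n$ nodes is observed in which pairs of distinct nodes are joined independently, with probability $p$ if both nodes lie in $C^*$ and with probability $q$ otherwise; in addition, independently of $G$ and independently over the nodes given $C^*$, each node $i$ shows one symbol $y_i$ (side information). Exact recovery is said to be achieved if there are estimators $\hat C_n(G,y)$ with $\mathbb P(\hat C_n=C^*)\to1$ as $n\to\infty$. Put $T=\log(a/b)$ and $$\eta_1=\rho\Big(b+\frac{a-b}{T}\log\frac{a-b}{ebT}\Big),\qquad \eta_2(\beta)=\rho b+\frac{\rho(a-b)-\beta}{T}\log\frac{\rho(a-b)-\beta}{\rho ebT}+\beta .$$ **Noisy labels.** Let $\alpha=\alpha_n\in(0,1/2)$, and let $y_i=x_i$ with probability $1-\alpha$ and $y_i=1-x_i$ with probability $\alpha$.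 1. If $\log\frac{1-\alpha}{\alpha}=o(\log n)$ and $\eta_1\ne1$, then exact recovery is achieved if and only if $\eta_1>1$. 2. If $\log\frac{1-\alpha}{\alpha}=(\beta+o(1))\log n$ for a constant $\beta$ with $0<\beta<\rho(a-b-bT)$, and $\eta_2(\beta)\ne1$, then exact recovery is achieved if and only if $\eta_2(\beta)>1$. **Partially revealed labels.** Let $\epsilon=\epsilon_n\in(0,1]$, and let $y_i=x_i$ with probability $1-\epsilon$ and $y_i$ be an erasure symbol with probability $\epsilon$. 3. If $\log\epsilon=o(\log n)$ and $\eta_1\ne1$, then exact recovery is achieved if and only if $\eta_1>1$. 4. If $\log\epsilon=(-\beta+o(1))\log n$ for a constant $\beta>0$, and $\eta_1+\beta\ne1$, then exact recovery is achieved if and only if $\eta_1+\beta>1$. -/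

import Mathlib

open Filter Topology Asymptotics
open scoped Classical

noncomputable section

/-- Probability of the graph `g` on `n` nodes when the hidden community is `C`: the unordered
pairs of distinct nodes (listed as `i < j`) carry independent edges, present with probability `p`
if both end points lie in `C` and with probability `q` otherwise. -/
def graphProb {n : ℕ} (p q : ℝ) (C : Finset (Fin n)) (g : SimpleGraph (Fin n)) : ℝ :=
  ∏ e ∈ (Finset.univ : Finset (Fin n × Fin n)).filter (fun e => e.1 < e.2),
    if g.Adj e.1 e.2 then (if e.1 ∈ C ∧ e.2 ∈ C then p else q)
    else 1 - (if e.1 ∈ C ∧ e.2 ∈ C then p else q)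

/-- Probability of the side information `y` when the hidden community is `C`: given the labels,
the observations at the nodes are independent, and a node whose label is `x` (`true` inside the
community, `false` outside) shows the symbol `s` with probability `w x s`. -/
def sideProb {n : ℕ} {Y : Type} (w : Bool → Y → ℝ) (C : Finset (Fin n)) (y : Fin n → Y) : ℝ :=
  ∏ i, w (decide (i ∈ C)) (y i)

/-- `ℙ(x̂ = x*)` for the estimator `est` of the community from the graph and the side information,
when the hidden community is drawn uniformly among the `K`-element sets of nodes and, given the
community, the graph and the side information are independent. -/
def successProb {Y : Type} [Fintype Y] (n K : ℕ) (p q : ℝ) (w : Bool → Y → ℝ)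
    (est : SimpleGraph (Fin n) → (Fin n → Y) → Finset (Fin n)) : ℝ :=
  ∑ C ∈ Finset.powersetCard K (Finset.univ : Finset (Fin n)), ((n.choose K : ℝ))⁻¹ *
    ∑ g : SimpleGraph (Fin n), ∑ y : Fin n → Y,
      graphProb p q C g * sideProb w C y * (if est g y = C then 1 else 0)

/-- Exact recovery is achieved: some sequence of estimators (one for each `n`, which may depend on
all the parameters) returns the community with probability tending to `1`. -/
def ExactRecovery {Y : Type} [Fintype Y] (K : ℕ → ℕ) (p q : ℕ → ℝ) (w : ℕ → Bool → Y → ℝ) : Prop :=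
  ∃ est : (n : ℕ) → SimpleGraph (Fin n) → (Fin n → Y) → Finset (Fin n),
    Tendsto (fun n => successProb n (K n) (p n) (q n) (w n) (est n)) atTop (𝓝 1)

/-- Noisy label: the observed bit is the true label with probability `1 - α` and the flipped label
with probability `α`. -/
def noisyLabel (α : ℝ) (x y : Bool) : ℝ := if y = x then 1 - α else α

/-- Partially revealed label: the true label is shown (`some x`) with probability `1 - ε` and
erased (`none`) with probability `ε`. -/
def revealedLabel (ε : ℝ) (x : Bool) : Option Bool → ℝ
  | none => ε
  | some y => if y = x then 1 - ε else 0

/-- `T = log (a / b)`. -/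
def Tab (a b : ℝ) : ℝ := Real.log (a / b)

/-- The function `η₁(ρ, a, b)`. -/
def eta1 (ρ a b : ℝ) : ℝ :=
  ρ * (b + (a - b) / Tab a b * Real.log ((a - b) / (Real.exp 1 * b * Tab a b)))

/-- The function `η₂(ρ, a, b, β)`. -/
def eta2 (ρ a b β : ℝ) : ℝ :=
  ρ * b + (ρ * (a - b) - β) / Tab a b *
    Real.log ((ρ * (a - b) - β) / (ρ * Real.exp 1 * b * Tab a b)) + β

/-- The common edge-probability scale `c (log n)² / n`. -/
def edgeScale (c : ℝ) (n : ℕ) : ℝ := c * Real.log n ^ 2 / n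

end

/-! The prior is uniform, so a maximum likelihood set is an optimal estimator, and the question is
whether another `K`-set can beat the true community `C`. This is decided node by node. On the scale
`log n`, the number of neighbours of a node in `C` behaves like a Poisson variable of mean `ρ a log
n` for a member and `ρ b log n` for a non-member. If a symbol has log-likelihood ratio about `β log
n`, membership and non-membership balance at `critLevel * log n` neighbours. Both the `K = n ^ (1 -
o(1))` members and the `n - K` non-members supply enough candidates for errors to occur or not
according as the exponent of a single error, label cost included, is below or above 1.

Achievability (`exactRecovery_of_exponent`): a tilted Markov inequality and a union bound put every
node on its correct side with a margin of order `log n`. By `jointProb_lt_of_swap`, such margins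
rule out every competitor that differs from `C` in a small fraction of its nodes, provided the
exchanged blocks span few edges. Competitors further away are excluded by a Bhattacharyya bound:
there are only `exp (O(K log log n))` of them, and each has probability `exp (-c K log n)`.

Converse (`not_exactRecovery_of_exponent`): if one symbol is likely enough on both sides, then with
high probability some member shows it with slightly fewer than `critLevel * log n` neighbours in
`C`, and some non-member shows it with slightly more. Exchanging the two leaves the label likelihood
unchanged and raises the graph likelihood (`jointProb_lt_of_exchange`).

The two halves meet because the Chernoff exponent at the tilt `tiltParam` equals the Poisson rate at
`critLevel`, both being `eta2` (`chernoffGap_critLevel`, `poissonRate_critLevel_left`,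
`poissonRate_critLevel_right`). The value `eta1` is `eta2` at `β = 0`, and an erased label costs the
factor `ε` under either hypothesis, which adds `β` to the exponent. -/

/-! ### Random graph weights and independence across pairs. -/

/-- The unordered pairs of distinct nodes, listed increasingly. -/
def nodePairs (n : ℕ) : Finset (Fin n × Fin n) := Finset.univ.filter (fun e => e.1 < e.2)

/-- Bernoulli weight of the outcome `P`. -/
noncomputable def bernWeight (r : ℝ) (P : Prop) : ℝ := if P then r else 1 - r

/-- Probability of an edge between `u` and `v` when the community is `C`. -/
noncomputable def edgeProb {n : ℕ} (p q : ℝ) (C : Finset (Fin n)) (u v : Fin n) : ℝ :=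
  if u ∈ C ∧ v ∈ C then p else q

theorem graphProb_eq_prod {n : ℕ} (p q : ℝ) (C : Finset (Fin n)) (g : SimpleGraph (Fin n)) :
    graphProb p q C g =
      ∏ e ∈ nodePairs n, bernWeight (edgeProb p q C e.1 e.2) (g.Adj e.1 e.2) := rfl

theorem mem_nodePairs {n : ℕ} {e : Fin n × Fin n} : e ∈ nodePairs n ↔ e.1 < e.2 := by
  simp [nodePairs]

/-- Expanding the product over subsets of the pairs turns each subset into the edge set of exactly
one graph. All exact graph expectations rest on this factorisation. -/
theorem sum_graph_prod {n : ℕ} (f : Fin n × Fin n → Prop → ℝ) :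
    ∑ g : SimpleGraph (Fin n), ∏ e ∈ nodePairs n, f e (g.Adj e.1 e.2) =
      ∏ e ∈ nodePairs n, (f e True + f e False) := by
  rw [Finset.prod_add]
  refine Finset.sum_bij' (fun g _ => (nodePairs n).filter (fun e => g.Adj e.1 e.2))
    (fun t _ => SimpleGraph.fromRel (fun u v => (u, v) ∈ t)) ?_ ?_ ?_ ?_ ?_
  · intro g _
    simp
  · intro t _
    simp
  · intro g _
    ext u v
    simp only [SimpleGraph.fromRel_adj, Finset.mem_filter, mem_nodePairs]
    constructor
    · rintro ⟨_, h | h⟩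
      · exact h.2
      · exact h.2.symm
    · intro h
      refine ⟨h.ne, ?_⟩
      rcases lt_or_gt_of_ne h.ne with h1 | h1
      · exact Or.inl ⟨h1, h⟩
      · exact Or.inr ⟨h1, h.symm⟩
  · intro t ht
    rw [Finset.mem_powerset] at ht
    ext ⟨u, v⟩
    simp only [SimpleGraph.fromRel_adj, Finset.mem_filter, mem_nodePairs]
    constructor
    · rintro ⟨h1, _, h | h⟩
      · exact h
      · exact absurd (mem_nodePairs.1 (ht h)) (not_lt_of_gt h1)
    · intro h
      have := mem_nodePairs.1 (ht h)
      exact ⟨this, this.ne, Or.inl h⟩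
  · intro g _
    rw [← Finset.prod_filter_mul_prod_filter_not (nodePairs n) (fun e => g.Adj e.1 e.2)]
    congr 1
    · refine Finset.prod_congr rfl fun e he => ?_
      simp [(Finset.mem_filter.1 he).2]
    · rw [← Finset.filter_not]
      refine Finset.prod_congr rfl fun e he => ?_
      simp [(Finset.mem_filter.1 he).2]

theorem sum_graphProb_mul_prod {n : ℕ} (p q : ℝ) (C : Finset (Fin n))
    (φ : Fin n × Fin n → Prop → ℝ) :
    ∑ g : SimpleGraph (Fin n), graphProb p q C g * ∏ e ∈ nodePairs n, φ e (g.Adj e.1 e.2) =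
      ∏ e ∈ nodePairs n, (edgeProb p q C e.1 e.2 * φ e True +
        (1 - edgeProb p q C e.1 e.2) * φ e False) := by
  have := sum_graph_prod (fun e P => bernWeight (edgeProb p q C e.1 e.2) P * φ e P)
  simp only [Finset.prod_mul_distrib] at this
  simp only [graphProb_eq_prod]
  rw [this]
  simp [bernWeight]

theorem sum_graphProb {n : ℕ} (p q : ℝ) (C : Finset (Fin n)) :
    ∑ g : SimpleGraph (Fin n), graphProb p q C g = 1 := by
  have := sum_graphProb_mul_prod p q C (fun _ _ => 1)
  simpa using this

theorem edgeProb_mem {n : ℕ} {p q : ℝ} (hp : p ∈ Set.Icc (0 : ℝ) 1) (hq : q ∈ Set.Icc (0 : ℝ) 1)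
    (C : Finset (Fin n)) (u v : Fin n) : edgeProb p q C u v ∈ Set.Icc (0 : ℝ) 1 := by
  unfold edgeProb; split_ifs <;> assumption

theorem bernWeight_nonneg {r : ℝ} (hr : r ∈ Set.Icc (0 : ℝ) 1) (P : Prop) :
    0 ≤ bernWeight r P := by
  unfold bernWeight; split_ifs
  · exact hr.1
  · linarith [hr.2]

theorem graphProb_nonneg {n : ℕ} {p q : ℝ} (hp : p ∈ Set.Icc (0 : ℝ) 1)
    (hq : q ∈ Set.Icc (0 : ℝ) 1) (C : Finset (Fin n)) (g : SimpleGraph (Fin n)) :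
    0 ≤ graphProb p q C g := by
  rw [graphProb_eq_prod]
  exact Finset.prod_nonneg fun e _ => bernWeight_nonneg (edgeProb_mem hp hq C _ _) _

/-- The pair `u, v` joins `i` to a node of `R`. -/
def InStar {n : ℕ} (i : Fin n) (R : Finset (Fin n)) (u v : Fin n) : Prop :=
  (u = i ∧ v ∈ R) ∨ (v = i ∧ u ∈ R)

theorem prod_nodePairs_inStar {n : ℕ} {i : Fin n} {R : Finset (Fin n)} (hi : i ∉ R)
    (F : Fin n → ℝ) :
    ∏ e ∈ nodePairs n, (if InStar i R e.1 e.2 then F (if e.1 = i then e.2 else e.1) else 1) =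
      ∏ j ∈ R, F j := by
  rw [← Finset.prod_filter]
  refine Finset.prod_nbij' (fun e => if e.1 = i then e.2 else e.1)
    (fun j => if i < j then (i, j) else (j, i)) ?_ ?_ ?_ ?_ ?_
  · rintro ⟨u, v⟩ h
    rw [Finset.mem_filter, mem_nodePairs] at h
    simp only [InStar] at h
    rcases h with ⟨h1, ⟨rfl, h⟩ | ⟨rfl, h⟩⟩
    · simpa using h
    · have : u ≠ v := fun h' => hi (h' ▸ h)
      simpa [this] using h
  · intro j hj
    have hij : i ≠ j := fun h' => hi (h' ▸ hj)
    rw [Finset.mem_filter, mem_nodePairs]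
    simp only [InStar]
    split_ifs with h
    · exact ⟨h, Or.inl ⟨rfl, hj⟩⟩
    · exact ⟨lt_of_le_of_ne (not_lt.1 h) hij.symm, Or.inr ⟨rfl, hj⟩⟩
  · rintro ⟨u, v⟩ h
    rw [Finset.mem_filter, mem_nodePairs] at h
    simp only [InStar] at h
    rcases h with ⟨h1, ⟨rfl, h⟩ | ⟨rfl, h⟩⟩
    · simp [h1]
    · have : u ≠ v := fun h' => hi (h' ▸ h)
      simp [this, not_lt_of_gt h1]
  · intro j hj
    have hij : i ≠ j := fun h' => hi (h' ▸ hj)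
    by_cases h : i < j
    · simp [h]
    · simp [h, hij.symm]
  · intro e _
    rfl

theorem sum_graphProb_mul_star {n : ℕ} (p q : ℝ) (C : Finset (Fin n)) {i : Fin n}
    {R : Finset (Fin n)} (hi : i ∉ R) (φ : Fin n → Prop → ℝ) :
    ∑ g : SimpleGraph (Fin n), graphProb p q C g * ∏ j ∈ R, φ j (g.Adj i j) =
      ∏ j ∈ R, (edgeProb p q C i j * φ j True + (1 - edgeProb p q C i j) * φ j False) := by
  rw [← prod_nodePairs_inStar hi]
  have h := sum_graphProb_mul_prod p q C (fun e P =>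
    if InStar i R e.1 e.2 then φ (if e.1 = i then e.2 else e.1) P else 1)
  have h2 : ∀ g : SimpleGraph (Fin n), ∏ j ∈ R, φ j (g.Adj i j) = ∏ e ∈ nodePairs n,
      if InStar i R e.1 e.2 then φ (if e.1 = i then e.2 else e.1) (g.Adj e.1 e.2) else 1 := by
    intro g
    rw [← prod_nodePairs_inStar hi]
    refine Finset.prod_congr rfl fun e _ => ?_
    split_ifs with h1 h2
    · rw [h2]
    · rcases h1 with h1 | h1
      · exact absurd h1.1 h2
      · rw [h1.1, g.adj_comm]
    · rfl
  simp only [h2]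
  rw [h]
  refine Finset.prod_congr rfl fun e _ => ?_
  split_ifs with h1 h2
  · rw [h2]
  · rcases h1 with h1 | h1
    · exact absurd h1.1 h2
    · rw [h1.1]; simp only [edgeProb, and_comm]
  · ring

/-- The degree of `i` into `R` is binomial: its indicator is split over the possible neighbour sets,
and each of these is a product over the star. -/
theorem sum_graphProb_card_star {n : ℕ} (p q : ℝ) (C : Finset (Fin n)) {i : Fin n}
    {R : Finset (Fin n)} (hi : i ∉ R) {r : ℝ} (hr : ∀ j ∈ R, edgeProb p q C i j = r) (k : ℕ) :
    ∑ g : SimpleGraph (Fin n), graphProb p q C g *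
        (if (R.filter (g.Adj i)).card = k then 1 else 0) =
      (R.card.choose k : ℝ) * r ^ k * (1 - r) ^ (R.card - k) := by
  have h1 : ∀ g : SimpleGraph (Fin n), (if (R.filter (g.Adj i)).card = k then (1 : ℝ) else 0) =
      ∑ U ∈ R.powersetCard k, ∏ j ∈ R, if (g.Adj i j ↔ j ∈ U) then 1 else 0 := by
    intro g
    have h2 : ∀ U ∈ R.powersetCard k, (∏ j ∈ R, if (g.Adj i j ↔ j ∈ U) then (1 : ℝ) else 0) =
        if R.filter (g.Adj i) = U then 1 else 0 := by
      intro U hU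
      rw [Finset.mem_powersetCard] at hU
      rw [Finset.prod_ite_zero]
      simp only [Finset.prod_const_one]
      congr 1
      apply propext
      constructor
      · intro h
        ext j
        rw [Finset.mem_filter]
        exact ⟨fun hj => (h j hj.1).1 hj.2, fun hj => ⟨hU.1 hj, (h j (hU.1 hj)).2 hj⟩⟩
      · rintro rfl j hj
        simp [hj]
    rw [Finset.sum_congr rfl h2, Finset.sum_ite_eq]
    simp [Finset.mem_powersetCard]
  simp only [h1, Finset.mul_sum]
  rw [Finset.sum_comm]
  have h3 : ∀ U ∈ R.powersetCard k, ∑ g : SimpleGraph (Fin n), graphProb p q C g *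
      ∏ j ∈ R, (if (g.Adj i j ↔ j ∈ U) then (1 : ℝ) else 0) =
      r ^ k * (1 - r) ^ (R.card - k) := by
    intro U hU
    rw [Finset.mem_powersetCard] at hU
    rw [sum_graphProb_mul_star p q C hi (fun j P => if (P ↔ j ∈ U) then (1 : ℝ) else 0)]
    refine (Finset.prod_congr rfl (g := fun j => if j ∈ U then r else 1 - r) fun j hj => ?_).trans ?_
    · rw [hr j hj]
      by_cases hjU : j ∈ U <;> simp [hjU]
    rw [Finset.prod_ite]
    simp only [Finset.prod_const]
    rw [Finset.filter_mem_eq_inter, Finset.inter_eq_right.2 hU.1, hU.2, Finset.filter_not,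
      Finset.filter_mem_eq_inter, Finset.inter_eq_right.2 hU.1, Finset.card_sdiff_of_subset hU.1, hU.2]
  rw [Finset.sum_congr rfl h3]
  simp [Finset.card_powersetCard, mul_assoc]

/-- The graph that agrees with `g` on the pairs in `D` and with `g'` on the others. -/
def mixGraph {n : ℕ} (D : Fin n → Fin n → Prop) (hD : ∀ u v, D u v → D v u)
    (g g' : SimpleGraph (Fin n)) : SimpleGraph (Fin n) where
  Adj u v := (D u v ∧ g.Adj u v) ∨ (¬ D u v ∧ g'.Adj u v)
  symm := ⟨by
    rintro u v (⟨h1, h2⟩ | ⟨h1, h2⟩)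
    · exact Or.inl ⟨hD _ _ h1, h2.symm⟩
    · exact Or.inr ⟨fun h => h1 (hD _ _ h), h2.symm⟩⟩
  loopless := ⟨by
    rintro u (⟨_, h⟩ | ⟨_, h⟩)
    · exact g.loopless.irrefl _ h
    · exact g'.loopless.irrefl _ h⟩

/-- Independence by exchange: for two independent copies, trading their parts off `D` is an
involution that preserves the joint weight and moves `F` and `H` onto different copies. -/
theorem sum_graphProb_mul_indep {n : ℕ} (p q : ℝ) (C : Finset (Fin n))
    (D : Fin n → Fin n → Prop) (hD : ∀ u v, D u v → D v u) (F H : SimpleGraph (Fin n) → ℝ)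
    (hF : ∀ g g', (∀ u v, D u v → (g.Adj u v ↔ g'.Adj u v)) → F g = F g')
    (hH : ∀ g g', (∀ u v, ¬ D u v → (g.Adj u v ↔ g'.Adj u v)) → H g = H g') :
    ∑ g : SimpleGraph (Fin n), graphProb p q C g * (F g * H g) =
      (∑ g : SimpleGraph (Fin n), graphProb p q C g * F g) *
        ∑ g : SimpleGraph (Fin n), graphProb p q C g * H g := by
  let σ : SimpleGraph (Fin n) × SimpleGraph (Fin n) → SimpleGraph (Fin n) × SimpleGraph (Fin n) :=
    fun x => (mixGraph D hD x.1 x.2, mixGraph D hD x.2 x.1)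
  have hσ : Function.Involutive σ := by
    rintro ⟨g, g'⟩
    refine Prod.ext ?_ ?_ <;>
    · ext u v
      simp only [σ, mixGraph]
      tauto
  have hL : ∑ g : SimpleGraph (Fin n), graphProb p q C g * (F g * H g) =
      ∑ x : SimpleGraph (Fin n) × SimpleGraph (Fin n),
        graphProb p q C x.1 * graphProb p q C x.2 * (F x.1 * H x.1) := by
    rw [Fintype.sum_prod_type]
    refine Finset.sum_congr rfl fun g _ => ?_
    have : ∀ g' : SimpleGraph (Fin n), graphProb p q C g * graphProb p q C g' * (F g * H g) =
      graphProb p q C g' * (graphProb p q C g * (F g * H g)) := fun g' => by ring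
    simp only [this]
    rw [← Finset.sum_mul, sum_graphProb, one_mul]
  rw [hL, Finset.sum_mul_sum, ← Fintype.sum_prod_type' (fun g g' =>
    graphProb p q C g * F g * (graphProb p q C g' * H g')), ← Equiv.sum_comp hσ.toPerm]
  refine Finset.sum_congr rfl fun x _ => ?_
  simp only [Function.Involutive.coe_toPerm]
  have h1 : F (σ x).1 = F x.1 := hF _ _ fun u v h => by simp [σ, mixGraph, h]
  have h2 : H (σ x).1 = H x.2 := hH _ _ fun u v h => by simp [σ, mixGraph, h]
  have h3 : graphProb p q C (σ x).1 * graphProb p q C (σ x).2 =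
      graphProb p q C x.1 * graphProb p q C x.2 := by
    simp only [graphProb_eq_prod, ← Finset.prod_mul_distrib]
    refine Finset.prod_congr rfl fun e _ => ?_
    by_cases h : D e.1 e.2
    · simp [σ, mixGraph, h]
    · simp [σ, mixGraph, h, mul_comm]
  rw [h1, h2, h3]
  ring

/-- Since `I` and `R` are disjoint, no pair belongs to the stars of two different centres, so the
stars are peeled off one at a time. -/
theorem sum_graphProb_prod_stars {n : ℕ} (p q : ℝ) (C I R : Finset (Fin n)) (hIR : Disjoint I R)
    (F : Fin n → Finset (Fin n) → ℝ) :
    ∑ g : SimpleGraph (Fin n), graphProb p q C g * ∏ i ∈ I, F i (R.filter (g.Adj i)) =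
      ∏ i ∈ I, ∑ g : SimpleGraph (Fin n), graphProb p q C g * F i (R.filter (g.Adj i)) := by
  induction I using Finset.induction_on with
  | empty => simp [sum_graphProb]
  | insert i I hi ih =>
    rw [Finset.disjoint_insert_left] at hIR
    simp only [Finset.prod_insert hi]
    rw [← ih hIR.2]
    refine sum_graphProb_mul_indep p q C (InStar i R) ?_ _ _ ?_ ?_
    · intro u v h
      exact h.symm
    · intro g g' h
      congr 1
      exact Finset.filter_congr fun j hj => h i j (Or.inl ⟨rfl, hj⟩)
    · intro g g' h
      refine Finset.prod_congr rfl fun k hk => ?_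
      congr 1
      refine Finset.filter_congr fun j hj => h k j ?_
      rintro (⟨rfl, _⟩ | ⟨rfl, _⟩)
      · exact hi hk
      · exact hIR.1 hj

/-! ### Event probabilities and the maximum likelihood estimator. -/

/-- Probability of an event about the graph when the community is `C`. -/
noncomputable def graphEventProb {n : ℕ} (p q : ℝ) (C : Finset (Fin n))
    (A : SimpleGraph (Fin n) → Prop) : ℝ :=
  ∑ g : SimpleGraph (Fin n), graphProb p q C g * if A g then 1 else 0

/-- Joint probability of the graph and the side information when the community is `C`. -/
noncomputable def jointProb {n : ℕ} {Y : Type} (p q : ℝ) (w : Bool → Y → ℝ) (C : Finset (Fin n))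
    (g : SimpleGraph (Fin n)) (y : Fin n → Y) : ℝ :=
  graphProb p q C g * sideProb w C y

/-- Probability of an event about the graph and the side information when the community is `C`. -/
noncomputable def eventProb {n : ℕ} {Y : Type} [Fintype Y] (p q : ℝ) (w : Bool → Y → ℝ)
    (C : Finset (Fin n)) (A : SimpleGraph (Fin n) → (Fin n → Y) → Prop) : ℝ :=
  ∑ g : SimpleGraph (Fin n), ∑ y : Fin n → Y, jointProb p q w C g y * if A g y then 1 else 0

/-- The edge probabilities lie in `[0, 1]` and the symbols have conditional laws `w`. -/
structure IsModel {Y : Type} [Fintype Y] (p q : ℝ) (w : Bool → Y → ℝ) : Prop where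
  hp : p ∈ Set.Icc (0 : ℝ) 1
  hq : q ∈ Set.Icc (0 : ℝ) 1
  nonneg : ∀ x s, 0 ≤ w x s
  sum_eq : ∀ x, ∑ s, w x s = 1

/-- `C` has the largest likelihood among the communities of size `K`. -/
def IsMaxLikelihood {n : ℕ} {Y : Type} (K : ℕ) (p q : ℝ) (w : Bool → Y → ℝ) (g : SimpleGraph (Fin n)) (y : Fin n → Y)
    (C : Finset (Fin n)) : Prop :=
  C ∈ Finset.powersetCard K (Finset.univ : Finset (Fin n)) ∧
    ∀ C' ∈ Finset.powersetCard K Finset.univ, jointProb p q w C' g y ≤ jointProb p q w C g y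

/-- A maximum likelihood estimator. -/
noncomputable def mlEstimator {n : ℕ} {Y : Type} (K : ℕ) (p q : ℝ) (w : Bool → Y → ℝ) (g : SimpleGraph (Fin n))
    (y : Fin n → Y) : Finset (Fin n) :=
  Classical.epsilon (IsMaxLikelihood K p q w g y)

theorem isMaxLikelihood_mlEstimator {n : ℕ} {Y : Type} {K : ℕ} (hK : K ≤ n) (p q : ℝ) (w : Bool → Y → ℝ)
    (g : SimpleGraph (Fin n)) (y : Fin n → Y) :
    IsMaxLikelihood K p q w g y (mlEstimator K p q w g y) := by
  refine Classical.epsilon_spec (p := IsMaxLikelihood K p q w g y) ?_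
  obtain ⟨C, hC, h⟩ := Finset.exists_max_image (Finset.powersetCard K Finset.univ)
    (fun C => jointProb p q w C g y)
    (Finset.powersetCard_nonempty.2 (by simpa using hK))
  exact ⟨C, hC, h⟩

section
variable {n : ℕ} {Y : Type} [Fintype Y] {p q : ℝ} {w : Bool → Y → ℝ}

theorem sum_sideProb_mul_prod (w : Bool → Y → ℝ) (C : Finset (Fin n)) (ψ : Fin n → Y → ℝ) :
    ∑ y : Fin n → Y, sideProb w C y * ∏ i, ψ i (y i) =
      ∏ i, ∑ s, w (decide (i ∈ C)) s * ψ i s := by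
  rw [Finset.prod_univ_sum, Fintype.piFinset_univ]
  simp only [sideProb, Finset.prod_mul_distrib]

theorem IsModel.sideProb_nonneg (h : IsModel p q w) (C : Finset (Fin n)) (y : Fin n → Y) :
    0 ≤ sideProb w C y :=
  Finset.prod_nonneg fun _ _ => h.nonneg _ _

theorem IsModel.jointProb_nonneg (h : IsModel p q w) (C : Finset (Fin n))
    (g : SimpleGraph (Fin n)) (y : Fin n → Y) : 0 ≤ jointProb p q w C g y :=
  mul_nonneg (graphProb_nonneg h.hp h.hq C g) (h.sideProb_nonneg C y)

theorem IsModel.sum_sideProb (h : IsModel p q w) (C : Finset (Fin n)) :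
    ∑ y : Fin n → Y, sideProb w C y = 1 := by
  have := sum_sideProb_mul_prod w C (fun _ _ => 1)
  simpa [h.sum_eq] using this

theorem IsModel.sum_sideProb_mul_node (h : IsModel p q w) (C : Finset (Fin n)) (i : Fin n)
    (ψ : Y → ℝ) :
    ∑ y : Fin n → Y, sideProb w C y * ψ (y i) = ∑ s, w (decide (i ∈ C)) s * ψ s := by
  have := sum_sideProb_mul_prod w C (fun j s => if j = i then ψ s else 1)
  have h1 : ∀ y : Fin n → Y, ∏ j, (if j = i then ψ (y j) else 1) = ψ (y i) := by
    intro y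
    rw [Finset.prod_ite_eq' Finset.univ i (fun j => ψ (y j))]
    simp
  simp only [h1] at this
  rw [this, ← Finset.mul_prod_erase Finset.univ _ (Finset.mem_univ i)]
  rw [Finset.prod_eq_one]
  · simp
  · intro j hj
    simp [Finset.ne_of_mem_erase hj, h.sum_eq]

theorem IsModel.eventProb_true (h : IsModel p q w) (C : Finset (Fin n)) :
    eventProb p q w C (fun _ _ => True) = 1 := by
  simp only [eventProb, jointProb, if_true, mul_one, ← Finset.mul_sum, h.sum_sideProb,
    sum_graphProb]

theorem eventProb_and_not (C : Finset (Fin n)) (A : SimpleGraph (Fin n) → (Fin n → Y) → Prop) :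
    eventProb p q w C A + eventProb p q w C (fun g y => ¬ A g y) =
      eventProb p q w C (fun _ _ => True) := by
  simp only [eventProb, ← Finset.sum_add_distrib]
  refine Finset.sum_congr rfl fun g _ => Finset.sum_congr rfl fun y _ => ?_
  by_cases hA : A g y <;> simp [hA]

theorem IsModel.eventProb_le_of_indicator_le (h : IsModel p q w) (C : Finset (Fin n))
    (A : SimpleGraph (Fin n) → (Fin n → Y) → Prop) (F : SimpleGraph (Fin n) → (Fin n → Y) → ℝ)
    (hF : ∀ g y, (if A g y then (1 : ℝ) else 0) ≤ F g y) :
    eventProb p q w C A ≤ ∑ g, ∑ y, jointProb p q w C g y * F g y :=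
  Finset.sum_le_sum fun g _ => Finset.sum_le_sum fun y _ =>
    mul_le_mul_of_nonneg_left (hF g y) (h.jointProb_nonneg C g y)

theorem IsModel.eventProb_mono (h : IsModel p q w) (C : Finset (Fin n))
    {A B : SimpleGraph (Fin n) → (Fin n → Y) → Prop} (hAB : ∀ g y, A g y → B g y) :
    eventProb p q w C A ≤ eventProb p q w C B :=
  h.eventProb_le_of_indicator_le C A _ fun g y => by
    by_cases hA : A g y
    · simp [hA, hAB g y hA]
    · simp only [hA, if_false]; split_ifs <;> norm_num

theorem IsModel.eventProb_or_le (h : IsModel p q w) (C : Finset (Fin n))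
    (A B : SimpleGraph (Fin n) → (Fin n → Y) → Prop) :
    eventProb p q w C (fun g y => A g y ∨ B g y) ≤
      eventProb p q w C A + eventProb p q w C B := by
  refine (h.eventProb_le_of_indicator_le C _ (fun g y =>
    (if A g y then 1 else 0) + if B g y then 1 else 0) ?_).trans ?_
  · intro g y
    by_cases hA : A g y <;> by_cases hB : B g y <;> simp [hA, hB]
  · simp only [eventProb, ← Finset.sum_add_distrib, mul_add, le_refl]

theorem IsModel.eventProb_exists_le (h : IsModel p q w) (C : Finset (Fin n)) {ι : Type*}
    (s : Finset ι) (A : ι → SimpleGraph (Fin n) → (Fin n → Y) → Prop) :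
    eventProb p q w C (fun g y => ∃ i ∈ s, A i g y) ≤ ∑ i ∈ s, eventProb p q w C (A i) := by
  induction s using Finset.induction_on with
  | empty => simp [eventProb]
  | insert i s hi ih =>
    rw [Finset.sum_insert hi]
    refine le_trans ?_ (add_le_add_right ih _)
    refine le_trans (h.eventProb_mono C ?_) (h.eventProb_or_le C _ _)
    intro g y
    simp

theorem IsModel.eventProb_node (h : IsModel p q w) (C : Finset (Fin n)) (i : Fin n)
    (B : SimpleGraph (Fin n) → Y → Prop) :
    eventProb p q w C (fun g y => B g (y i)) =
      ∑ s, w (decide (i ∈ C)) s * graphEventProb p q C (fun g => B g s) := by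
  simp only [eventProb, jointProb, graphEventProb, mul_assoc, ← Finset.mul_sum]
  conv_rhs => simp only [Finset.mul_sum]
  conv_rhs => rw [Finset.sum_comm]
  refine Finset.sum_congr rfl fun g _ => ?_
  rw [h.sum_sideProb_mul_node C i (fun s => if B g s then (1 : ℝ) else 0), Finset.mul_sum]
  refine Finset.sum_congr rfl fun s _ => ?_
  ring

theorem IsModel.eventProb_graph (h : IsModel p q w) (C : Finset (Fin n))
    (B : SimpleGraph (Fin n) → Prop) :
    eventProb p q w C (fun g _ => B g) = graphEventProb p q C B := by
  simp only [eventProb, jointProb, graphEventProb, mul_assoc, ← Finset.mul_sum,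
    ← Finset.sum_mul, h.sum_sideProb, one_mul]

theorem graphEventProb_le_of_indicator_le (hp : p ∈ Set.Icc (0 : ℝ) 1)
    (hq : q ∈ Set.Icc (0 : ℝ) 1) (C : Finset (Fin n)) (A : SimpleGraph (Fin n) → Prop)
    (F : SimpleGraph (Fin n) → ℝ) (hF : ∀ g, (if A g then (1 : ℝ) else 0) ≤ F g) :
    graphEventProb p q C A ≤ ∑ g, graphProb p q C g * F g :=
  Finset.sum_le_sum fun g _ =>
    mul_le_mul_of_nonneg_left (hF g) (graphProb_nonneg hp hq C g)

theorem successProb_eq (K : ℕ) (est : SimpleGraph (Fin n) → (Fin n → Y) → Finset (Fin n)) :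
    successProb n K p q w est = ((n.choose K : ℝ))⁻¹ *
      ∑ C ∈ Finset.powersetCard K Finset.univ, eventProb p q w C (fun g y => est g y = C) := by
  rw [successProb, Finset.mul_sum]
  refine Finset.sum_congr rfl fun C _ => ?_
  congr 1
  refine Finset.sum_congr rfl fun g _ => Finset.sum_congr rfl fun y _ => ?_
  by_cases hC : est g y = C <;> simp [hC, jointProb]

theorem choose_inv_mul_sum_const {K : ℕ} (hK : K ≤ n) (c : ℝ) :
    ((n.choose K : ℝ))⁻¹ * ∑ _C ∈ Finset.powersetCard K (Finset.univ : Finset (Fin n)), c = c := by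
  rw [Finset.sum_const, Finset.card_powersetCard, Finset.card_univ, Fintype.card_fin,
    nsmul_eq_mul, ← mul_assoc, inv_mul_cancel₀, one_mul]
  exact_mod_cast (Nat.choose_pos hK).ne'

theorem IsModel.successProb_le_one (h : IsModel p q w) {K : ℕ} (hK : K ≤ n)
    (est : SimpleGraph (Fin n) → (Fin n → Y) → Finset (Fin n)) :
    successProb n K p q w est ≤ 1 := by
  rw [successProb_eq, ← choose_inv_mul_sum_const hK (1 : ℝ)]
  refine mul_le_mul_of_nonneg_left (Finset.sum_le_sum fun C _ => ?_) (by positivity)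
  rw [← h.eventProb_true C]
  exact h.eventProb_mono C fun _ _ _ => trivial

/-- Ties are counted as failures, so the choice made among several maximisers does not matter. -/
theorem IsModel.le_successProb_mlEstimator (h : IsModel p q w) {K : ℕ} (hK : K ≤ n) {η : ℝ}
    (hη : ∀ C ∈ Finset.powersetCard K (Finset.univ : Finset (Fin n)),
      eventProb p q w C (fun g y => ∃ C' ∈ Finset.powersetCard K Finset.univ, C' ≠ C ∧
        jointProb p q w C g y ≤ jointProb p q w C' g y) ≤ η) :
    1 - η ≤ successProb n K p q w (mlEstimator K p q w) := by
  rw [successProb_eq, ← choose_inv_mul_sum_const hK (1 - η)]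
  refine mul_le_mul_of_nonneg_left (Finset.sum_le_sum fun C hC => ?_) (by positivity)
  have h1 := eventProb_and_not (p := p) (q := q) (w := w) C
    (fun g y => mlEstimator K p q w g y = C)
  rw [h.eventProb_true] at h1
  have h2 : eventProb p q w C (fun g y => ¬ mlEstimator K p q w g y = C) ≤ η := by
    refine le_trans (h.eventProb_mono C ?_) (hη C hC)
    intro g y hne
    have := isMaxLikelihood_mlEstimator hK p q w g y
    exact ⟨_, this.1, hne, this.2 C hC⟩
  linarith

/-- Under the uniform prior no estimator does better than maximum likelihood, and that one fails
whenever the truth is strictly beaten. -/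
theorem IsModel.successProb_le (h : IsModel p q w) {K : ℕ} (hK : K ≤ n) {η : ℝ}
    (hη : ∀ C ∈ Finset.powersetCard K (Finset.univ : Finset (Fin n)),
      eventProb p q w C (fun g y => ¬ ∃ C' ∈ Finset.powersetCard K Finset.univ,
        jointProb p q w C g y < jointProb p q w C' g y) ≤ η)
    (est : SimpleGraph (Fin n) → (Fin n → Y) → Finset (Fin n)) :
    successProb n K p q w est ≤ η := by
  -- Summing over the community first leaves, for each observation, only the likelihood of the
  -- estimator's own output, which can be compared pointwise.
  have hsum : ∀ e : SimpleGraph (Fin n) → (Fin n → Y) → Finset (Fin n),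
      ∑ C ∈ Finset.powersetCard K Finset.univ, eventProb p q w C (fun g y => e g y = C) =
      ∑ g, ∑ y, if e g y ∈ Finset.powersetCard K Finset.univ then
        jointProb p q w (e g y) g y else 0 := by
    intro e
    simp only [eventProb]
    rw [Finset.sum_comm]
    refine Finset.sum_congr rfl fun g _ => ?_
    rw [Finset.sum_comm]
    refine Finset.sum_congr rfl fun y _ => ?_
    simp only [mul_ite, mul_one, mul_zero]
    rw [Finset.sum_ite_eq (Finset.powersetCard K Finset.univ) (e g y)
      (fun C => jointProb p q w C g y)]
  have hle : successProb n K p q w est ≤ successProb n K p q w (mlEstimator K p q w) := by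
    rw [successProb_eq, successProb_eq, hsum, hsum]
    refine mul_le_mul_of_nonneg_left (Finset.sum_le_sum fun g _ => Finset.sum_le_sum
      fun y _ => ?_) (by positivity)
    have hml := isMaxLikelihood_mlEstimator hK p q w g y
    rw [if_pos hml.1]
    split_ifs with h1
    · exact hml.2 _ h1
    · exact h.jointProb_nonneg _ _ _
  refine hle.trans ?_
  rw [successProb_eq, ← choose_inv_mul_sum_const hK η]
  refine mul_le_mul_of_nonneg_left (Finset.sum_le_sum fun C hC => ?_) (by positivity)
  refine le_trans (h.eventProb_mono C ?_) (hη C hC)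
  rintro g y hy ⟨C', hC', hlt⟩
  have hml := isMaxLikelihood_mlEstimator hK p q w g y
  rw [hy] at hml
  exact absurd (hml.2 C' hC') (not_le.2 hlt)

end

/-! ### Log-likelihood scores and the cost of swapping blocks. -/

/-- Log-likelihood ratio of a pair inside the community against a pair outside. -/
noncomputable def edgeScore (p q : ℝ) (P : Prop) : ℝ :=
  if P then Real.log (p / q) else Real.log ((1 - p) / (1 - q))

/-- Total log-likelihood ratio of the pairs joining `i` to `R`. -/
noncomputable def nodeScore {n : ℕ} (p q : ℝ) (g : SimpleGraph (Fin n)) (R : Finset (Fin n))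
    (i : Fin n) : ℝ :=
  ∑ v ∈ R, if i = v then 0 else edgeScore p q (g.Adj i v)

/-- Total log-likelihood ratio between two sets of nodes, counting ordered pairs. -/
noncomputable def crossScore {n : ℕ} (p q : ℝ) (g : SimpleGraph (Fin n))
    (S R : Finset (Fin n)) : ℝ :=
  ∑ u ∈ S, nodeScore p q g R u

/-- Number of edges inside `S`. -/
noncomputable def innerEdges {n : ℕ} (g : SimpleGraph (Fin n)) (S : Finset (Fin n)) : ℕ :=
  ((nodePairs n).filter (fun e => (e.1 ∈ S ∧ e.2 ∈ S) ∧ g.Adj e.1 e.2)).card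

theorem sum_sum_eq_two_mul_nodePairs {n : ℕ} (f : Fin n → Fin n → ℝ)
    (hf : ∀ u v, f u v = f v u) (S : Finset (Fin n)) :
    ∑ u ∈ S, ∑ v ∈ S, (if u = v then 0 else f u v) =
      2 * ∑ e ∈ (nodePairs n).filter (fun e => e.1 ∈ S ∧ e.2 ∈ S), f e.1 e.2 := by
  have h1 : ∑ e ∈ (nodePairs n).filter (fun e => e.1 ∈ S ∧ e.2 ∈ S), f e.1 e.2 =
      ∑ u ∈ S, ∑ v ∈ S, if u < v then f u v else 0 := by
    rw [← Finset.sum_product' S S (fun u v => if u < v then f u v else 0), ← Finset.sum_filter]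
    refine Finset.sum_congr ?_ fun _ _ => rfl
    ext e
    simp [mem_nodePairs, and_comm]
  have h2 : ∑ u ∈ S, ∑ v ∈ S, (if u < v then f u v else 0) =
      ∑ u ∈ S, ∑ v ∈ S, if v < u then f u v else 0 := by
    rw [Finset.sum_comm]
    refine Finset.sum_congr rfl fun u _ => Finset.sum_congr rfl fun v _ => ?_
    rw [hf]
  rw [two_mul, h1]
  nth_rw 2 [h2]
  simp only [← Finset.sum_add_distrib]
  refine Finset.sum_congr rfl fun u _ => Finset.sum_congr rfl fun v _ => ?_
  rcases lt_trichotomy u v with h | h | h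
  · simp [h, h.ne, not_lt_of_gt h]
  · simp [h]
  · simp [h, h.ne', not_lt_of_gt h]

theorem card_nodePairs_filter {n : ℕ} (S : Finset (Fin n)) :
    2 * (((nodePairs n).filter (fun e => e.1 ∈ S ∧ e.2 ∈ S)).card : ℝ) =
      S.card * (S.card - 1) := by
  have := sum_sum_eq_two_mul_nodePairs (fun _ _ => 1) (fun _ _ => rfl) S
  simp only [Finset.sum_const, nsmul_eq_mul, mul_one] at this
  rw [← this]
  have h1 : ∀ u ∈ S, ∑ v ∈ S, (if u = v then (0 : ℝ) else 1) = S.card - 1 := by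
    intro u hu
    have : ∀ v, (if u = v then (0 : ℝ) else 1) = 1 - if u = v then 1 else 0 := by
      intro v; split_ifs <;> norm_num
    simp [this, Finset.sum_sub_distrib, hu]
  rw [Finset.sum_congr rfl h1]
  simp only [Finset.sum_const, nsmul_eq_mul]

section
variable {n : ℕ} {p q : ℝ}

theorem exp_edgeScore (hp : p ∈ Set.Ioo (0 : ℝ) 1) (hq : q ∈ Set.Ioo (0 : ℝ) 1) (P : Prop) :
    bernWeight q P * Real.exp (edgeScore p q P) = bernWeight p P := by
  have h1 : 0 < 1 - p := by linarith [hp.2]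
  have h2 : 0 < 1 - q := by linarith [hq.2]
  have := hp.1
  have := hq.1
  unfold bernWeight edgeScore
  split_ifs
  · rw [Real.exp_log (by positivity)]; field_simp
  · rw [Real.exp_log (by positivity)]; field_simp

theorem crossScore_self (p q : ℝ) (g : SimpleGraph (Fin n)) (S : Finset (Fin n)) :
    crossScore p q g S S =
      2 * ∑ e ∈ (nodePairs n).filter (fun e => e.1 ∈ S ∧ e.2 ∈ S),
        edgeScore p q (g.Adj e.1 e.2) :=
  sum_sum_eq_two_mul_nodePairs (fun u v => edgeScore p q (g.Adj u v))
    (fun u v => by rw [g.adj_comm]) S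

/-- The factor in front does not depend on `C`, so comparing communities reduces to comparing
`crossScore`; the half undoes the double counting of ordered pairs. -/
theorem graphProb_eq_exp (hp : p ∈ Set.Ioo (0 : ℝ) 1) (hq : q ∈ Set.Ioo (0 : ℝ) 1)
    (C : Finset (Fin n)) (g : SimpleGraph (Fin n)) :
    graphProb p q C g = (∏ e ∈ nodePairs n, bernWeight q (g.Adj e.1 e.2)) *
      Real.exp (crossScore p q g C C / 2) := by
  rw [crossScore_self, mul_div_cancel_left₀ _ two_ne_zero, Real.exp_sum, Finset.prod_filter,
    ← Finset.prod_mul_distrib, graphProb_eq_prod]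
  refine Finset.prod_congr rfl fun e _ => ?_
  unfold edgeProb
  split_ifs
  · rw [exp_edgeScore hp hq]
  · rw [mul_one]

theorem graphProb_base_pos (hq : q ∈ Set.Ioo (0 : ℝ) 1) (g : SimpleGraph (Fin n)) :
    0 < ∏ e ∈ nodePairs n, bernWeight q (g.Adj e.1 e.2) := by
  refine Finset.prod_pos fun e _ => ?_
  unfold bernWeight
  split_ifs
  · exact hq.1
  · linarith [hq.2]

theorem crossScore_comm (p q : ℝ) (g : SimpleGraph (Fin n)) (S R : Finset (Fin n)) :
    crossScore p q g S R = crossScore p q g R S := by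
  unfold crossScore nodeScore
  rw [Finset.sum_comm]
  refine Finset.sum_congr rfl fun u _ => Finset.sum_congr rfl fun v _ => ?_
  simp only [eq_comm, g.adj_comm]

theorem crossScore_union_left (p q : ℝ) (g : SimpleGraph (Fin n)) {S S' : Finset (Fin n)}
    (h : Disjoint S S') (R : Finset (Fin n)) :
    crossScore p q g (S ∪ S') R = crossScore p q g S R + crossScore p q g S' R :=
  Finset.sum_union h

theorem crossScore_union_right (p q : ℝ) (g : SimpleGraph (Fin n)) {S S' : Finset (Fin n)}
    (h : Disjoint S S') (R : Finset (Fin n)) :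
    crossScore p q g R (S ∪ S') = crossScore p q g R S + crossScore p q g R S' := by
  rw [crossScore_comm, crossScore_union_left p q g h, crossScore_comm p q g S,
    crossScore_comm p q g S']

/-- Both sets are split over their intersection. The node scores are taken against all of `C`, so
the pairs inside and between the exchanged blocks remain as correction terms. -/
theorem crossScore_swap (p q : ℝ) (g : SimpleGraph (Fin n)) (C C' : Finset (Fin n)) :
    (crossScore p q g C' C' - crossScore p q g C C) / 2 =
      ∑ j ∈ C' \ C, nodeScore p q g C j - ∑ i ∈ C \ C', nodeScore p q g C i
      + crossScore p q g (C' \ C) (C' \ C) / 2 + crossScore p q g (C \ C') (C \ C') / 2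
      - crossScore p q g (C' \ C) (C \ C') := by
  have hC : C = (C ∩ C') ∪ (C \ C') := by ext x; simp; tauto
  have hC' : C' = (C ∩ C') ∪ (C' \ C) := by ext x; simp; tauto
  have d1 : Disjoint (C ∩ C') (C \ C') := by
    rw [Finset.disjoint_left]; intro x; simp; tauto
  have d2 : Disjoint (C ∩ C') (C' \ C) := by
    rw [Finset.disjoint_left]; intro x; simp; tauto
  have e1 : ∑ j ∈ C' \ C, nodeScore p q g C j = crossScore p q g (C' \ C) (C ∩ C') +
      crossScore p q g (C' \ C) (C \ C') := by
    rw [← crossScore_union_right p q g d1, ← hC]; rfl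
  have e2 : ∑ j ∈ C \ C', nodeScore p q g C j = crossScore p q g (C \ C') (C ∩ C') +
      crossScore p q g (C \ C') (C \ C') := by
    rw [← crossScore_union_right p q g d1, ← hC]; rfl
  have e3 : crossScore p q g C' C' = crossScore p q g (C ∩ C') (C ∩ C') +
      2 * crossScore p q g (C' \ C) (C ∩ C') + crossScore p q g (C' \ C) (C' \ C) := by
    conv_lhs => rw [hC']
    rw [crossScore_union_left p q g d2, crossScore_union_right p q g d2,
      crossScore_union_right p q g d2, crossScore_comm p q g (C ∩ C') (C' \ C)]
    ring
  have e4 : crossScore p q g C C = crossScore p q g (C ∩ C') (C ∩ C') +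
      2 * crossScore p q g (C \ C') (C ∩ C') + crossScore p q g (C \ C') (C \ C') := by
    conv_lhs => rw [hC]
    rw [crossScore_union_left p q g d1, crossScore_union_right p q g d1,
      crossScore_union_right p q g d1, crossScore_comm p q g (C ∩ C') (C \ C')]
    ring
  rw [e1, e2, e3, e4]
  ring

theorem edgeScore_false_nonpos (hp : p < 1)
    (hqp : q ≤ p) : Real.log ((1 - p) / (1 - q)) ≤ 0 := by
  have h1 : 0 < 1 - p := by linarith
  have h2 : 0 < 1 - q := by linarith
  refine Real.log_nonpos (by positivity) ?_
  rw [div_le_one h2]; linarith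

theorem log_ratio_nonneg (hq : q ∈ Set.Ioo (0 : ℝ) 1) (hqp : q ≤ p) : 0 ≤ Real.log (p / q) := by
  refine Real.log_nonneg ?_
  rw [one_le_div hq.1]; exact hqp

theorem innerEdges_eq_sum (g : SimpleGraph (Fin n)) (S : Finset (Fin n)) :
    (innerEdges g S : ℝ) = ∑ e ∈ (nodePairs n).filter (fun e => e.1 ∈ S ∧ e.2 ∈ S),
      if g.Adj e.1 e.2 then 1 else 0 := by
  rw [innerEdges, ← Finset.filter_filter, Finset.card_filter, Nat.cast_sum]
  simp only [Nat.cast_ite, Nat.cast_one, Nat.cast_zero]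

theorem crossScore_self_le (hp : p ∈ Set.Ioo (0 : ℝ) 1)
    (hqp : q ≤ p) (g : SimpleGraph (Fin n)) (S : Finset (Fin n)) :
    crossScore p q g S S / 2 ≤ Real.log (p / q) * innerEdges g S := by
  rw [crossScore_self, mul_div_cancel_left₀ _ two_ne_zero, innerEdges_eq_sum, Finset.mul_sum]
  refine Finset.sum_le_sum fun e _ => ?_
  unfold edgeScore
  split_ifs
  · simp
  · simpa using edgeScore_false_nonpos hp.2 hqp

theorem neg_crossScore_le (hp : p ∈ Set.Ioo (0 : ℝ) 1) (hq : q ∈ Set.Ioo (0 : ℝ) 1)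
    (hqp : q ≤ p) (g : SimpleGraph (Fin n)) (S R : Finset (Fin n)) :
    - crossScore p q g S R ≤ S.card * (R.card * - Real.log ((1 - p) / (1 - q))) := by
  have h0 := edgeScore_false_nonpos hp.2 hqp
  have h1 := log_ratio_nonneg (p := p) hq hqp
  unfold crossScore nodeScore
  rw [← Finset.sum_neg_distrib, ← nsmul_eq_mul]
  refine Finset.sum_le_card_nsmul _ _ _ fun u _ => ?_
  rw [← Finset.sum_neg_distrib, ← nsmul_eq_mul]
  refine Finset.sum_le_card_nsmul _ _ _ fun v _ => ?_
  unfold edgeScore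
  split_ifs <;> linarith

/-- Each exchanged pair of nodes loses at least `2 * D` in log-likelihood through `h1` and `h2`. The
corrections in `crossScore_swap` regain at most the left side of `h5` per pair. The margins are
stated multiplicatively so that symbols of probability zero are allowed. -/
theorem jointProb_lt_of_swap {Y : Type} {w : Bool → Y → ℝ} (hw : ∀ x s, 0 ≤ w x s)
    (hp : p ∈ Set.Ioo (0 : ℝ) 1) (hq : q ∈ Set.Ioo (0 : ℝ) 1) (hqp : q ≤ p)
    (g : SimpleGraph (Fin n)) (y : Fin n → Y) {C C' : Finset (Fin n)} {D η : ℝ}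
    (hcard : C'.card = C.card) (hne : C' ≠ C)
    (h1 : ∀ i ∈ C, w false (y i) * Real.exp D < w true (y i) * Real.exp (nodeScore p q g C i))
    (h2 : ∀ j ∉ C, w true (y j) * Real.exp (nodeScore p q g C j) * Real.exp D < w false (y j))
    (h3 : innerEdges g (C \ C') ≤ η * (C \ C').card)
    (h4 : innerEdges g (C' \ C) ≤ η * (C \ C').card)
    (h5 : 2 * η * Real.log (p / q) + (C \ C').card * - Real.log ((1 - p) / (1 - q)) < 2 * D) :
    jointProb p q w C' g y < jointProb p q w C g y := by
  have hl : (C' \ C).card = (C \ C').card := by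
    have a1 := Finset.card_sdiff_add_card_inter C' C
    have a2 := Finset.card_sdiff_add_card_inter C C'
    rw [Finset.inter_comm] at a2
    omega
  have hpos : 0 < (C \ C').card := by
    rw [Finset.card_pos, Finset.nonempty_iff_ne_empty, Ne, Finset.sdiff_eq_empty_iff_subset]
    intro hsub
    exact hne (Finset.eq_of_subset_of_card_le hsub hcard.le).symm
  -- The strict inequalities already force the true labels to have positive weight, so no positivity
  -- hypothesis on `w` is needed.
  have hw1 : ∀ i ∈ C, 0 < w true (y i) := fun i hi =>
    pos_of_mul_pos_left ((mul_nonneg (hw _ _) (Real.exp_pos D).le).trans_lt (h1 i hi))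
      (Real.exp_pos _).le
  have hw0 : ∀ j ∉ C, 0 < w false (y j) := fun j hj =>
    (mul_nonneg (mul_nonneg (hw _ _) (Real.exp_pos _).le) (Real.exp_pos D).le).trans_lt (h2 j hj)
  have hside : 0 < sideProb w C y := by
    refine Finset.prod_pos fun i _ => ?_
    by_cases hi : i ∈ C
    · simpa [hi] using hw1 i hi
    · simpa [hi] using hw0 i hi
  set l : ℝ := ((C \ C').card : ℝ) with hldef
  have hl0 : 0 < l := by rw [hldef]; exact_mod_cast hpos
  have hle : sideProb w C' y ≤ sideProb w C y * Real.exp (∑ i ∈ C \ C', nodeScore p q g C i -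
      ∑ j ∈ C' \ C, nodeScore p q g C j - 2 * l * D) := by
    have hc : ∑ i ∈ C \ C', nodeScore p q g C i - ∑ j ∈ C' \ C, nodeScore p q g C j - 2 * l * D =
        ∑ i, ((if i ∈ C \ C' then nodeScore p q g C i - D else 0) +
          if i ∈ C' \ C then - nodeScore p q g C i - D else 0) := by
      rw [Finset.sum_add_distrib, Finset.sum_ite_mem, Finset.sum_ite_mem, Finset.univ_inter,
        Finset.univ_inter, Finset.sum_sub_distrib, Finset.sum_sub_distrib, Finset.sum_const,
        Finset.sum_const, hl, Finset.sum_neg_distrib, nsmul_eq_mul, ← hldef]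
      ring
    rw [hc, Real.exp_sum]
    unfold sideProb
    rw [← Finset.prod_mul_distrib]
    refine Finset.prod_le_prod (fun i _ => hw _ _) fun i _ => ?_
    by_cases hi : i ∈ C <;> by_cases hi' : i ∈ C'
    · simp [hi, hi']
    · have := h1 i hi
      simp only [hi, hi', Finset.mem_sdiff, not_true_eq_false, not_false_eq_true, and_true,
        and_false, if_true, if_false, add_zero, decide_true, decide_false, Real.exp_sub]
      rw [mul_div_assoc', le_div_iff₀ (Real.exp_pos D)]
      exact this.le
    · have := h2 i hi
      simp only [hi, hi', Finset.mem_sdiff, not_true_eq_false, not_false_eq_true, and_true,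
        and_false, if_true, if_false, zero_add, decide_true, decide_false, Real.exp_sub,
        Real.exp_neg]
      rw [mul_div_assoc', le_div_iff₀ (Real.exp_pos D), ← div_eq_mul_inv,
        le_div_iff₀ (Real.exp_pos _)]
      linarith
    · simp [hi, hi']
  have hbase := graphProb_base_pos (n := n) hq g
  have hfin : crossScore p q g C' C' / 2 + (∑ i ∈ C \ C', nodeScore p q g C i -
      ∑ j ∈ C' \ C, nodeScore p q g C j - 2 * l * D) < crossScore p q g C C / 2 := by
    have e := crossScore_swap p q g C C'
    have b1 := crossScore_self_le hp hqp g (C \ C')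
    have b2 := crossScore_self_le hp hqp g (C' \ C)
    have b3 := neg_crossScore_le hp hq hqp g (C' \ C) (C \ C')
    rw [hl, ← hldef] at b3
    have hT := log_ratio_nonneg (p := p) hq hqp
    have b4 := mul_le_mul_of_nonneg_left h3 hT
    have b5 := mul_le_mul_of_nonneg_left h4 hT
    have b6 := mul_lt_mul_of_pos_left h5 hl0
    nlinarith
  unfold jointProb
  rw [graphProb_eq_exp hp hq, graphProb_eq_exp hp hq, mul_assoc, mul_assoc]
  refine mul_lt_mul_of_pos_left ?_ hbase
  calc Real.exp (crossScore p q g C' C' / 2) * sideProb w C' y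
      ≤ Real.exp (crossScore p q g C' C' / 2) * (sideProb w C y *
        Real.exp (∑ i ∈ C \ C', nodeScore p q g C i -
          ∑ j ∈ C' \ C, nodeScore p q g C j - 2 * l * D)) :=
        mul_le_mul_of_nonneg_left hle (Real.exp_pos _).le
    _ = Real.exp (crossScore p q g C' C' / 2 + (∑ i ∈ C \ C', nodeScore p q g C i -
          ∑ j ∈ C' \ C, nodeScore p q g C j - 2 * l * D)) * sideProb w C y := by
        rw [Real.exp_add]; ring
    _ < Real.exp (crossScore p q g C C / 2) * sideProb w C y :=
        mul_lt_mul_of_pos_right (Real.exp_lt_exp.2 hfin) hside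

end

/-! ### Chernoff and Bhattacharyya bounds, and the union bound for maximum likelihood. -/

/-- The exponent `(1 - s) p + s q - p ^ (1 - s) q ^ s` of the tilted moment. -/
noncomputable def chernoffGap (p q s : ℝ) : ℝ := (1 - s) * p + s * q - p ^ (1 - s) * q ^ s

section
variable {n : ℕ} {p q : ℝ}

theorem mul_exp_neg_log_div {x y : ℝ} (hx : 0 < x) (hy : 0 < y) (s : ℝ) :
    x * Real.exp (-s * Real.log (x / y)) = x ^ (1 - s) * y ^ s := by
  rw [Real.log_div hx.ne' hy.ne', Real.rpow_def_of_pos hx, Real.rpow_def_of_pos hy,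
    ← Real.exp_add]
  nth_rw 1 [← Real.exp_log hx]
  rw [← Real.exp_add]
  congr 1
  ring

theorem mul_exp_log_div {x y : ℝ} (hx : 0 < x) (hy : 0 < y) (s : ℝ) :
    y * Real.exp ((1 - s) * Real.log (x / y)) = x ^ (1 - s) * y ^ s := by
  rw [Real.log_div hx.ne' hy.ne', Real.rpow_def_of_pos hx, Real.rpow_def_of_pos hy,
    ← Real.exp_add]
  nth_rw 1 [← Real.exp_log hy]
  rw [← Real.exp_add]
  congr 1
  ring

/-- Weighted AM-GM is applied to the non-edge term only; the sum is then at most `1 - chernoffGap p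
q s`. -/
theorem tilted_moment_le (hp : p ∈ Set.Ioo (0 : ℝ) 1) (hq : q ∈ Set.Ioo (0 : ℝ) 1) {s : ℝ}
    (hs : s ∈ Set.Icc (0 : ℝ) 1) :
    p ^ (1 - s) * q ^ s + (1 - p) ^ (1 - s) * (1 - q) ^ s ≤ Real.exp (- chernoffGap p q s) := by
  have h := Real.geom_mean_le_arith_mean2_weighted (w₁ := 1 - s) (w₂ := s) (p₁ := 1 - p)
    (p₂ := 1 - q) (by linarith [hs.2]) hs.1 (by linarith [hp.2]) (by linarith [hq.2]) (by ring)
  have h2 := Real.add_one_le_exp (- chernoffGap p q s)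
  unfold chernoffGap at *
  linarith

/-- A member is joined to the `C.card - 1` other members, each pair contributing one tilted factor.
-/
theorem exp_score_true_moment_le (hp : p ∈ Set.Ioo (0 : ℝ) 1) (hq : q ∈ Set.Ioo (0 : ℝ) 1)
    {C : Finset (Fin n)} {i : Fin n} (hi : i ∈ C) {s : ℝ} (hs : s ∈ Set.Icc (0 : ℝ) 1) :
    ∑ g : SimpleGraph (Fin n), graphProb p q C g * Real.exp (-s * nodeScore p q g C i) ≤
      Real.exp (- (((C.card : ℝ) - 1) * chernoffGap p q s)) := by
  have h1 : ∀ g : SimpleGraph (Fin n), Real.exp (-s * nodeScore p q g C i) =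
      ∏ j ∈ C.erase i, Real.exp (-s * edgeScore p q (g.Adj i j)) := by
    intro g
    rw [nodeScore, ← Finset.add_sum_erase C _ hi, if_pos rfl, zero_add, Finset.mul_sum,
      Real.exp_sum]
    refine Finset.prod_congr rfl fun j hj => ?_
    rw [if_neg (Finset.ne_of_mem_erase hj).symm]
  simp only [h1]
  rw [sum_graphProb_mul_star p q C (Finset.notMem_erase i C)
    (fun _ P => Real.exp (-s * edgeScore p q P))]
  have hc : ((C.erase i).card : ℝ) = C.card - 1 := by
    rw [Finset.card_erase_of_mem hi, Nat.cast_sub (Finset.card_pos.2 ⟨i, hi⟩), Nat.cast_one]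
  have h3 : Real.exp (- (((C.card : ℝ) - 1) * chernoffGap p q s)) =
      ∏ j ∈ C.erase i, Real.exp (- chernoffGap p q s) := by
    rw [Finset.prod_const, ← Real.exp_nat_mul, hc]
    congr 1; ring
  rw [h3]
  have hp1 : 0 < 1 - p := by linarith [hp.2]
  have hq1 : 0 < 1 - q := by linarith [hq.2]
  refine Finset.prod_le_prod (fun j hj => ?_) fun j hj => ?_
  · have := edgeProb_mem (Set.Ioo_subset_Icc_self hp) (Set.Ioo_subset_Icc_self hq) C i j
    exact add_nonneg (mul_nonneg this.1 (Real.exp_pos _).le)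
      (mul_nonneg (by linarith [this.2]) (Real.exp_pos _).le)
  · have : edgeProb p q C i j = p := by simp [edgeProb, hi, Finset.mem_of_mem_erase hj]
    rw [this]
    simp only [edgeScore, if_true, if_false]
    rw [mul_exp_neg_log_div hp.1 hq.1, mul_exp_neg_log_div hp1 hq1]
    exact tilted_moment_le hp hq hs

theorem exp_score_false_moment_le (hp : p ∈ Set.Ioo (0 : ℝ) 1) (hq : q ∈ Set.Ioo (0 : ℝ) 1)
    {C : Finset (Fin n)} {i : Fin n} (hi : i ∉ C) {s : ℝ} (hs : s ∈ Set.Icc (0 : ℝ) 1) :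
    ∑ g : SimpleGraph (Fin n), graphProb p q C g * Real.exp ((1 - s) * nodeScore p q g C i) ≤
      Real.exp (- ((C.card : ℝ) * chernoffGap p q s)) := by
  have h1 : ∀ g : SimpleGraph (Fin n), Real.exp ((1 - s) * nodeScore p q g C i) =
      ∏ j ∈ C, Real.exp ((1 - s) * edgeScore p q (g.Adj i j)) := by
    intro g
    rw [nodeScore, Finset.mul_sum, Real.exp_sum]
    refine Finset.prod_congr rfl fun j hj => ?_
    rw [if_neg (by rintro rfl; exact hi hj)]
  simp only [h1]
  rw [sum_graphProb_mul_star p q C hi (fun _ P => Real.exp ((1 - s) * edgeScore p q P))]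
  have h3 : Real.exp (- ((C.card : ℝ) * chernoffGap p q s)) =
      ∏ j ∈ C, Real.exp (- chernoffGap p q s) := by
    rw [Finset.prod_const, ← Real.exp_nat_mul]
    congr 1; ring
  rw [h3]
  have hp1 : 0 < 1 - p := by linarith [hp.2]
  have hq1 : 0 < 1 - q := by linarith [hq.2]
  refine Finset.prod_le_prod (fun j hj => ?_) fun j hj => ?_
  · have := edgeProb_mem (Set.Ioo_subset_Icc_self hp) (Set.Ioo_subset_Icc_self hq) C i j
    exact add_nonneg (mul_nonneg this.1 (Real.exp_pos _).le)
      (mul_nonneg (by linarith [this.2]) (Real.exp_pos _).le)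
  · have : edgeProb p q C i j = q := by simp [edgeProb, hi]
    rw [this]
    simp only [edgeScore, if_true, if_false]
    rw [mul_exp_log_div hp.1 hq.1, mul_exp_log_div hp1 hq1]
    exact tilted_moment_le hp hq hs

/-- Markov's inequality for the likelihood ratio raised to the power `-s`. Multiplying by the symbol
probability `u` turns the label part into `u ^ (1 - s) * v ^ s`, the same expression that
non-members produce with the power `1 - s`. -/
theorem mul_graphEventProb_member_le (hp : p ∈ Set.Ioo (0 : ℝ) 1) (hq : q ∈ Set.Ioo (0 : ℝ) 1)
    {C : Finset (Fin n)} {i : Fin n} (hi : i ∈ C) {s : ℝ} (hs : s ∈ Set.Icc (0 : ℝ) 1)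
    {u v D : ℝ} (hu : 0 ≤ u) (hv : 0 ≤ v) :
    u * graphEventProb p q C (fun g => ¬ v * Real.exp D < u * Real.exp (nodeScore p q g C i)) ≤
      Real.exp (s * D) * (u ^ (1 - s) * v ^ s) *
        Real.exp (- (((C.card : ℝ) - 1) * chernoffGap p q s)) := by
  rcases hu.eq_or_lt with rfl | hu
  · rw [zero_mul]; positivity
  have h1 : graphEventProb p q C
      (fun g => ¬ v * Real.exp D < u * Real.exp (nodeScore p q g C i)) ≤
      ∑ g, graphProb p q C g *
        ((v / u) ^ s * Real.exp (s * D) * Real.exp (-s * nodeScore p q g C i)) := by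
    refine graphEventProb_le_of_indicator_le (Set.Ioo_subset_Icc_self hp)
      (Set.Ioo_subset_Icc_self hq) C _ _ fun g => ?_
    by_cases h : v * Real.exp D < u * Real.exp (nodeScore p q g C i)
    · rw [if_neg (not_not.2 h)]
      positivity
    · rw [if_pos h]
      rw [not_lt] at h
      have e : (v / u) ^ s * Real.exp (s * D) * Real.exp (-s * nodeScore p q g C i) =
          (v / u * Real.exp D * Real.exp (-nodeScore p q g C i)) ^ s := by
        rw [Real.mul_rpow (by positivity) (by positivity),
          Real.mul_rpow (by positivity) (by positivity), ← Real.exp_mul, ← Real.exp_mul]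
        congr 2 <;> ring_nf
      rw [e]
      refine Real.one_le_rpow ?_ hs.1
      rw [Real.exp_neg, ← div_eq_mul_inv, le_div_iff₀ (Real.exp_pos _), one_mul, div_mul_eq_mul_div,
        le_div_iff₀ hu]
      linarith
  have h2 : ∑ g, graphProb p q C g *
        ((v / u) ^ s * Real.exp (s * D) * Real.exp (-s * nodeScore p q g C i)) =
      (v / u) ^ s * Real.exp (s * D) *
        ∑ g, graphProb p q C g * Real.exp (-s * nodeScore p q g C i) := by
    rw [Finset.mul_sum]
    exact Finset.sum_congr rfl fun g _ => by ring
  rw [h2] at h1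
  have h3 := mul_le_mul_of_nonneg_left (exp_score_true_moment_le hp hq hi hs)
    (show 0 ≤ (v / u) ^ s * Real.exp (s * D) by positivity)
  have h4 : u * (v / u) ^ s = u ^ (1 - s) * v ^ s := by
    rw [Real.div_rpow hv hu.le, Real.rpow_sub hu, Real.rpow_one]
    ring
  calc _ ≤ u * ((v / u) ^ s * Real.exp (s * D) *
        Real.exp (- (((C.card : ℝ) - 1) * chernoffGap p q s))) :=
        mul_le_mul_of_nonneg_left (h1.trans h3) hu.le
    _ = _ := by rw [← h4]; ring

theorem mul_graphEventProb_nonmember_le (hp : p ∈ Set.Ioo (0 : ℝ) 1)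
    (hq : q ∈ Set.Ioo (0 : ℝ) 1)
    {C : Finset (Fin n)} {i : Fin n} (hi : i ∉ C) {s : ℝ} (hs : s ∈ Set.Icc (0 : ℝ) 1)
    {u v D : ℝ} (hu : 0 ≤ u) (hv : 0 ≤ v) :
    v * graphEventProb p q C (fun g => ¬ u * Real.exp (nodeScore p q g C i) * Real.exp D < v) ≤
      Real.exp ((1 - s) * D) * (u ^ (1 - s) * v ^ s) *
        Real.exp (- ((C.card : ℝ) * chernoffGap p q s)) := by
  rcases hv.eq_or_lt with rfl | hv
  · rw [zero_mul]; positivity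
  have hs1 : 0 ≤ 1 - s := by linarith [hs.2]
  have h1 : graphEventProb p q C
      (fun g => ¬ u * Real.exp (nodeScore p q g C i) * Real.exp D < v) ≤
      ∑ g, graphProb p q C g *
        ((u / v) ^ (1 - s) * Real.exp ((1 - s) * D) *
          Real.exp ((1 - s) * nodeScore p q g C i)) := by
    refine graphEventProb_le_of_indicator_le (Set.Ioo_subset_Icc_self hp)
      (Set.Ioo_subset_Icc_self hq) C _ _ fun g => ?_
    by_cases h : u * Real.exp (nodeScore p q g C i) * Real.exp D < v
    · rw [if_neg (not_not.2 h)]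
      positivity
    · rw [if_pos h]
      rw [not_lt] at h
      have e : (u / v) ^ (1 - s) * Real.exp ((1 - s) * D) *
          Real.exp ((1 - s) * nodeScore p q g C i) =
          (u / v * Real.exp D * Real.exp (nodeScore p q g C i)) ^ (1 - s) := by
        rw [Real.mul_rpow (by positivity) (by positivity),
          Real.mul_rpow (by positivity) (by positivity), ← Real.exp_mul, ← Real.exp_mul]
        congr 2 <;> ring_nf
      rw [e]
      refine Real.one_le_rpow ?_ hs1
      rw [div_mul_eq_mul_div, div_mul_eq_mul_div, le_div_iff₀ hv]
      linarith
  have h2 : ∑ g, graphProb p q C g *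
        ((u / v) ^ (1 - s) * Real.exp ((1 - s) * D) *
          Real.exp ((1 - s) * nodeScore p q g C i)) =
      (u / v) ^ (1 - s) * Real.exp ((1 - s) * D) *
        ∑ g, graphProb p q C g * Real.exp ((1 - s) * nodeScore p q g C i) := by
    rw [Finset.mul_sum]
    exact Finset.sum_congr rfl fun g _ => by ring
  rw [h2] at h1
  have h3 := mul_le_mul_of_nonneg_left (exp_score_false_moment_le hp hq hi hs)
    (show 0 ≤ (u / v) ^ (1 - s) * Real.exp ((1 - s) * D) by positivity)
  have h4 : v * (u / v) ^ (1 - s) = u ^ (1 - s) * v ^ s := by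
    rw [Real.div_rpow hu hv.le, Real.rpow_sub hv, Real.rpow_one]
    have : 0 < v ^ s := Real.rpow_pos_of_pos hv s
    field_simp
  calc _ ≤ v * ((u / v) ^ (1 - s) * Real.exp ((1 - s) * D) *
        Real.exp (- ((C.card : ℝ) * chernoffGap p q s))) :=
        mul_le_mul_of_nonneg_left (h1.trans h3) hv.le
    _ = _ := by rw [← h4]; ring

theorem edgeProb_le (hqp : q ≤ p) (C : Finset (Fin n)) (u v : Fin n) : edgeProb p q C u v ≤ p := by
  unfold edgeProb; split_ifs <;> linarith

theorem exp_mean_le {r p t : ℝ} (hr : 0 ≤ r) (hrp : r ≤ p) :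
    r * Real.exp t + (1 - r) ≤ Real.exp (p * Real.exp t) := by
  have h1 := Real.add_one_le_exp (p * Real.exp t)
  have h2 := mul_le_mul_of_nonneg_right hrp (Real.exp_pos t).le
  linarith

/-- Exponential Markov with every edge probability bounded by `p` and the number of pairs in `S`
crudely by its squared size. -/
theorem graphEventProb_innerEdges_le (hp : p ∈ Set.Ioo (0 : ℝ) 1) (hq : q ∈ Set.Ioo (0 : ℝ) 1)
    (hqp : q ≤ p) (C S : Finset (Fin n)) {t x : ℝ} (ht : 0 ≤ t) :
    graphEventProb p q C (fun g => x < innerEdges g S) ≤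
      Real.exp (S.card * (S.card * (p * Real.exp t)) - t * x) := by
  have h1 : graphEventProb p q C (fun g => x < innerEdges g S) ≤
      ∑ g, graphProb p q C g * (Real.exp (-(t * x)) * Real.exp (t * innerEdges g S)) := by
    refine graphEventProb_le_of_indicator_le (Set.Ioo_subset_Icc_self hp)
      (Set.Ioo_subset_Icc_self hq) C _ _ fun g => ?_
    split_ifs with h
    · rw [← Real.exp_add]
      refine Real.one_le_exp ?_
      nlinarith
    · positivity
  refine h1.trans ?_
  have h2 : ∑ g, graphProb p q C g * (Real.exp (-(t * x)) * Real.exp (t * innerEdges g S)) =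
      Real.exp (-(t * x)) * ∑ g, graphProb p q C g * Real.exp (t * innerEdges g S) := by
    rw [Finset.mul_sum]
    exact Finset.sum_congr rfl fun g _ => by ring
  have h3 : ∀ g : SimpleGraph (Fin n), Real.exp (t * innerEdges g S) = ∏ e ∈ nodePairs n,
      if e.1 ∈ S ∧ e.2 ∈ S then Real.exp (t * if g.Adj e.1 e.2 then 1 else 0) else 1 := by
    intro g
    rw [innerEdges_eq_sum, Finset.mul_sum, Real.exp_sum, Finset.prod_filter]
  rw [h2]
  simp only [h3]
  rw [sum_graphProb_mul_prod p q C (fun e P =>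
    if e.1 ∈ S ∧ e.2 ∈ S then Real.exp (t * if P then 1 else 0) else 1), sub_eq_neg_add,
    Real.exp_add]
  refine mul_le_mul_of_nonneg_left ?_ (Real.exp_pos _).le
  refine le_trans (Finset.prod_le_prod (g := fun e =>
    if e.1 ∈ S ∧ e.2 ∈ S then Real.exp (p * Real.exp t) else 1) (fun e _ => ?_) fun e _ => ?_) ?_
  · have := edgeProb_mem (Set.Ioo_subset_Icc_self hp) (Set.Ioo_subset_Icc_self hq) C e.1 e.2
    have h5 : 0 ≤ 1 - edgeProb p q C e.1 e.2 := by linarith [this.2]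
    have := this.1
    split_ifs <;> positivity
  · have h5 := edgeProb_mem (Set.Ioo_subset_Icc_self hp) (Set.Ioo_subset_Icc_self hq) C e.1 e.2
    have := exp_mean_le (t := t) h5.1 (edgeProb_le hqp C e.1 e.2)
    by_cases h : e.1 ∈ S ∧ e.2 ∈ S
    · simp only [h, if_true, if_false, and_self, mul_one, mul_zero, Real.exp_zero]
      exact this
    · simp only [h, if_false]
      linarith
  rw [← Finset.prod_filter, Finset.prod_const, ← Real.exp_nat_mul]
  refine Real.exp_le_exp.2 ?_
  rw [← mul_assoc (S.card : ℝ)]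
  refine mul_le_mul_of_nonneg_right ?_ (mul_nonneg hp.1.le (Real.exp_pos t).le)
  have := card_nodePairs_filter S
  have h0 : (0 : ℝ) ≤ S.card := Nat.cast_nonneg _
  nlinarith

/-- The Bhattacharyya coefficient factorises over pairs. Only pairs inside `C` but not inside `C'`
are kept; every other factor is at most 1 by AM-GM. -/
theorem sum_sqrt_graphProb_le (hp : p ∈ Set.Ioo (0 : ℝ) 1) (hq : q ∈ Set.Ioo (0 : ℝ) 1)
    (C C' : Finset (Fin n)) :
    ∑ g : SimpleGraph (Fin n), Real.sqrt (graphProb p q C g * graphProb p q C' g) ≤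
      Real.exp (- (((nodePairs n).filter (fun e => (e.1 ∈ C ∧ e.2 ∈ C) ∧
        ¬ (e.1 ∈ C' ∧ e.2 ∈ C'))).card * chernoffGap p q (1 / 2))) := by
  have hpI := Set.Ioo_subset_Icc_self hp
  have hqI := Set.Ioo_subset_Icc_self hq
  have h1 : ∀ g : SimpleGraph (Fin n), Real.sqrt (graphProb p q C g * graphProb p q C' g) =
      ∏ e ∈ nodePairs n, Real.sqrt (bernWeight (edgeProb p q C e.1 e.2) (g.Adj e.1 e.2) *
        bernWeight (edgeProb p q C' e.1 e.2) (g.Adj e.1 e.2)) := by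
    intro g
    rw [graphProb_eq_prod, graphProb_eq_prod, ← Finset.prod_mul_distrib, Real.sqrt_eq_rpow,
      ← Real.finsetProd_rpow _ _ fun e _ => mul_nonneg
        (bernWeight_nonneg (edgeProb_mem hpI hqI C _ _) _)
        (bernWeight_nonneg (edgeProb_mem hpI hqI C' _ _) _)]
    simp only [Real.sqrt_eq_rpow]
  simp only [h1]
  rw [sum_graph_prod (fun e P => Real.sqrt (bernWeight (edgeProb p q C e.1 e.2) P *
        bernWeight (edgeProb p q C' e.1 e.2) P))]
  have h2 : Real.exp (- (((nodePairs n).filter (fun e => (e.1 ∈ C ∧ e.2 ∈ C) ∧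
        ¬ (e.1 ∈ C' ∧ e.2 ∈ C'))).card * chernoffGap p q (1 / 2))) =
      ∏ e ∈ nodePairs n, if (e.1 ∈ C ∧ e.2 ∈ C) ∧ ¬ (e.1 ∈ C' ∧ e.2 ∈ C') then
        Real.exp (- chernoffGap p q (1 / 2)) else 1 := by
    rw [← Finset.prod_filter, Finset.prod_const, ← Real.exp_nat_mul]
    congr 1; ring
  rw [h2]
  refine Finset.prod_le_prod (fun e _ => by positivity) fun e _ => ?_
  have hsq : ∀ x y : ℝ, 0 ≤ x → 0 ≤ y → Real.sqrt (x * y) ≤ (x + y) / 2 := fun x y hx hy => by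
    rw [Real.sqrt_le_left (by positivity)]
    nlinarith [sq_nonneg (x - y)]
  split_ifs with h
  · have e1 : edgeProb p q C e.1 e.2 = p := if_pos h.1
    have e2 : edgeProb p q C' e.1 e.2 = q := if_neg h.2
    have h3 := tilted_moment_le hp hq (s := 1 / 2) (by norm_num)
    have hp1 : 0 ≤ 1 - p := by linarith [hp.2]
    rw [e1, e2]
    simp only [bernWeight, if_true, if_false]
    rw [Real.sqrt_mul hp.1.le, Real.sqrt_mul hp1]
    simp only [Real.sqrt_eq_rpow]
    norm_num at h3 ⊢
    exact h3
  · have b1 := edgeProb_mem hpI hqI C e.1 e.2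
    have b2 := edgeProb_mem hpI hqI C' e.1 e.2
    have h3 := hsq _ _ b1.1 b2.1
    have h4 := hsq (1 - edgeProb p q C e.1 e.2) (1 - edgeProb p q C' e.1 e.2)
      (by linarith [b1.2]) (by linarith [b2.2])
    simp only [bernWeight, if_true, if_false]
    linarith

theorem card_nodePairs_diff_ge (C C' : Finset (Fin n)) :
    ((C \ C').card : ℝ) * (C.card - 1) ≤
      2 * ((nodePairs n).filter (fun e => (e.1 ∈ C ∧ e.2 ∈ C) ∧
        ¬ (e.1 ∈ C' ∧ e.2 ∈ C'))).card := by
  have h1 := card_nodePairs_filter C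
  have h2 := card_nodePairs_filter (C ∩ C')
  have h3 : ((nodePairs n).filter (fun e => e.1 ∈ C ∧ e.2 ∈ C)).card =
      ((nodePairs n).filter (fun e => e.1 ∈ C ∩ C' ∧ e.2 ∈ C ∩ C')).card +
      ((nodePairs n).filter (fun e => (e.1 ∈ C ∧ e.2 ∈ C) ∧
        ¬ (e.1 ∈ C' ∧ e.2 ∈ C'))).card := by
    rw [← Finset.card_filter_add_card_filter_not (s := (nodePairs n).filter
      (fun e => e.1 ∈ C ∧ e.2 ∈ C)) (fun e => e.1 ∈ C' ∧ e.2 ∈ C'), Finset.filter_filter,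
      Finset.filter_filter]
    congr 2
    refine Finset.filter_congr fun e _ => ?_
    simp only [Finset.mem_inter]; tauto
  have h4 : ((C \ C').card : ℝ) + (C ∩ C').card = C.card := by
    exact_mod_cast Finset.card_sdiff_add_card_inter C C'
  have h3' : (((nodePairs n).filter (fun e => e.1 ∈ C ∧ e.2 ∈ C)).card : ℝ) =
      ((nodePairs n).filter (fun e => e.1 ∈ C ∩ C' ∧ e.2 ∈ C ∩ C')).card +
      ((nodePairs n).filter (fun e => (e.1 ∈ C ∧ e.2 ∈ C) ∧
        ¬ (e.1 ∈ C' ∧ e.2 ∈ C'))).card := by exact_mod_cast h3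
  have h5 : (0 : ℝ) ≤ (C \ C').card := Nat.cast_nonneg _
  have h6 : (0 : ℝ) ≤ (C ∩ C').card := Nat.cast_nonneg _
  nlinarith

end

/-- The labels are discarded here, since their Bhattacharyya coefficient is at most 1; the graph
alone separates distant communities. -/
theorem IsModel.eventProb_jointProb_le {n : ℕ} {Y : Type} [Fintype Y] {p q : ℝ}
    {w : Bool → Y → ℝ} (h : IsModel p q w) (hp : p ∈ Set.Ioo (0 : ℝ) 1)
    (hq : q ∈ Set.Ioo (0 : ℝ) 1) (C C' : Finset (Fin n))
    (hgap : 0 ≤ chernoffGap p q (1 / 2)) :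
    eventProb p q w C (fun g y => jointProb p q w C g y ≤ jointProb p q w C' g y) ≤
      Real.exp (- ((C \ C').card * (C.card - 1) / 2 * chernoffGap p q (1 / 2))) := by
  have h1 : eventProb p q w C (fun g y => jointProb p q w C g y ≤ jointProb p q w C' g y) ≤
      ∑ g, ∑ y, Real.sqrt (graphProb p q C g * graphProb p q C' g) *
        ((sideProb w C y + sideProb w C' y) / 2) := by
    refine Finset.sum_le_sum fun g _ => Finset.sum_le_sum fun y _ => ?_
    have a1 := h.sideProb_nonneg C y
    have a2 := h.sideProb_nonneg C' y
    have a3 := graphProb_nonneg h.hp h.hq C g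
    have a4 := graphProb_nonneg h.hp h.hq C' g
    split_ifs with hle
    · rw [mul_one]
      -- When the competitor's likelihood is at least as large, the true likelihood is below the
      -- geometric mean of the two.
      have b1 : jointProb p q w C g y ≤
          Real.sqrt (jointProb p q w C g y * jointProb p q w C' g y) := by
        refine Real.le_sqrt_of_sq_le ?_
        rw [sq]
        exact mul_le_mul_of_nonneg_left hle (h.jointProb_nonneg C g y)
      refine b1.trans ?_
      have b2 : jointProb p q w C g y * jointProb p q w C' g y =
          (graphProb p q C g * graphProb p q C' g) * (sideProb w C y * sideProb w C' y) := by
        unfold jointProb; ring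
      rw [b2, Real.sqrt_mul (mul_nonneg a3 a4)]
      refine mul_le_mul_of_nonneg_left ?_ (Real.sqrt_nonneg _)
      rw [Real.sqrt_le_left (by positivity)]
      nlinarith [sq_nonneg (sideProb w C y - sideProb w C' y)]
    · rw [mul_zero]; positivity
  refine h1.trans ?_
  simp only [← Finset.mul_sum, ← Finset.sum_div, Finset.sum_add_distrib, h.sum_sideProb]
  rw [← Finset.sum_mul]
  norm_num only [mul_one]
  refine (sum_sqrt_graphProb_le hp hq C C').trans (Real.exp_le_exp.2 ?_)
  have := mul_le_mul_of_nonneg_right (card_nodePairs_diff_ge C C') hgap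
  linarith

theorem sum_pow_card_nonempty (n : ℕ) (x : ℝ) :
    ∑ S ∈ (Finset.univ : Finset (Finset (Fin n))).filter (fun S => S.Nonempty), x ^ S.card =
      (1 + x) ^ n - 1 := by
  have h1 := Finset.prod_one_add (ι := Fin n) (R := ℝ) (f := fun _ => x) Finset.univ
  rw [Finset.prod_const, Finset.card_univ, Fintype.card_fin, Finset.powerset_univ] at h1
  simp only [Finset.prod_const] at h1
  rw [h1, ← Finset.sum_filter_add_sum_filter_not Finset.univ (fun S => S.Nonempty)]
  have h2 : (Finset.univ : Finset (Finset (Fin n))).filter (fun S => ¬ S.Nonempty) = {∅} := by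
    ext S; simp
  rw [h2]
  simp

theorem chernoffGap_nonneg {p q s : ℝ} (hp : 0 ≤ p) (hq : 0 ≤ q) (hs : s ∈ Set.Icc (0 : ℝ) 1) :
    0 ≤ chernoffGap p q s := by
  have := Real.geom_mean_le_arith_mean2_weighted (w₁ := 1 - s) (w₂ := s) (p₁ := p)
    (p₂ := q) (by linarith [hs.2]) hs.1 hp hq (by ring)
  unfold chernoffGap
  linarith

/-- If maximum likelihood may fail, then a node lacks the margin `D`, or a set of at most `M` nodes
spans too many edges, or a competitor missing more than `M` members of `C` wins. The three terms of
the bound pay for these events in that order. The tilt may depend on the symbol shown. -/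
theorem IsModel.eventProb_ml_fails_le {n : ℕ} {Y : Type} [Fintype Y] {p q : ℝ}
    {w : Bool → Y → ℝ} (h : IsModel p q w) (hp : p ∈ Set.Ioo (0 : ℝ) 1)
    (hq : q ∈ Set.Ioo (0 : ℝ) 1) (hqp : q ≤ p) {K : ℕ} (hK : 1 ≤ K) {s : Y → ℝ}
    (hs : ∀ x, s x ∈ Set.Icc (0 : ℝ) 1) {D η t M φ ψ : ℝ} (hD : 0 ≤ D) (ht : 0 ≤ t)
    (hη : 2 * η * Real.log (p / q) + M * - Real.log ((1 - p) / (1 - q)) < 2 * D)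
    (hφ : ∀ x, w true x ^ (1 - s x) * w false x ^ s x *
      Real.exp (- (((K : ℝ) - 1) * chernoffGap p q (s x))) ≤ φ)
    (hψ : M * (p * Real.exp t) - t * η ≤ -ψ)
    {C : Finset (Fin n)} (hC : C ∈ Finset.powersetCard K Finset.univ) :
    eventProb p q w C (fun g y => ∃ C' ∈ Finset.powersetCard K Finset.univ, C' ≠ C ∧
        jointProb p q w C g y ≤ jointProb p q w C' g y) ≤
      n * (Fintype.card Y * (Real.exp D * φ)) + ((1 + Real.exp (-ψ)) ^ n - 1) +
        n.choose K * Real.exp (- (M * (K - 1) / 2 * chernoffGap p q (1 / 2))) := by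
  have hCK : C.card = K := (Finset.mem_powersetCard.1 hC).2
  have hK1 : (0 : ℝ) ≤ (K : ℝ) - 1 := by
    have : (1 : ℝ) ≤ K := by exact_mod_cast hK
    linarith
  let bad : Fin n → SimpleGraph (Fin n) → Y → Prop := fun i g x =>
    if i ∈ C then ¬ w false x * Real.exp D < w true x * Real.exp (nodeScore p q g C i)
    else ¬ w true x * Real.exp (nodeScore p q g C i) * Real.exp D < w false x
  have hbad : ∀ i, eventProb p q w C (fun g y => bad i g (y i)) ≤
      Fintype.card Y * (Real.exp D * φ) := by
    intro i
    rw [h.eventProb_node C i (bad i), ← nsmul_eq_mul]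
    refine Finset.sum_le_card_nsmul _ _ _ fun x _ => ?_
    have hpow : 0 ≤ w true x ^ (1 - s x) * w false x ^ s x :=
      mul_nonneg (Real.rpow_nonneg (h.nonneg _ _) _) (Real.rpow_nonneg (h.nonneg _ _) _)
    -- One estimate serves both classes: the margin factor has `c = s` and `K - 1` partners for
    -- members, `c = 1 - s` and `K` partners for non-members.
    have key : ∀ c : ℝ, c ≤ 1 → ∀ k : ℝ, (K : ℝ) - 1 ≤ k →
        Real.exp (c * D) * (w true x ^ (1 - s x) * w false x ^ s x) *
        Real.exp (- (k * chernoffGap p q (s x))) ≤ Real.exp D * φ := by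
      intro c hc k hk
      rw [mul_assoc]
      refine mul_le_mul (Real.exp_le_exp.2 (by nlinarith)) ((mul_le_mul_of_nonneg_left
        (Real.exp_le_exp.2 ?_) hpow).trans (hφ x)) (mul_nonneg hpow (Real.exp_pos _).le)
        (Real.exp_pos _).le
      have := chernoffGap_nonneg hp.1.le hq.1.le (hs x)
      nlinarith
    by_cases hi : i ∈ C
    · simp only [bad, hi, if_true, decide_true]
      refine (mul_graphEventProb_member_le hp hq hi (hs x) (h.nonneg _ _) (h.nonneg _ _)).trans ?_
      rw [hCK]
      exact key _ (hs x).2 _ le_rfl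
    · simp only [bad, hi, if_false, decide_false]
      refine (mul_graphEventProb_nonmember_le hp hq hi (hs x) (h.nonneg _ _)
        (h.nonneg _ _)).trans ?_
      rw [hCK]
      exact key _ (by linarith [(hs x).1]) _ (by linarith)
  let small : Finset (Finset (Fin n)) := Finset.univ.filter (fun S => S.Nonempty ∧ (S.card : ℝ) ≤ M)
  let far : Finset (Finset (Fin n)) :=
    (Finset.powersetCard K Finset.univ).filter (fun C' => M < ((C \ C').card : ℝ))
  have hincl : ∀ g y, (∃ C' ∈ Finset.powersetCard K Finset.univ, C' ≠ C ∧
        jointProb p q w C g y ≤ jointProb p q w C' g y) →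
      ((∃ i ∈ Finset.univ, bad i g (y i)) ∨ (∃ S ∈ small, η * S.card < innerEdges g S)) ∨
        ∃ C' ∈ far, jointProb p q w C g y ≤ jointProb p q w C' g y := by
    rintro g y ⟨C', hC', hne, hle⟩
    by_contra hcon
    rw [not_or, not_or] at hcon
    obtain ⟨⟨hA, hB⟩, hF⟩ := hcon
    have hM : ((C \ C').card : ℝ) ≤ M := by
      by_contra hlt
      exact hF ⟨C', Finset.mem_filter.2 ⟨hC', not_le.1 hlt⟩, hle⟩
    have hcard : C'.card = C.card := by rw [hCK, (Finset.mem_powersetCard.1 hC').2]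
    have hl : (C' \ C).card = (C \ C').card := by
      have a1 := Finset.card_sdiff_add_card_inter C' C
      have a2 := Finset.card_sdiff_add_card_inter C C'
      rw [Finset.inter_comm] at a2
      omega
    have hS : ∀ S : Finset (Fin n), S.card = (C \ C').card →
        (innerEdges g S : ℝ) ≤ η * (C \ C').card := by
      intro S hS
      by_contra hlt
      have hne' : S.Nonempty := by
        rw [← Finset.card_pos, hS, Finset.card_pos, Finset.nonempty_iff_ne_empty, Ne,
          Finset.sdiff_eq_empty_iff_subset]
        intro hsub
        exact hne (Finset.eq_of_subset_of_card_le hsub hcard.le).symm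
      refine hB ⟨S, Finset.mem_filter.2 ⟨Finset.mem_univ _, hne', by rw [hS]; exact hM⟩, ?_⟩
      rw [hS]
      exact not_le.1 hlt
    refine absurd (jointProb_lt_of_swap h.nonneg hp hq hqp g y hcard hne (D := D) (η := η)
      ?_ ?_ (hS _ rfl) (hS _ hl) ?_) (not_lt.2 hle)
    · intro i hi
      by_contra hlt
      exact hA ⟨i, Finset.mem_univ _, by simp only [bad, hi, if_true]; exact hlt⟩
    · intro i hi
      by_contra hlt
      exact hA ⟨i, Finset.mem_univ _, by simp only [bad, hi, if_false]; exact hlt⟩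
    · have := edgeScore_false_nonpos hp.2 hqp
      nlinarith
  refine (h.eventProb_mono C hincl).trans ((h.eventProb_or_le C _ _).trans
    (add_le_add ((h.eventProb_or_le C _ _).trans (add_le_add ?_ ?_)) ?_))
  · refine (h.eventProb_exists_le C Finset.univ (fun i g y => bad i g (y i))).trans ?_
    have := Finset.sum_le_card_nsmul Finset.univ
      (fun i => eventProb p q w C (fun g y => bad i g (y i))) _ (fun i _ => hbad i)
    simpa using this
  · refine (h.eventProb_exists_le C small _).trans ?_
    -- Each small set contributes at most `exp (-ψ)` to the power of its size; dropping the size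
    -- restriction gives a binomial sum in closed form.
    rw [← sum_pow_card_nonempty]
    refine le_trans (Finset.sum_le_sum (g := fun S => Real.exp (-ψ) ^ S.card) fun S hS => ?_)
      (Finset.sum_le_sum_of_subset_of_nonneg ?_ fun _ _ _ => by positivity)
    · rw [h.eventProb_graph C (fun g => η * S.card < innerEdges g S)]
      refine (graphEventProb_innerEdges_le hp hq hqp C S ht).trans ?_
      rw [← Real.exp_nat_mul]
      refine Real.exp_le_exp.2 ?_
      have hSM := (Finset.mem_filter.1 hS).2.2
      have h0 : (0 : ℝ) ≤ S.card := Nat.cast_nonneg _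
      have h1 : (S.card : ℝ) * (p * Real.exp t) ≤ M * (p * Real.exp t) :=
        mul_le_mul_of_nonneg_right hSM (mul_nonneg hp.1.le (Real.exp_pos t).le)
      nlinarith
    · intro S hS
      exact Finset.mem_filter.2 ⟨Finset.mem_univ _, (Finset.mem_filter.1 hS).2.1⟩
  · refine (h.eventProb_exists_le C far _).trans ?_
    have hgap := chernoffGap_nonneg hp.1.le hq.1.le (s := 1 / 2) (by norm_num)
    have h1 : ∀ C' ∈ far, eventProb p q w C
        (fun g y => jointProb p q w C g y ≤ jointProb p q w C' g y) ≤
        Real.exp (- (M * (K - 1) / 2 * chernoffGap p q (1 / 2))) := by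
      intro C' hC'
      refine (h.eventProb_jointProb_le hp hq C C' hgap).trans (Real.exp_le_exp.2 ?_)
      rw [hCK]
      have := (Finset.mem_filter.1 hC').2
      have h2 : M * ((K : ℝ) - 1) ≤ (C \ C').card * ((K : ℝ) - 1) :=
        mul_le_mul_of_nonneg_right this.le hK1
      have h3 := mul_le_mul_of_nonneg_right h2 hgap
      linarith
    refine (Finset.sum_le_card_nsmul _ _ _ h1).trans ?_
    rw [nsmul_eq_mul]
    refine mul_le_mul_of_nonneg_right ?_ (Real.exp_pos _).le
    have h4 : far.card ≤ n.choose K := by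
      refine (Finset.card_filter_le _ _).trans ?_
      simp
    exact_mod_cast h4

/-! ### Asymptotic scales and achievability. -/

theorem tendsto_log_nat : Tendsto (fun n : ℕ => Real.log n) atTop atTop :=
  Real.tendsto_log_atTop.comp tendsto_natCast_atTop_atTop

theorem tendsto_log_pow_div_nat (k : ℕ) :
    Tendsto (fun n : ℕ => Real.log n ^ k / n) atTop (𝓝 0) := by
  have h := (Real.isLittleO_pow_log_id_atTop (n := k)).tendsto_div_nhds_zero
  exact h.comp tendsto_natCast_atTop_atTop

theorem tendsto_size_scale {ρ : ℝ} {K : ℕ → ℕ}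
    (hK : ∀ᶠ n : ℕ in atTop, |(K n : ℝ) - ρ * n / Real.log n| < 1) :
    Tendsto (fun n : ℕ => (K n : ℝ) * Real.log n / n) atTop (𝓝 ρ) := by
  have h0 := tendsto_log_pow_div_nat 1
  simp only [pow_one] at h0
  rw [tendsto_iff_norm_sub_tendsto_zero]
  refine tendsto_of_tendsto_of_tendsto_of_le_of_le' tendsto_const_nhds h0
    (Eventually.of_forall fun n => norm_nonneg _) ?_
  filter_upwards [hK, tendsto_log_nat.eventually_gt_atTop 0, eventually_gt_atTop 0]
    with n hn hL hn0
  have hn0' : (0 : ℝ) < n := by exact_mod_cast hn0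
  have e : (K n : ℝ) * Real.log n / n - ρ =
      ((K n : ℝ) - ρ * n / Real.log n) * (Real.log n / n) := by field_simp
  rw [e, norm_mul, Real.norm_eq_abs, Real.norm_of_nonneg (by positivity)]
  exact mul_le_of_le_one_left (by positivity) hn.le

theorem tendsto_size_pred_scale {ρ : ℝ} {K : ℕ → ℕ}
    (hK : ∀ᶠ n : ℕ in atTop, |(K n : ℝ) - ρ * n / Real.log n| < 1) :
    Tendsto (fun n : ℕ => ((K n : ℝ) - 1) * Real.log n / n) atTop (𝓝 ρ) := by
  have h0 := tendsto_log_pow_div_nat 1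
  have h := (tendsto_size_scale hK).sub h0
  rw [sub_zero] at h
  refine h.congr fun n => ?_
  rw [pow_one]; ring

theorem tendsto_edgeScale (c : ℝ) : Tendsto (edgeScale c) atTop (𝓝 0) := by
  have := (tendsto_log_pow_div_nat 2).const_mul c
  rw [mul_zero] at this
  refine this.congr fun n => ?_
  unfold edgeScale; ring

theorem eventually_edgeScale_mem {c : ℝ} (hc : 0 < c) :
    ∀ᶠ n in atTop, edgeScale c n ∈ Set.Ioo (0 : ℝ) 1 := by
  filter_upwards [(tendsto_edgeScale c).eventually_lt_const one_pos,
    tendsto_log_nat.eventually_gt_atTop 0, eventually_gt_atTop 0] with n h1 hL hn0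
  have hn0' : (0 : ℝ) < n := by exact_mod_cast hn0
  exact ⟨by unfold edgeScale; positivity, h1⟩

theorem eventually_size_le {ρ : ℝ} {K : ℕ → ℕ}
    (hK : ∀ᶠ n : ℕ in atTop, |(K n : ℝ) - ρ * n / Real.log n| < 1) :
    ∀ᶠ n in atTop, 2 * K n ≤ n := by
  have h := (tendsto_size_scale hK).mul (tendsto_inv_atTop_zero.comp tendsto_log_nat)
  rw [mul_zero] at h
  filter_upwards [h.eventually_lt_const (show (0 : ℝ) < 1 / 2 by norm_num),
    tendsto_log_nat.eventually_gt_atTop 0, eventually_gt_atTop 0] with n h1 hL hn0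
  have hn0' : (0 : ℝ) < n := by exact_mod_cast hn0
  simp only [Function.comp] at h1
  have e : (K n : ℝ) * Real.log n / n * (Real.log n)⁻¹ = K n / n := by field_simp
  rw [e, div_lt_iff₀ hn0'] at h1
  have : (2 : ℝ) * K n ≤ n := by linarith
  exact_mod_cast this

theorem tendsto_size_atTop {ρ : ℝ} (hρ : 0 < ρ) {K : ℕ → ℕ}
    (hK : ∀ᶠ n : ℕ in atTop, |(K n : ℝ) - ρ * n / Real.log n| < 1) :
    Tendsto (fun n => (K n : ℝ)) atTop atTop := by
  have h0 : Tendsto (fun n : ℕ => (n : ℝ) / Real.log n) atTop atTop := by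
    have h := tendsto_log_pow_div_nat 1
    have h2 : Tendsto (fun n : ℕ => Real.log n ^ 1 / n) atTop (𝓝[>] 0) := by
      refine tendsto_nhdsWithin_iff.2 ⟨h, ?_⟩
      filter_upwards [tendsto_log_nat.eventually_gt_atTop 0, eventually_gt_atTop 0] with n hL hn0
      have hn0' : (0 : ℝ) < n := by exact_mod_cast hn0
      exact Set.mem_Ioi.2 (by positivity)
    refine (tendsto_inv_nhdsGT_zero.comp h2).congr fun n => ?_
    simp
  refine ((tendsto_size_scale hK).pos_mul_atTop hρ h0).congr' ?_
  filter_upwards [tendsto_log_nat.eventually_gt_atTop 0, eventually_gt_atTop 0] with n hL hn0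
  have hn0' : (0 : ℝ) < n := by exact_mod_cast hn0
  field_simp

theorem chernoffGap_mul {x a b s : ℝ} (hx : 0 < x) (ha : 0 ≤ a) (hb : 0 ≤ b) :
    chernoffGap (a * x) (b * x) s = x * chernoffGap a b s := by
  unfold chernoffGap
  rw [Real.mul_rpow ha hx.le, Real.mul_rpow hb hx.le]
  have : x ^ (1 - s) * x ^ s = x := by
    rw [← Real.rpow_add hx]; simp
  linear_combination (- (a ^ (1 - s) * b ^ s)) * this

theorem chernoffGap_edgeScale {a b : ℝ} (ha : 0 ≤ a) (hb : 0 ≤ b) {n : ℕ} (hn : 0 < n)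
    (hL : 0 < Real.log n) (s : ℝ) :
    chernoffGap (edgeScale a n) (edgeScale b n) s = Real.log n ^ 2 / n * chernoffGap a b s := by
  have hn0' : (0 : ℝ) < n := by exact_mod_cast hn
  rw [← chernoffGap_mul (by positivity) ha hb]
  unfold edgeScale
  rw [mul_div_assoc, mul_div_assoc]

theorem chernoffGap_half_pos {a b : ℝ} (hb : 0 < b) (hab : b < a) :
    0 < chernoffGap a b (1 / 2) := by
  have ha := hb.trans hab
  unfold chernoffGap
  norm_num
  rw [← Real.sqrt_eq_rpow, ← Real.sqrt_eq_rpow]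
  have h1 := Real.sq_sqrt ha.le
  have h2 := Real.sq_sqrt hb.le
  have h3 := Real.sqrt_lt_sqrt hb.le hab
  nlinarith [mul_pos (sub_pos.2 h3) (sub_pos.2 h3)]

theorem choose_le_exp {n K : ℕ} (hK : 1 ≤ K) (hKn : K ≤ n) :
    (n.choose K : ℝ) ≤ Real.exp (K * (1 + Real.log (n / K))) := by
  have hK0 : (0 : ℝ) < K := by exact_mod_cast hK
  have hn0 : (0 : ℝ) < n := by exact_mod_cast (show 0 < n by omega)
  have h1 := Nat.choose_le_pow_div (α := ℝ) K n
  have h2 : (K : ℝ) ^ K / K.factorial ≤ Real.exp K := by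
    exact Real.pow_div_factorial_le_exp _ hK0.le K
  have hf : (0 : ℝ) < K.factorial := by exact_mod_cast K.factorial_pos
  refine h1.trans ?_
  rw [mul_add, mul_one, Real.exp_add, Real.exp_nat_mul, Real.exp_log (by positivity), div_pow]
  calc (n : ℝ) ^ K / K.factorial = (K : ℝ) ^ K / K.factorial * ((n : ℝ) ^ K / (K : ℝ) ^ K) := by
        field_simp
    _ ≤ _ := mul_le_mul_of_nonneg_right h2 (by positivity)

theorem tendsto_log_log_div_log :
    Tendsto (fun n : ℕ => Real.log (Real.log n) / Real.log n) atTop (𝓝 0) := by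
  have h := Real.isLittleO_log_id_atTop.tendsto_div_nhds_zero
  exact h.comp tendsto_log_nat

/-- The size `K ~ ρ n / log n` is what makes this work: the entropy per community node is `log (n /
K) ~ log log n`, while the exponent per node is of order `log n`. -/
theorem tendsto_choose_mul_exp {ρ c : ℝ} (hρ : 0 < ρ) (hc : 0 < c) {K : ℕ → ℕ}
    (hK : ∀ᶠ n : ℕ in atTop, |(K n : ℝ) - ρ * n / Real.log n| < 1) :
    Tendsto (fun n : ℕ => (n.choose (K n) : ℝ) * Real.exp (- (K n * ((K n : ℝ) - 1) *
      (Real.log n ^ 2 / n * c)))) atTop (𝓝 0) := by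
  have hKinf := tendsto_size_atTop hρ hK
  have h1 : Tendsto (fun n : ℕ => (Real.log n)⁻¹ + (Real.log (Real.log n) / Real.log n -
      Real.log (K n * Real.log n / n) * (Real.log n)⁻¹) -
      ((K n : ℝ) - 1) * Real.log n / n * c) atTop (𝓝 (0 + (0 - Real.log ρ * 0) - ρ * c)) := by
    have hinv := tendsto_inv_atTop_zero.comp tendsto_log_nat
    refine (hinv.add (tendsto_log_log_div_log.sub (Tendsto.mul ?_ hinv))).sub
      ((tendsto_size_pred_scale hK).mul_const c)
    exact (Real.continuousAt_log hρ.ne').tendsto.comp (tendsto_size_scale hK)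
  have h2 := (h1.neg.pos_mul_atTop (by simp; positivity) tendsto_log_nat)
  have h3 := hKinf.atTop_mul_atTop₀ h2
  have h4 := Real.tendsto_exp_neg_atTop_nhds_zero.comp h3
  refine tendsto_of_tendsto_of_tendsto_of_le_of_le' tendsto_const_nhds h4
    (Eventually.of_forall fun n => by positivity) ?_
  filter_upwards [hKinf.eventually_ge_atTop 1, eventually_size_le hK,
    tendsto_log_nat.eventually_gt_atTop 0, eventually_gt_atTop 0] with n hK1 hKn hL hn0
  have hn0' : (0 : ℝ) < n := by exact_mod_cast hn0
  have hK1' : 1 ≤ K n := by exact_mod_cast hK1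
  have hK0 : (0 : ℝ) < K n := by linarith
  refine (mul_le_mul_of_nonneg_right (choose_le_exp hK1' (by omega)) (Real.exp_pos _).le).trans ?_
  rw [← Real.exp_add]
  refine Real.exp_le_exp.2 (le_of_eq ?_)
  beta_reduce
  rw [Real.log_div (by positivity) (by positivity), Real.log_div (by positivity) (by positivity),
    Real.log_mul (by positivity) (by positivity)]
  field_simp
  ring

theorem neg_log_ratio_le {p q : ℝ} (hp : p ∈ Set.Ioo (0 : ℝ) 1) (hq : q ∈ Set.Ioo (0 : ℝ) 1)
    (hp2 : p ≤ 1 / 2) : - Real.log ((1 - p) / (1 - q)) ≤ 2 * p := by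
  have h1 : 0 < 1 - p := by linarith [hp.2]
  have h2 : 0 < 1 - q := by linarith [hq.2]
  rw [Real.log_div h1.ne' h2.ne']
  have h3 : Real.log (1 - q) ≤ 0 := Real.log_nonpos h2.le (by linarith [hq.1])
  have h4 := Real.one_sub_inv_le_log_of_pos h1
  have h5 : (1 - p)⁻¹ ≤ 1 + 2 * p := by
    rw [inv_le_iff_one_le_mul₀ h1]
    nlinarith [hp.1]
  linarith

/-- If for every symbol some tilt makes the joint error exponent of label and graph exceed 1 by `δ`,
the union bound over nodes closes. Part of `δ` is spent on the margin `D` and part on replacing `ρ`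
by the actual community size. -/
theorem exactRecovery_of_exponent {Y : Type} [Fintype Y] {ρ a b : ℝ} (hρ : 0 < ρ) (hb : 0 < b)
    (hab : b < a) {K : ℕ → ℕ} (hK : ∀ᶠ n : ℕ in atTop, |(K n : ℝ) - ρ * n / Real.log n| < 1)
    {w : ℕ → Bool → Y → ℝ} (hw : ∀ n x s, 0 ≤ w n x s) (hw1 : ∀ n x, ∑ s, w n x s = 1)
    {s : Y → ℝ} (hs : ∀ x, s x ∈ Set.Icc (0 : ℝ) 1) {δ : ℝ} (hδ : 0 < δ)
    (H : ∀ᶠ n : ℕ in atTop, ∀ x, w n true x ^ (1 - s x) * w n false x ^ s x *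
      Real.exp (- (ρ * chernoffGap a b (s x)) * Real.log n) ≤
        Real.exp (- (1 + δ) * Real.log n)) :
    ExactRecovery K (edgeScale a) (edgeScale b) w := by
  have ha := hb.trans hab
  refine ⟨fun n => mlEstimator (K n) (edgeScale a n) (edgeScale b n) (w n), ?_⟩
  set T := Real.log (a / b) with hT
  have hTpos : 0 < T := Real.log_pos (by rwa [one_lt_div hb])
  -- With `η = ε log n` the edges inside the exchanged blocks cost `2 * ε * T * log n = (δ / 4) *
  -- log n`, half of the budget `2 * D`.
  set ε := δ / (8 * T) with hε
  have hεpos : 0 < ε := by positivity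
  -- This makes `t * η = 3 * log n`, leaving `2 * log n` for `ψ` after a loss of `log n` in the
  -- moment.
  set t := 3 / ε with ht
  have htpos : 0 < t := by positivity
  -- With `M = δ₁ * K`, the first bound keeps `M * p * exp t` below `log n`; the second keeps the
  -- non-edge correction `2 * M * p` below `(δ / 8) * log n`.
  set δ₁ := min (1 / (2 * ρ * a * Real.exp t)) (δ / (32 * ρ * a)) with hδ₁
  have hδ₁pos : 0 < δ₁ := lt_min (by positivity) (by positivity)
  have hδ₁a : δ₁ * (2 * ρ * a * Real.exp t) ≤ 1 := by
    rw [← le_div_iff₀ (by positivity)]; exact min_le_left _ _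
  have hδ₁b : δ₁ * (32 * ρ * a) ≤ δ := by
    rw [← le_div_iff₀ (by positivity)]; exact min_le_right _ _
  have hgap := chernoffGap_half_pos hb hab
  have hKinf := tendsto_size_atTop hρ hK
  have hF : Tendsto (fun n : ℕ => 1 - (Fintype.card Y * Real.exp (-(δ / 2 * Real.log n)) +
      (Real.exp (Real.exp (-Real.log n)) - 1) +
      n.choose (K n) * Real.exp (- (K n * ((K n : ℝ) - 1) *
        (Real.log n ^ 2 / n * (δ₁ / 2 * chernoffGap a b (1 / 2))))))) atTop (𝓝 1) := by
    have e1 : Tendsto (fun n : ℕ => Real.exp (-(δ / 2 * Real.log n))) atTop (𝓝 0) :=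
      Real.tendsto_exp_neg_atTop_nhds_zero.comp (tendsto_log_nat.const_mul_atTop (by positivity))
    have e2 : Tendsto (fun n : ℕ => Real.exp (-(Real.log n))) atTop (𝓝 0) :=
      Real.tendsto_exp_neg_atTop_nhds_zero.comp tendsto_log_nat
    have e3 := (Real.continuous_exp.tendsto 0).comp e2
    have e4 := tendsto_choose_mul_exp hρ (show 0 < δ₁ / 2 * chernoffGap a b (1 / 2) by positivity)
      hK
    have := (((e1.const_mul (Fintype.card Y : ℝ)).add (e3.sub_const 1)).add e4).const_sub 1
    simpa [Function.comp_def] using this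
  have hall : ∀ᶠ n : ℕ in atTop, ∀ x,
      (ρ - ((K n : ℝ) - 1) * Real.log n / n) * chernoffGap a b (s x) < δ / 4 := by
    refine eventually_all.2 fun x => ?_
    have := ((tendsto_size_pred_scale hK).const_sub ρ).mul_const (chernoffGap a b (s x))
    rw [sub_self, zero_mul] at this
    exact this.eventually_lt_const (by positivity)
  have hev := H.and (hall.and (hKinf.eventually_ge_atTop 1))
  have hmain : ∀ᶠ n : ℕ in atTop, 2 * K n ≤ n ∧ IsModel (edgeScale a n) (edgeScale b n) (w n) ∧
      1 - (Fintype.card Y * Real.exp (-(δ / 2 * Real.log n)) +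
      (Real.exp (Real.exp (-Real.log n)) - 1) +
      n.choose (K n) * Real.exp (- (K n * ((K n : ℝ) - 1) *
        (Real.log n ^ 2 / n * (δ₁ / 2 * chernoffGap a b (1 / 2)))))) ≤
      successProb n (K n) (edgeScale a n) (edgeScale b n) (w n)
        (mlEstimator (K n) (edgeScale a n) (edgeScale b n) (w n)) := by
    filter_upwards [hev, eventually_size_le hK, tendsto_log_nat.eventually_gt_atTop 0,
      eventually_gt_atTop 0, eventually_edgeScale_mem ha, eventually_edgeScale_mem hb,
      (tendsto_edgeScale a).eventually_le_const (show (0 : ℝ) < 1 / 2 by norm_num),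
      (tendsto_size_scale hK).eventually_le_const (show ρ < 2 * ρ by linarith)]
      with n ⟨hH, hx, hK1⟩ hKn hL hn0 hp hq hp2 hKs
    have hn0' : (0 : ℝ) < n := by exact_mod_cast hn0
    have hK1' : 1 ≤ K n := by exact_mod_cast hK1
    have hM : IsModel (edgeScale a n) (edgeScale b n) (w n) :=
      ⟨Set.Ioo_subset_Icc_self hp, Set.Ioo_subset_Icc_self hq, hw n, hw1 n⟩
    refine ⟨hKn, hM, ?_⟩
    have hqp : edgeScale b n ≤ edgeScale a n := by
      unfold edgeScale; gcongr
    have hratio : edgeScale a n / edgeScale b n = a / b := by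
      unfold edgeScale; field_simp
    have hKp : (K n : ℝ) * edgeScale a n ≤ 2 * ρ * a * Real.log n := by
      have : (K n : ℝ) * edgeScale a n = (K n : ℝ) * Real.log n / n * (a * Real.log n) := by
        unfold edgeScale; ring
      rw [this]
      calc _ ≤ 2 * ρ * (a * Real.log n) := mul_le_mul_of_nonneg_right hKs (by positivity)
        _ = _ := by ring
    have hexpn : (n : ℝ) = Real.exp (Real.log n) := (Real.exp_log hn0').symm
    have key := hM.le_successProb_mlEstimator (show K n ≤ n by omega) fun C hC =>
      hM.eventProb_ml_fails_le hp hq hqp hK1' hs (D := δ / 4 * Real.log n) (η := ε * Real.log n)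
        (t := t) (M := δ₁ * K n) (φ := Real.exp (-(1 + 3 * δ / 4) * Real.log n))
        (ψ := 2 * Real.log n) (by positivity) htpos.le ?_ ?_ ?_ hC
    · refine le_trans ?_ key
      -- The exponent `1 + δ` has lost `δ / 4` in `φ` and `δ / 4` in `exp D`; the factor `n` then
      -- leaves `δ / 2`.
      have e1 : (n : ℝ) * (Fintype.card Y * (Real.exp (δ / 4 * Real.log n) *
          Real.exp (-(1 + 3 * δ / 4) * Real.log n))) =
          Fintype.card Y * Real.exp (-(δ / 2 * Real.log n)) := by
        nth_rw 1 [hexpn]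
        rw [mul_left_comm, ← Real.exp_add, ← Real.exp_add]
        congr 2; ring
      have e2 : (1 + Real.exp (-(2 * Real.log n))) ^ n ≤ Real.exp (Real.exp (-Real.log n)) := by
        have a1 := Real.add_one_le_exp (Real.exp (-(2 * Real.log n)))
        calc (1 + Real.exp (-(2 * Real.log n))) ^ n
            ≤ Real.exp (Real.exp (-(2 * Real.log n))) ^ n :=
              pow_le_pow_left₀ (by positivity) (by linarith) n
          _ = Real.exp (n * Real.exp (-(2 * Real.log n))) := (Real.exp_nat_mul _ _).symm
          _ = _ := by
              nth_rw 1 [hexpn]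
              rw [← Real.exp_add]
              congr 2; ring
      have e3 : δ₁ * (K n : ℝ) * ((K n : ℝ) - 1) / 2 *
          chernoffGap (edgeScale a n) (edgeScale b n) (1 / 2) = K n * ((K n : ℝ) - 1) *
          (Real.log n ^ 2 / n * (δ₁ / 2 * chernoffGap a b (1 / 2))) := by
        rw [chernoffGap_edgeScale ha.le hb.le hn0 hL]; ring
      rw [e1, e3]
      linarith
    · rw [hratio]
      have k1 := neg_log_ratio_le hp hq hp2
      have k2 : δ₁ * K n * - Real.log ((1 - edgeScale a n) / (1 - edgeScale b n)) ≤
          δ₁ * K n * (2 * edgeScale a n) := mul_le_mul_of_nonneg_left k1 (by positivity)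
      have k3 : δ₁ * K n * (2 * edgeScale a n) ≤ δ₁ * (2 * (2 * ρ * a * Real.log n)) := by
        rw [mul_assoc]
        exact mul_le_mul_of_nonneg_left (by linarith) hδ₁pos.le
      have k4 : δ₁ * (2 * (2 * ρ * a * Real.log n)) = δ₁ * (32 * ρ * a) * Real.log n / 8 := by ring
      have k5 := mul_le_mul_of_nonneg_right hδ₁b hL.le
      have k6 : 2 * (ε * Real.log n) * Real.log (a / b) = δ / 4 * Real.log n := by
        rw [← hT, hε]; field_simp; ring
      have k7 := mul_pos hδ hL
      rw [k6]
      linarith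
    · intro x
      have k1 := hx x
      have k2 := hH x
      have hpow : 0 ≤ w n true x ^ (1 - s x) * w n false x ^ s x :=
        mul_nonneg (Real.rpow_nonneg (hw _ _ _) _) (Real.rpow_nonneg (hw _ _ _) _)
      have k3 : - (((K n : ℝ) - 1) * chernoffGap (edgeScale a n) (edgeScale b n) (s x)) ≤
          - (ρ * chernoffGap a b (s x)) * Real.log n + δ / 4 * Real.log n := by
        rw [chernoffGap_edgeScale ha.le hb.le hn0 hL]
        have k4 := mul_le_mul_of_nonneg_right k1.le hL.le
        have k5 : ((K n : ℝ) - 1) * (Real.log n ^ 2 / n * chernoffGap a b (s x)) =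
          ((K n : ℝ) - 1) * Real.log n / n * chernoffGap a b (s x) * Real.log n := by ring
        rw [k5]
        linarith
      calc _ ≤ w n true x ^ (1 - s x) * w n false x ^ s x *
            Real.exp (- (ρ * chernoffGap a b (s x)) * Real.log n + δ / 4 * Real.log n) :=
            mul_le_mul_of_nonneg_left (Real.exp_le_exp.2 k3) hpow
        _ ≤ Real.exp (- (1 + δ) * Real.log n) * Real.exp (δ / 4 * Real.log n) := by
            rw [Real.exp_add, ← mul_assoc]
            exact mul_le_mul_of_nonneg_right k2 (Real.exp_pos _).le
        _ = _ := by rw [← Real.exp_add]; congr 1; ring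
    · have k1 : t * (ε * Real.log n) = 3 * Real.log n := by
        rw [ht]; field_simp
      have k2 : δ₁ * K n * (edgeScale a n * Real.exp t) ≤
          δ₁ * (2 * ρ * a * Real.exp t) * Real.log n := by
        calc _ = δ₁ * Real.exp t * (K n * edgeScale a n) := by ring
          _ ≤ δ₁ * Real.exp t * (2 * ρ * a * Real.log n) :=
            mul_le_mul_of_nonneg_left hKp (by positivity)
          _ = _ := by ring
      have k3 := mul_le_mul_of_nonneg_right hδ₁a hL.le
      rw [k1]
      linarith
  refine tendsto_of_tendsto_of_tendsto_of_le_of_le' hF tendsto_const_nhds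
    (hmain.mono fun n h => h.2.2) (hmain.mono fun n h => h.2.1.successProb_le_one (by omega) _)

/-! ### Converse for fixed `n`: a pair of nodes worth exchanging. -/

/-- The binomial probability of `k` successes in `N` trials. -/
noncomputable def binomProb (N : ℕ) (r : ℝ) (k : ℕ) : ℝ :=
  (N.choose k : ℝ) * r ^ k * (1 - r) ^ (N - k)

theorem nodeScore_eq {n : ℕ} (p q : ℝ) (g : SimpleGraph (Fin n)) (R : Finset (Fin n))
    (i : Fin n) : nodeScore p q g R i =
      (R.filter (g.Adj i)).card * (Real.log (p / q) - Real.log ((1 - p) / (1 - q))) +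
        (R.card - if i ∈ R then 1 else 0) * Real.log ((1 - p) / (1 - q)) := by
  have h1 : ∀ v, (if i = v then 0 else edgeScore p q (g.Adj i v)) =
      (if g.Adj i v then 1 else 0) * (Real.log (p / q) - Real.log ((1 - p) / (1 - q))) +
        (1 - if i = v then 1 else 0) * Real.log ((1 - p) / (1 - q)) := by
    intro v
    by_cases hv : i = v
    · subst hv; simp
    · by_cases ha : g.Adj i v <;> simp [hv, ha, edgeScore]
  unfold nodeScore
  rw [Finset.sum_congr rfl fun v _ => h1 v, Finset.sum_add_distrib, ← Finset.sum_mul,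
    ← Finset.sum_mul, Finset.sum_boole, Finset.sum_sub_distrib, Finset.sum_ite_eq]
  simp

/-- Equal symbols cancel in the label likelihood. A lead of two neighbours is required because the
pair `i, j` may itself be an edge, in which case a lead of one would only give a tie. -/
theorem jointProb_lt_of_exchange {n : ℕ} {Y : Type} {p q : ℝ} {w : Bool → Y → ℝ}
    (hp : p ∈ Set.Ioo (0 : ℝ) 1) (hq : q ∈ Set.Ioo (0 : ℝ) 1) (hqp : q < p)
    {g : SimpleGraph (Fin n)} {y : Fin n → Y} {C : Finset (Fin n)} {i j : Fin n}
    (hi : i ∈ C) (hj : j ∉ C) (hy : y i = y j) (hpos : 0 < jointProb p q w C g y)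
    (he : (C.filter (g.Adj i)).card + 1 < (C.filter (g.Adj j)).card) :
    jointProb p q w C g y < jointProb p q w (insert j (C.erase i)) g y := by
  have hij : i ≠ j := fun h => hj (h ▸ hi)
  have hside : sideProb w (insert j (C.erase i)) y = sideProb w C y := by
    unfold sideProb
    rw [← Finset.mul_prod_erase Finset.univ _ (Finset.mem_univ i),
      ← Finset.mul_prod_erase (Finset.univ.erase i) _
        (Finset.mem_erase.2 ⟨hij.symm, Finset.mem_univ j⟩),
      ← Finset.mul_prod_erase Finset.univ (fun k => w (decide (k ∈ C)) (y k)) (Finset.mem_univ i),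
      ← Finset.mul_prod_erase (Finset.univ.erase i) (fun k => w (decide (k ∈ C)) (y k))
        (Finset.mem_erase.2 ⟨hij.symm, Finset.mem_univ j⟩)]
    have h1 : ∏ x ∈ (Finset.univ.erase i).erase j,
        w (decide (x ∈ insert j (C.erase i))) (y x) =
        ∏ x ∈ (Finset.univ.erase i).erase j, w (decide (x ∈ C)) (y x) := by
      refine Finset.prod_congr rfl fun x hx => ?_
      simp only [Finset.mem_erase, Finset.mem_univ, and_true] at hx
      simp [hx.1, hx.2]
    rw [h1]
    simp only [Finset.mem_insert, Finset.mem_erase, hi, hj, hij, hy, decide_true, decide_false,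
      ne_eq, not_true_eq_false, false_and, true_or, or_false]
    ring
  have hgraph : 0 < graphProb p q C g := by
    rw [graphProb_eq_exp hp hq]
    exact mul_pos (graphProb_base_pos hq g) (Real.exp_pos _)
  have hs : 0 < sideProb w C y := pos_of_mul_pos_right hpos hgraph.le
  unfold jointProb
  rw [hside]
  refine mul_lt_mul_of_pos_right ?_ hs
  rw [graphProb_eq_exp hp hq, graphProb_eq_exp hp hq]
  refine mul_lt_mul_of_pos_left (Real.exp_lt_exp.2 ?_) (graphProb_base_pos hq g)
  have hsw := crossScore_swap p q g C (insert j (C.erase i))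
  have d1 : insert j (C.erase i) \ C = {j} := by
    ext x
    simp only [Finset.mem_sdiff, Finset.mem_insert, Finset.mem_erase, Finset.mem_singleton]
    constructor
    · tauto
    · rintro rfl; exact ⟨Or.inl rfl, hj⟩
  have d2 : C \ insert j (C.erase i) = {i} := by
    ext x
    simp only [Finset.mem_sdiff, Finset.mem_insert, Finset.mem_erase, Finset.mem_singleton]
    constructor
    · tauto
    · rintro rfl; exact ⟨hi, by tauto⟩
  rw [d1, d2] at hsw
  have c1 : ∀ u, crossScore p q g {u} {u} = 0 := fun u => by simp [crossScore, nodeScore]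
  have c2 : crossScore p q g {j} {i} = edgeScore p q (g.Adj j i) := by
    simp [crossScore, nodeScore, hij.symm]
  rw [Finset.sum_singleton, Finset.sum_singleton, c1, c1, c2, nodeScore_eq p q g C,
    nodeScore_eq p q g C, if_neg hj, if_pos hi] at hsw
  have hT : 0 < Real.log (p / q) := Real.log_pos (by rwa [one_lt_div hq.1])
  have hk := edgeScore_false_nonpos hp.2 hqp.le
  have he' : ((C.filter (g.Adj i)).card : ℝ) + 1 + 1 ≤ (C.filter (g.Adj j)).card := by
    exact_mod_cast he
  have hsc : edgeScore p q (g.Adj j i) ≤ Real.log (p / q) := by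
    unfold edgeScore; split_ifs <;> linarith
  nlinarith

section
variable {n : ℕ} {Y : Type} [Fintype Y] {p q : ℝ} {w : Bool → Y → ℝ}

/-- The stars from `I` to `R` and the symbols are all independent, so the probability is a power of
`1 - w x y₀ * binomProb R.card r k`, bounded by an exponential. -/
theorem IsModel.eventProb_no_star_le (h : IsModel p q w) {C I R : Finset (Fin n)}
    (hIR : Disjoint I R) {x : Bool} (hx : ∀ i ∈ I, decide (i ∈ C) = x) {r : ℝ}
    (hr : ∀ i ∈ I, ∀ j ∈ R, edgeProb p q C i j = r) (y₀ : Y) (k : ℕ) (hr0 : 0 ≤ r) (hr1 : r ≤ 1) :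
    eventProb p q w C (fun g y => ¬ ∃ i ∈ I, y i = y₀ ∧ (R.filter (g.Adj i)).card = k) ≤
      Real.exp (-(I.card * (w x y₀ * binomProb R.card r k))) := by
  have h1 : ∀ (g : SimpleGraph (Fin n)) (y : Fin n → Y) (A : Prop),
      (A ↔ ¬ ∃ i ∈ I, y i = y₀ ∧ (R.filter (g.Adj i)).card = k) →
      (if A then (1 : ℝ) else 0) = ∏ i ∈ I, (1 - (if y i = y₀ then 1 else 0) *
        if (R.filter (g.Adj i)).card = k then 1 else 0) := by
    intro g y A hA
    split_ifs with hc
    · rw [hA] at hc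
      rw [Finset.prod_eq_one]
      intro i hi
      by_cases h1 : y i = y₀ <;> by_cases h2 : (R.filter (g.Adj i)).card = k
      · exact absurd ⟨i, hi, h1, h2⟩ hc
      all_goals simp [h1, h2]
    · rw [hA, not_not] at hc
      obtain ⟨i, hi, h1, h2⟩ := hc
      rw [Finset.prod_eq_zero hi]
      simp [h1, h2]
  have h2 : ∀ y : Fin n → Y, ∑ g : SimpleGraph (Fin n), graphProb p q C g * ∏ i ∈ I, (1 - (if y i = y₀ then 1 else 0) *
        if (R.filter (g.Adj i)).card = k then 1 else 0) =
      ∏ i ∈ I, (1 - (if y i = y₀ then 1 else 0) * binomProb R.card r k) := by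
    intro y
    rw [sum_graphProb_prod_stars p q C I R hIR (fun i U => 1 - (if y i = y₀ then 1 else 0) *
        if U.card = k then 1 else 0)]
    refine Finset.prod_congr rfl fun i hi => ?_
    have hiR : i ∉ R := Finset.disjoint_left.1 hIR hi
    have := sum_graphProb_card_star p q C hiR (hr i hi) k
    simp only [mul_sub, mul_one, Finset.sum_sub_distrib, sum_graphProb]
    rw [binomProb, ← this, Finset.mul_sum]
    congr 1
    exact Finset.sum_congr rfl fun g _ => by ring
  have h3 : eventProb p q w C
      (fun g y => ¬ ∃ i ∈ I, y i = y₀ ∧ (R.filter (g.Adj i)).card = k) =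
      ∑ y : Fin n → Y, sideProb w C y *
        ∏ i ∈ I, (1 - (if y i = y₀ then 1 else 0) * binomProb R.card r k) := by
    unfold eventProb jointProb
    rw [Finset.sum_comm]
    refine Finset.sum_congr rfl fun y _ => ?_
    rw [← h2, Finset.mul_sum]
    refine Finset.sum_congr rfl fun g _ => ?_
    rw [h1 g y _ Iff.rfl]; ring
  have h4 := sum_sideProb_mul_prod w C (fun i s =>
    if i ∈ I then 1 - (if s = y₀ then 1 else 0) * binomProb R.card r k else 1)
  have h5 : ∀ y : Fin n → Y, ∏ i ∈ I, (1 - (if y i = y₀ then 1 else 0) * binomProb R.card r k) =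
      ∏ i, if i ∈ I then 1 - (if y i = y₀ then 1 else 0) * binomProb R.card r k else 1 := by
    intro y
    rw [Finset.prod_ite_mem, Finset.univ_inter]
  rw [h3]
  simp only [h5]
  rw [h4]
  have h6 : ∀ i, ∑ s, w (decide (i ∈ C)) s *
      (if i ∈ I then 1 - (if s = y₀ then 1 else 0) * binomProb R.card r k else 1) =
      if i ∈ I then 1 - w x y₀ * binomProb R.card r k else 1 := by
    intro i
    split_ifs with hi
    · rw [hx i hi]
      simp only [mul_sub, mul_one, Finset.sum_sub_distrib, h.sum_eq, ← mul_assoc, mul_ite, mul_zero,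
        ← Finset.sum_mul, Finset.sum_ite_eq', Finset.mem_univ, if_true]
    · simp [h.sum_eq]
  simp only [h6]
  rw [Finset.prod_ite_mem, Finset.univ_inter, Finset.prod_const, ← mul_neg, Real.exp_nat_mul]
  rcases I.eq_empty_or_nonempty with rfl | ⟨i, hi⟩
  · simp
  refine pow_le_pow_left₀ ?_ ?_ _
  · have hw : w x y₀ ≤ 1 := by
      rw [← h.sum_eq x]
      exact Finset.single_le_sum (fun s _ => h.nonneg x s) (Finset.mem_univ y₀)
    have hb1 : binomProb R.card r k ≤ 1 := by
      have hiR : i ∉ R := Finset.disjoint_left.1 hIR hi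
      rw [binomProb, ← sum_graphProb_card_star p q C hiR (hr i hi) k]
      refine le_trans (Finset.sum_le_sum fun g _ => mul_le_of_le_one_right
        (graphProb_nonneg h.hp h.hq C g) ?_) (sum_graphProb p q C).le
      split_ifs <;> norm_num
    have hb0 : 0 ≤ binomProb R.card r k := by
      have : 0 ≤ 1 - r := by linarith
      unfold binomProb; positivity
    nlinarith [h.nonneg x y₀]
  · have := Real.add_one_le_exp (-(w x y₀ * binomProb R.card r k))
    linarith

theorem graphEventProb_star_gt_le (hp : p ∈ Set.Ioo (0 : ℝ) 1) (hq : q ∈ Set.Ioo (0 : ℝ) 1)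
    (hqp : q ≤ p) (C I : Finset (Fin n)) (i : Fin n) {t x : ℝ} (ht : 0 ≤ t) :
    graphEventProb p q C (fun g => x < (I.filter (g.Adj i)).card) ≤
      Real.exp (I.card * (p * Real.exp t) - t * x) := by
  have h1 : graphEventProb p q C (fun g => x < (I.filter (g.Adj i)).card) ≤
      ∑ g : SimpleGraph (Fin n), graphProb p q C g * (Real.exp (-(t * x)) *
        ∏ j ∈ I.erase i, Real.exp (t * if g.Adj i j then 1 else 0)) := by
    refine graphEventProb_le_of_indicator_le (Set.Ioo_subset_Icc_self hp)
      (Set.Ioo_subset_Icc_self hq) C _ _ fun g => ?_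
    have hc : ((I.filter (g.Adj i)).card : ℝ) = ∑ j ∈ I.erase i, if g.Adj i j then 1 else 0 := by
      rw [Finset.sum_boole]
      congr 2
      ext j
      simp only [Finset.mem_filter, Finset.mem_erase]
      exact ⟨fun h => ⟨⟨h.2.ne', h.1⟩, h.2⟩, fun h => ⟨h.1.2, h.2⟩⟩
    rw [← Real.exp_sum, ← Finset.mul_sum, ← hc, ← Real.exp_add]
    split_ifs with h
    · refine Real.one_le_exp ?_
      nlinarith
    · positivity
  refine h1.trans ?_
  have h2 : ∑ g : SimpleGraph (Fin n), graphProb p q C g * (Real.exp (-(t * x)) *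
        ∏ j ∈ I.erase i, Real.exp (t * if g.Adj i j then 1 else 0)) =
      Real.exp (-(t * x)) * ∑ g : SimpleGraph (Fin n), graphProb p q C g *
        ∏ j ∈ I.erase i, Real.exp (t * if g.Adj i j then 1 else 0) := by
    rw [Finset.mul_sum]
    exact Finset.sum_congr rfl fun g _ => by ring
  rw [h2, sum_graphProb_mul_star p q C (Finset.notMem_erase i I)
    (fun _ P => Real.exp (t * if P then 1 else 0)), sub_eq_neg_add, Real.exp_add]
  refine mul_le_mul_of_nonneg_left ?_ (Real.exp_pos _).le
  have hmem := fun j => edgeProb_mem (Set.Ioo_subset_Icc_self hp) (Set.Ioo_subset_Icc_self hq) C i j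
  refine le_trans (Finset.prod_le_prod (g := fun _ => Real.exp (p * Real.exp t))
    (fun j _ => ?_) fun j _ => ?_) ?_
  · have h5 : 0 ≤ 1 - edgeProb p q C i j := by linarith [(hmem j).2]
    have := (hmem j).1
    positivity
  · have := exp_mean_le (t := t) (hmem j).1 (edgeProb_le hqp C i j)
    simp only [if_true, if_false, mul_one, mul_zero, Real.exp_zero]
    exact this
  · rw [Finset.prod_const, ← Real.exp_nat_mul]
    refine Real.exp_le_exp.2 (mul_le_mul_of_nonneg_right ?_ (mul_nonneg hp.1.le (Real.exp_pos t).le))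
    exact_mod_cast Finset.card_le_card (Finset.erase_subset i I)

theorem IsModel.eventProb_mono_of_pos (h : IsModel p q w) (C : Finset (Fin n))
    {A B : SimpleGraph (Fin n) → (Fin n → Y) → Prop}
    (hAB : ∀ g y, 0 < jointProb p q w C g y → A g y → B g y) :
    eventProb p q w C A ≤ eventProb p q w C B := by
  refine Finset.sum_le_sum fun g _ => Finset.sum_le_sum fun y _ => ?_
  rcases (h.jointProb_nonneg C g y).eq_or_lt with h0 | h0
  · rw [← h0]; simp
  · refine mul_le_mul_of_nonneg_left ?_ h0.le
    by_cases hA : A g y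
    · simp [hA, hAB g y h0 hA]
    · simp only [hA, if_false]; split_ifs <;> norm_num

/-- Degrees of members into all of `C` are dependent. Restricting to `m` members and counting only
their neighbours in the rest of `C` restores independence; the neighbours missed are at most `x`, up
to the middle error term. -/
theorem IsModel.eventProb_no_better_le (h : IsModel p q w) (hp : p ∈ Set.Ioo (0 : ℝ) 1)
    (hq : q ∈ Set.Ioo (0 : ℝ) 1) (hqp : q < p) {K m k₁ k₂ : ℕ} (hm : m ≤ K) {t x : ℝ}
    (ht : 0 ≤ t) (hk : (k₁ : ℝ) + x + 1 < k₂) (y₀ : Y) {C : Finset (Fin n)}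
    (hC : C ∈ Finset.powersetCard K Finset.univ) :
    eventProb p q w C (fun g y => ¬ ∃ C' ∈ Finset.powersetCard K Finset.univ,
        jointProb p q w C g y < jointProb p q w C' g y) ≤
      Real.exp (-(m * (w true y₀ * binomProb (K - m) p k₁))) +
        m * Real.exp (m * (p * Real.exp t) - t * x) +
        Real.exp (-(((n - K : ℕ) : ℝ) * (w false y₀ * binomProb K q k₂))) := by
  have hCK : C.card = K := (Finset.mem_powersetCard.1 hC).2
  obtain ⟨I, hIC, hI⟩ := Finset.exists_subset_card_eq (hCK ▸ hm : m ≤ C.card)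
  have hincl : ∀ g y, 0 < jointProb p q w C g y →
      (¬ ∃ C' ∈ Finset.powersetCard K Finset.univ,
        jointProb p q w C g y < jointProb p q w C' g y) →
      ((¬ ∃ i ∈ I, y i = y₀ ∧ ((C \ I).filter (g.Adj i)).card = k₁) ∨
        (∃ i ∈ I, x < (I.filter (g.Adj i)).card)) ∨
        ¬ ∃ j ∈ Cᶜ, y j = y₀ ∧ (C.filter (g.Adj j)).card = k₂ := by
    intro g y hpos hno
    by_contra hcon
    rw [not_or, not_or, not_not, not_not] at hcon
    obtain ⟨⟨⟨i, hi, hyi, hki⟩, hB⟩, ⟨j, hj, hyj, hkj⟩⟩ := hcon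
    have hjC : j ∉ C := Finset.mem_compl.1 hj
    have hiC := hIC hi
    refine hno ⟨insert j (C.erase i), ?_, ?_⟩
    · rw [Finset.mem_powersetCard]
      refine ⟨Finset.subset_univ _, ?_⟩
      rw [Finset.card_insert_of_notMem (fun hmem => hjC (Finset.mem_of_mem_erase hmem)),
        Finset.card_erase_add_one hiC, hCK]
    · refine jointProb_lt_of_exchange hp hq hqp hiC hjC (hyi.trans hyj.symm) hpos ?_
      have h1 : ((I.filter (g.Adj i)).card : ℝ) ≤ x := by
        by_contra hlt
        exact hB ⟨i, hi, not_le.1 hlt⟩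
      have h2 : (C.filter (g.Adj i)).card = k₁ + (I.filter (g.Adj i)).card := by
        rw [← hki, ← Finset.card_union_of_disjoint, ← Finset.filter_union,
          Finset.sdiff_union_of_subset hIC]
        exact Finset.disjoint_filter_filter Finset.sdiff_disjoint
      rw [hkj, h2]
      have : ((k₁ + (I.filter (g.Adj i)).card + 1 : ℕ) : ℝ) < k₂ := by
        push_cast; linarith
      exact_mod_cast this
  refine (h.eventProb_mono_of_pos C hincl).trans ((h.eventProb_or_le C _ _).trans
    (add_le_add ((h.eventProb_or_le C _ _).trans (add_le_add ?_ ?_)) ?_))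
  · have hcard : (C \ I).card = K - m := by
      rw [Finset.card_sdiff_of_subset hIC, hCK, hI]
    have := h.eventProb_no_star_le (C := C) (I := I) (R := C \ I) Finset.disjoint_sdiff (x := true)
      (fun i hi => by simpa using hIC hi) (r := p)
      (fun i hi j hj => if_pos ⟨hIC hi, (Finset.mem_sdiff.1 hj).1⟩) y₀ k₁ hp.1.le hp.2.le
    rwa [hI, hcard] at this
  · refine (h.eventProb_exists_le C I
      (fun i g _ => x < ((I.filter (g.Adj i)).card : ℝ))).trans ?_
    refine (Finset.sum_le_card_nsmul I _ (Real.exp (m * (p * Real.exp t) - t * x))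
      fun i _ => ?_).trans ?_
    · rw [h.eventProb_graph C (fun g => x < ((I.filter (g.Adj i)).card : ℝ)), ← hI]
      exact graphEventProb_star_gt_le hp hq hqp.le C I i ht
    · rw [hI, nsmul_eq_mul]
  · have hcard : Cᶜ.card = n - K := by
      rw [Finset.card_compl, hCK, Fintype.card_fin]
    have := h.eventProb_no_star_le (C := C) (I := Cᶜ) (R := C) disjoint_compl_left (x := false)
      (fun i hi => by simpa using hi) (r := q)
      (fun i hi j hj => if_neg (fun h => Finset.mem_compl.1 hi h.1)) y₀ k₂ hq.1.le hq.2.le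
    rwa [hcard, hCK] at this

end

/-! ### Lower bounds on the Poisson scale and the asymptotic converse. -/

/-- The large deviation rate of a Poisson variable of mean `m` at the level `x`. -/
noncomputable def poissonRate (m x : ℝ) : ℝ := m - x + x * Real.log (x / m)

theorem factorial_le_mul_pow {k : ℕ} (hk : 1 ≤ k) :
    (k.factorial : ℝ) ≤ Real.exp 1 * k * ((k : ℝ) / Real.exp 1) ^ k := by
  induction k, hk using Nat.le_induction with
  | base => simp
  | succ k hk ih =>
    have hk0 : (0 : ℝ) < k := by exact_mod_cast hk
    have h1 : Real.exp 1 * (k : ℝ) ^ (k + 1) ≤ ((k : ℝ) + 1) ^ (k + 1) := by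
      have h2 : Real.exp 1 ≤ (((k : ℝ) + 1) / k) ^ (k + 1) := by
        rw [← Real.exp_log (show (0 : ℝ) < ((k : ℝ) + 1) / k by positivity), ← Real.exp_nat_mul]
        refine Real.exp_le_exp.2 ?_
        have h3 := Real.one_sub_inv_le_log_of_pos (show (0 : ℝ) < ((k : ℝ) + 1) / k by positivity)
        have h4 : 1 - (((k : ℝ) + 1) / k)⁻¹ = 1 / ((k : ℝ) + 1) := by field_simp; ring
        rw [h4, div_le_iff₀ (by positivity)] at h3
        push_cast
        linarith
      rw [div_pow, le_div_iff₀ (by positivity)] at h2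
      exact h2
    rw [Nat.factorial_succ]
    push_cast
    calc ((k : ℝ) + 1) * k.factorial
        ≤ ((k : ℝ) + 1) * (Real.exp 1 * k * ((k : ℝ) / Real.exp 1) ^ k) :=
          mul_le_mul_of_nonneg_left ih (by positivity)
      _ = ((k : ℝ) + 1) * (Real.exp 1 * (k : ℝ) ^ (k + 1)) / Real.exp 1 ^ k := by
          rw [div_pow]; ring
      _ ≤ ((k : ℝ) + 1) * ((k : ℝ) + 1) ^ (k + 1) / Real.exp 1 ^ k := by gcongr
      _ = _ := by
          rw [div_pow]
          field_simp
          ring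

/-- The binomial coefficient is bounded below by a falling power over `k!`, with the factorial
bounded by `factorial_le_mul_pow`; its extra factor `exp 1 * k` becomes `log k + 1`, negligible on
the scale `log n`. -/
theorem exp_le_binomProb {N k : ℕ} {r : ℝ} (hr : r ∈ Set.Ioo (0 : ℝ) 1) (hk : 1 ≤ k)
    (hkN : k ≤ N) :
    Real.exp (k * (Real.log (((N : ℝ) + 1 - k) * r / k) + 1) - (Real.log k + 1) -
      N * (r / (1 - r))) ≤ binomProb N r k := by
  have hk0 : (0 : ℝ) < k := by exact_mod_cast hk
  have hkN' : (k : ℝ) ≤ N := by exact_mod_cast hkN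
  have hx : 0 < (N : ℝ) + 1 - k := by linarith
  have hr1 : 0 < 1 - r := by linarith [hr.2]
  have hr0 := hr.1
  have h1 : ((N : ℝ) + 1 - k) ^ k / k.factorial ≤ N.choose k := by
    rw [div_le_iff₀ (by exact_mod_cast k.factorial_pos)]
    have := Nat.pow_sub_le_descFactorial N k
    rw [Nat.descFactorial_eq_factorial_mul_choose] at this
    have h2 : (((N + 1 - k) ^ k : ℕ) : ℝ) ≤ ((k.factorial * N.choose k : ℕ) : ℝ) := by
      exact_mod_cast this
    rw [Nat.cast_pow, Nat.cast_sub (by omega)] at h2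
    push_cast at h2
    linarith
  have h2 : Real.exp (- (N * (r / (1 - r)))) ≤ (1 - r) ^ (N - k) := by
    have h3 := Real.one_sub_inv_le_log_of_pos hr1
    have h4 : 1 - (1 - r)⁻¹ = - (r / (1 - r)) := by field_simp; ring
    rw [h4] at h3
    calc Real.exp (- (N * (r / (1 - r)))) ≤ Real.exp (N * Real.log (1 - r)) := by
          refine Real.exp_le_exp.2 ?_
          have := mul_le_mul_of_nonneg_left h3 (Nat.cast_nonneg (α := ℝ) N)
          linarith
      _ = (1 - r) ^ N := by rw [Real.exp_nat_mul, Real.exp_log hr1]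
      _ ≤ _ := pow_le_pow_of_le_one hr1.le (by linarith) (Nat.sub_le _ _)
  have h3 : Real.exp (k * (Real.log (((N : ℝ) + 1 - k) * r / k) + 1) - (Real.log k + 1)) ≤
      (N.choose k : ℝ) * r ^ k := by
    have e1 : Real.exp (k * (Real.log (((N : ℝ) + 1 - k) * r / k) + 1) - (Real.log k + 1)) =
        ((N : ℝ) + 1 - k) ^ k * r ^ k / (Real.exp 1 * k * ((k : ℝ) / Real.exp 1) ^ k) := by
      rw [Real.exp_sub, Real.exp_nat_mul, Real.exp_add, Real.exp_log (by positivity),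
        Real.exp_add, Real.exp_log hk0, div_mul_eq_mul_div, div_pow, mul_pow, mul_pow, div_pow]
      field_simp
    rw [e1]
    calc _ ≤ ((N : ℝ) + 1 - k) ^ k * r ^ k / k.factorial :=
          div_le_div_of_nonneg_left (by positivity) (by exact_mod_cast k.factorial_pos)
            (factorial_le_mul_pow hk)
      _ = ((N : ℝ) + 1 - k) ^ k / k.factorial * r ^ k := by ring
      _ ≤ _ := mul_le_mul_of_nonneg_right h1 (by positivity)
  rw [sub_eq_add_neg, Real.exp_add, binomProb]
  exact mul_le_mul h3 h2 (Real.exp_pos _).le (by positivity)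

theorem eventually_exp_le_binomProb {ρ c τ ζ : ℝ} (hρ : 0 < ρ) (hc : 0 < c) (hτ : 0 < τ)
    (hζ : 0 < ζ) {N k : ℕ → ℕ}
    (hN : Tendsto (fun n : ℕ => (N n : ℝ) * Real.log n / n) atTop (𝓝 ρ))
    (hk : Tendsto (fun n : ℕ => (k n : ℝ) / Real.log n) atTop (𝓝 τ)) :
    ∀ᶠ n : ℕ in atTop, Real.exp (- (poissonRate (ρ * c) τ + ζ) * Real.log n) ≤
      binomProb (N n) (edgeScale c n) (k n) := by
  have hinv := tendsto_inv_atTop_zero.comp tendsto_log_nat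
  have hM : Tendsto (fun n : ℕ => ((N n : ℝ) + 1 - k n) * Real.log n / n) atTop (𝓝 ρ) := by
    have h := (hN.add (tendsto_log_pow_div_nat 1)).sub (hk.mul (tendsto_log_pow_div_nat 2))
    rw [mul_zero, add_zero, sub_zero] at h
    refine h.congr' ?_
    filter_upwards [tendsto_log_nat.eventually_gt_atTop 0] with n hL
    field_simp
  have hlim1 : Tendsto (fun n : ℕ => ((N n : ℝ) + 1 - k n) * edgeScale c n / k n) atTop
      (𝓝 (ρ * c / τ)) := by
    refine ((hM.mul_const c).div hk hτ.ne').congr' ?_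
    filter_upwards [tendsto_log_nat.eventually_gt_atTop 0] with n hL
    simp only [Pi.div_apply]
    unfold edgeScale
    field_simp
  have hlogk : Tendsto (fun n : ℕ => (Real.log (k n) + 1) / Real.log n) atTop (𝓝 0) := by
    have h := ((((Real.continuousAt_log hτ.ne').tendsto.comp hk).mul hinv).add
      tendsto_log_log_div_log).add hinv
    simp only [mul_zero, add_zero] at h
    refine h.congr' ?_
    filter_upwards [tendsto_log_nat.eventually_gt_atTop 0, hk.eventually_const_lt hτ] with n hL hk0
    have hk1 : (0 : ℝ) < k n := by
      have := mul_pos hk0 hL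
      rwa [div_mul_cancel₀ _ hL.ne'] at this
    simp only [Function.comp]
    rw [Real.log_div hk1.ne' hL.ne']
    field_simp
    ring
  have hlast : Tendsto (fun n : ℕ => (N n : ℝ) * Real.log n / n * (c / (1 - edgeScale c n))) atTop
      (𝓝 (ρ * (c / (1 - 0)))) :=
    hN.mul (tendsto_const_nhds.div ((tendsto_edgeScale c).const_sub 1) (by norm_num))
  have hlog := (Real.continuousAt_log (show ρ * c / τ ≠ 0 by positivity)).tendsto.comp hlim1
  have htot := ((hk.mul (hlog.add_const 1)).sub hlogk).sub hlast
  have hval : τ * (Real.log (ρ * c / τ) + 1) - 0 - ρ * (c / (1 - 0)) =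
      - poissonRate (ρ * c) τ := by
    unfold poissonRate
    rw [Real.log_div (by positivity) hτ.ne', Real.log_div hτ.ne' (by positivity)]
    ring
  rw [hval] at htot
  filter_upwards [htot.eventually_const_lt (show - (poissonRate (ρ * c) τ + ζ) <
      - poissonRate (ρ * c) τ by linarith), tendsto_log_nat.eventually_gt_atTop 0,
      hk.eventually_const_lt hτ, hM.eventually_const_lt hρ, eventually_edgeScale_mem hc,
      eventually_gt_atTop 0] with n hn hL hk0 hM0 hr hn0
  have hn0' : (0 : ℝ) < n := by exact_mod_cast hn0
  have hk1 : (0 : ℝ) < k n := by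
    have := mul_pos hk0 hL
    rwa [div_mul_cancel₀ _ hL.ne'] at this
  have hNk : 0 < (N n : ℝ) + 1 - k n := by
    by_contra hneg
    rw [not_lt] at hneg
    have : ((N n : ℝ) + 1 - k n) * Real.log n / n ≤ 0 :=
      div_nonpos_of_nonpos_of_nonneg (mul_nonpos_of_nonpos_of_nonneg hneg hL.le) hn0'.le
    linarith
  have hkN : k n ≤ N n := by
    have : (k n : ℝ) < (N n + 1 : ℕ) := by push_cast; linarith
    have := Nat.cast_lt.1 this
    omega
  refine le_trans (Real.exp_le_exp.2 ?_)
    (exp_le_binomProb hr (by exact_mod_cast hk1) hkN)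
  have := mul_le_mul_of_nonneg_right hn.le hL.le
  refine this.trans (le_of_eq ?_)
  simp only [Function.comp]
  rw [sub_mul, sub_mul]
  have eN : (N n : ℝ) * Real.log n / n * (c / (1 - edgeScale c n)) * Real.log n =
      N n * (edgeScale c n / (1 - edgeScale c n)) := by
    have : edgeScale c n / (1 - edgeScale c n) =
      c * Real.log n ^ 2 / n / (1 - edgeScale c n) := rfl
    rw [this]; ring
  rw [eN]
  congr 2
  · field_simp
  · field_simp

theorem continuousAt_poissonRate {m x : ℝ} (hm : 0 < m) (hx : 0 < x) :
    ContinuousAt (poissonRate m) x := by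
  unfold poissonRate
  refine ContinuousAt.add (by fun_prop) (continuousAt_id.mul ?_)
  exact ContinuousAt.log (by fun_prop) (by positivity)

theorem tendsto_exp_div_log_sq {δ : ℝ} (hδ : 0 < δ) :
    Tendsto (fun n : ℕ => Real.exp (δ * Real.log n) / (2 * Real.log n ^ 2)) atTop atTop := by
  have h := (Real.tendsto_exp_div_pow_atTop 2).comp (tendsto_log_nat.const_mul_atTop hδ)
  refine (h.const_mul_atTop (show 0 < δ ^ 2 / 2 by positivity)).congr' ?_
  filter_upwards [tendsto_log_nat.eventually_gt_atTop 0] with n hL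
  simp only [Function.comp]
  field_simp

/-- One symbol `y₀` and one level `τ` at which both kinds of atypical node cost less than one power
of `n` suffice: then members just below the level and non-members just above it both exist with high
probability. -/
theorem not_exactRecovery_of_exponent {Y : Type} [Fintype Y] {ρ a b : ℝ} (hρ : 0 < ρ) (hb : 0 < b)
    (hab : b < a) {K : ℕ → ℕ} (hK : ∀ᶠ n : ℕ in atTop, |(K n : ℝ) - ρ * n / Real.log n| < 1)
    {w : ℕ → Bool → Y → ℝ} (hw : ∀ n x s, 0 ≤ w n x s) (hw1 : ∀ n x, ∑ s, w n x s = 1)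
    (y₀ : Y) {τ δ : ℝ} (hτ : 0 < τ) (hδ : 0 < δ)
    (Ht : ∀ᶠ n : ℕ in atTop, Real.exp (- (1 - δ) * Real.log n) ≤
      w n true y₀ * Real.exp (- poissonRate (ρ * a) τ * Real.log n))
    (Hf : ∀ᶠ n : ℕ in atTop, Real.exp (- (1 - δ) * Real.log n) ≤
      w n false y₀ * Real.exp (- poissonRate (ρ * b) τ * Real.log n)) :
    ¬ ExactRecovery K (edgeScale a) (edgeScale b) w := by
  have ha := hb.trans hab
  rintro ⟨est, hest⟩
  -- Continuity of the rates lets the two levels be separated by `2 * η` at a cost below `δ / 4`;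
  -- the binomial estimate uses another `δ / 4`.
  obtain ⟨η, hη, hητ, hηa, hηb⟩ : ∃ η > 0, η < τ ∧
      poissonRate (ρ * a) (τ - η) < poissonRate (ρ * a) τ + δ / 4 ∧
      poissonRate (ρ * b) (τ + η) < poissonRate (ρ * b) τ + δ / 4 := by
    have c1 := (continuousAt_poissonRate (mul_pos hρ ha) hτ).eventually_lt_const
      (show poissonRate (ρ * a) τ < poissonRate (ρ * a) τ + δ / 4 by linarith)
    have c2 := (continuousAt_poissonRate (mul_pos hρ hb) hτ).eventually_lt_const
      (show poissonRate (ρ * b) τ < poissonRate (ρ * b) τ + δ / 4 by linarith)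
    obtain ⟨ε, hε, h⟩ := Metric.eventually_nhds_iff.1 (c1.and c2)
    refine ⟨min (ε / 2) (τ / 2), by positivity, ?_, ?_, ?_⟩
    · exact (min_le_right _ _).trans_lt (by linarith)
    · refine (h ?_).1
      rw [Real.dist_eq, sub_sub_cancel_left, abs_neg, abs_of_pos (by positivity)]
      exact (min_le_left _ _).trans_lt (by linarith)
    · refine (h ?_).2
      rw [Real.dist_eq, add_sub_cancel_left, abs_of_pos (by positivity)]
      exact (min_le_left _ _).trans_lt (by linarith)
  -- Large enough that `m` trials still beat probability `n ^ (-(1 - δ / 2))`, small enough that `m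
  -- * p ≤ a`, so a node has fewer than `η log n` neighbours among the `m` chosen members.
  set m : ℕ → ℕ := fun n => ⌊(n : ℝ) / Real.log n ^ 2⌋₊ with hm
  set k₁ : ℕ → ℕ := fun n => ⌊(τ - η) * Real.log n⌋₊ with hk₁
  set k₂ : ℕ → ℕ := fun n => ⌊(τ + η) * Real.log n⌋₊ with hk₂
  have hm_le : ∀ n, (m n : ℝ) ≤ n / Real.log n ^ 2 := fun n => Nat.floor_le (by positivity)
  have hinv := tendsto_inv_atTop_zero.comp tendsto_log_nat
  have hm_lim : Tendsto (fun n : ℕ => (m n : ℝ) * Real.log n / n) atTop (𝓝 0) := by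
    refine tendsto_of_tendsto_of_tendsto_of_le_of_le' tendsto_const_nhds hinv ?_ ?_
    · filter_upwards [tendsto_log_nat.eventually_gt_atTop 0] with n hL
      positivity
    · filter_upwards [tendsto_log_nat.eventually_gt_atTop 0, eventually_gt_atTop 0] with n hL hn0
      have hn0' : (0 : ℝ) < n := by exact_mod_cast hn0
      have := mul_le_mul_of_nonneg_right (hm_le n) (show 0 ≤ Real.log n / n by positivity)
      rw [← mul_div_assoc] at this
      refine this.trans (le_of_eq ?_)
      simp only [Function.comp]
      field_simp
  have hmK : ∀ᶠ n in atTop, m n ≤ K n := by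
    filter_upwards [(hm_lim.sub (tendsto_size_scale hK)).eventually_lt_const
      (show 0 - ρ < 0 by linarith), tendsto_log_nat.eventually_gt_atTop 0,
      eventually_gt_atTop 0] with n hn hL hn0
    have hn0' : (0 : ℝ) < n := by exact_mod_cast hn0
    rw [← sub_div, ← sub_mul, div_lt_iff₀ hn0', zero_mul] at hn
    have : (m n : ℝ) < K n := by
      by_contra hcon
      have := mul_nonneg (sub_nonneg.2 (not_lt.1 hcon)) hL.le
      linarith
    exact (Nat.cast_lt.1 this).le
  have hN : Tendsto (fun n : ℕ => ((K n - m n : ℕ) : ℝ) * Real.log n / n) atTop (𝓝 ρ) := by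
    have := (tendsto_size_scale hK).sub hm_lim
    rw [sub_zero] at this
    refine this.congr' ?_
    filter_upwards [hmK] with n hn
    rw [Nat.cast_sub hn]; ring
  have hbin₁ := eventually_exp_le_binomProb hρ ha (sub_pos.2 hητ) (show 0 < δ / 4 by positivity) hN
    ((tendsto_nat_floor_mul_div_atTop (sub_pos.2 hητ).le).comp tendsto_log_nat)
  have hbin₂ := eventually_exp_le_binomProb hρ hb (show 0 < τ + η by positivity)
    (show 0 < δ / 4 by positivity) (tendsto_size_scale hK)
    ((tendsto_nat_floor_mul_div_atTop (show 0 ≤ τ + η by positivity)).comp tendsto_log_nat)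
  -- Then `t * (η * log n) = 2 * log n`, which beats the union bound over at most `n` members.
  set t := 2 / η with ht
  have htpos : 0 < t := by positivity
  have hF : Tendsto (fun n : ℕ =>
      Real.exp (-(Real.exp (δ / 2 * Real.log n) / (2 * Real.log n ^ 2))) +
      Real.exp (a * Real.exp t) * Real.exp (-Real.log n) +
      Real.exp (-(Real.exp (δ / 2 * Real.log n) / 2))) atTop (𝓝 0) := by
    have e1 := Real.tendsto_exp_neg_atTop_nhds_zero.comp
      (tendsto_exp_div_log_sq (show 0 < δ / 2 by positivity))
    have e2 := (Real.tendsto_exp_neg_atTop_nhds_zero.comp tendsto_log_nat).const_mul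
      (Real.exp (a * Real.exp t))
    have e3 := Real.tendsto_exp_neg_atTop_nhds_zero.comp ((Real.tendsto_exp_atTop.comp
      (tendsto_log_nat.const_mul_atTop (show 0 < δ / 2 by positivity))).atTop_div_const two_pos)
    simpa [Function.comp_def] using (e1.add e2).add e3
  have hfinal : ∀ᶠ n : ℕ in atTop, successProb n (K n) (edgeScale a n) (edgeScale b n) (w n)
      (est n) ≤ Real.exp (-(Real.exp (δ / 2 * Real.log n) / (2 * Real.log n ^ 2))) +
      Real.exp (a * Real.exp t) * Real.exp (-Real.log n) +
      Real.exp (-(Real.exp (δ / 2 * Real.log n) / 2)) := by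
    filter_upwards [hbin₁, hbin₂, hmK, eventually_size_le hK,
      tendsto_log_nat.eventually_gt_atTop 0, eventually_gt_atTop 0, eventually_edgeScale_mem ha,
      eventually_edgeScale_mem hb, Ht, Hf, tendsto_log_nat.eventually_gt_atTop (2 / η),
      (tendsto_log_pow_div_nat 2).eventually_le_const (show (0 : ℝ) < 1 / 2 by norm_num)]
      with n hb1 hb2 hmKn hKn hL hn0 hp hq hwt hwf hL2 hsq
    have hn0' : (0 : ℝ) < n := by exact_mod_cast hn0
    have hM : IsModel (edgeScale a n) (edgeScale b n) (w n) :=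
      ⟨Set.Ioo_subset_Icc_self hp, Set.Ioo_subset_Icc_self hq, hw n, hw1 n⟩
    have hqp : edgeScale b n < edgeScale a n := by
      unfold edgeScale; gcongr
    have hexpn : (n : ℝ) = Real.exp (Real.log n) := (Real.exp_log hn0').symm
    have hexp : (n : ℝ) * Real.exp (-(1 - δ / 2) * Real.log n) =
        Real.exp (δ / 2 * Real.log n) := by
      nth_rw 1 [hexpn]
      rw [← Real.exp_add]
      congr 1; ring
    have hk : (k₁ n : ℝ) + η * Real.log n + 1 < k₂ n := by
      have f1 : (k₁ n : ℝ) ≤ (τ - η) * Real.log n :=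
        Nat.floor_le (mul_nonneg (sub_pos.2 hητ).le hL.le)
      have f2 : (τ + η) * Real.log n < k₂ n + 1 := Nat.lt_floor_add_one _
      rw [div_lt_iff₀ hη] at hL2
      linarith
    have key := hM.successProb_le (show K n ≤ n by omega) (fun C hC =>
      hM.eventProb_no_better_le hp hq hqp hmKn htpos.le hk y₀ hC) (est n)
    refine key.trans (add_le_add (add_le_add ?_ ?_) ?_)
    · refine Real.exp_le_exp.2 (neg_le_neg ?_)
      have g1 : Real.exp (-(1 - δ / 2) * Real.log n) ≤
          w n true y₀ * binomProb (K n - m n) (edgeScale a n) (k₁ n) := by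
        have g2 : Real.exp (- poissonRate (ρ * a) τ * Real.log n) * Real.exp (-(δ / 2) * Real.log n)
            ≤ binomProb (K n - m n) (edgeScale a n) (k₁ n) := by
          refine le_trans ?_ hb1
          rw [← Real.exp_add]
          refine Real.exp_le_exp.2 ?_
          rw [← add_mul]
          exact mul_le_mul_of_nonneg_right (by linarith) hL.le
        calc _ = Real.exp (- (1 - δ) * Real.log n) * Real.exp (-(δ / 2) * Real.log n) := by
              rw [← Real.exp_add]; congr 1; ring
          _ ≤ w n true y₀ * Real.exp (- poissonRate (ρ * a) τ * Real.log n) *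
              Real.exp (-(δ / 2) * Real.log n) :=
              mul_le_mul_of_nonneg_right hwt (Real.exp_pos _).le
          _ ≤ _ := by
              rw [mul_assoc]
              exact mul_le_mul_of_nonneg_left g2 (hw _ _ _)
      have g3 : (n : ℝ) / (2 * Real.log n ^ 2) ≤ m n := by
        have f1 : (n : ℝ) / Real.log n ^ 2 < m n + 1 := Nat.lt_floor_add_one _
        have f2 : 2 ≤ (n : ℝ) / Real.log n ^ 2 := by
          rw [le_div_iff₀ (by positivity)]
          rw [div_le_iff₀ hn0'] at hsq
          linarith
        have f3 : (n : ℝ) / (2 * Real.log n ^ 2) = (n : ℝ) / Real.log n ^ 2 / 2 := by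
          rw [div_div, mul_comm]
        rw [f3]
        linarith
      calc _ = (n : ℝ) / (2 * Real.log n ^ 2) * Real.exp (-(1 - δ / 2) * Real.log n) := by
            rw [← hexp]; ring
        _ ≤ _ := mul_le_mul g3 g1 (Real.exp_pos _).le (Nat.cast_nonneg _)
    · have g1 : (m n : ℝ) * edgeScale a n ≤ a := by
        calc _ ≤ (n : ℝ) / Real.log n ^ 2 * edgeScale a n :=
              mul_le_mul_of_nonneg_right (hm_le n) hp.1.le
          _ = a := by unfold edgeScale; field_simp
      have g2 : (m n : ℝ) ≤ n := by exact_mod_cast (show m n ≤ n by omega)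
      have g3 : t * (η * Real.log n) = 2 * Real.log n := by rw [ht]; field_simp
      calc _ ≤ (n : ℝ) * Real.exp (a * Real.exp t - 2 * Real.log n) := by
            refine mul_le_mul g2 (Real.exp_le_exp.2 ?_) (Real.exp_pos _).le hn0'.le
            rw [g3, ← mul_assoc]
            have := mul_le_mul_of_nonneg_right g1 (Real.exp_pos t).le
            linarith
        _ = _ := by
            nth_rw 1 [hexpn]
            rw [← Real.exp_add, ← Real.exp_add]
            congr 1; ring
    · refine Real.exp_le_exp.2 (neg_le_neg ?_)
      have g1 : Real.exp (-(1 - δ / 2) * Real.log n) ≤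
          w n false y₀ * binomProb (K n) (edgeScale b n) (k₂ n) := by
        have g2 : Real.exp (- poissonRate (ρ * b) τ * Real.log n) * Real.exp (-(δ / 2) * Real.log n)
            ≤ binomProb (K n) (edgeScale b n) (k₂ n) := by
          refine le_trans ?_ hb2
          rw [← Real.exp_add]
          refine Real.exp_le_exp.2 ?_
          rw [← add_mul]
          exact mul_le_mul_of_nonneg_right (by linarith) hL.le
        calc _ = Real.exp (- (1 - δ) * Real.log n) * Real.exp (-(δ / 2) * Real.log n) := by
              rw [← Real.exp_add]; congr 1; ring
          _ ≤ w n false y₀ * Real.exp (- poissonRate (ρ * b) τ * Real.log n) *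
              Real.exp (-(δ / 2) * Real.log n) :=
              mul_le_mul_of_nonneg_right hwf (Real.exp_pos _).le
          _ ≤ _ := by
              rw [mul_assoc]
              exact mul_le_mul_of_nonneg_left g2 (hw _ _ _)
      have g3 : (n : ℝ) / 2 ≤ ((n - K n : ℕ) : ℝ) := by
        rw [Nat.cast_sub (by omega)]
        have : (2 : ℝ) * K n ≤ n := by exact_mod_cast hKn
        linarith
      calc _ = (n : ℝ) / 2 * Real.exp (-(1 - δ / 2) * Real.log n) := by
            rw [← hexp]; ring
        _ ≤ _ := mul_le_mul g3 g1 (Real.exp_pos _).le (Nat.cast_nonneg _)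
  have := le_of_tendsto_of_tendsto hest hF hfinal
  linarith

/-! ### Identities between the error exponents. -/

section
variable {ρ a b β : ℝ}

theorem Tab_pos (hb : 0 < b) (hab : b < a) : 0 < Tab a b :=
  Real.log_pos (by rwa [one_lt_div hb])

theorem mul_Tab_lt (hb : 0 < b) (hab : b < a) : b * Tab a b < a - b := by
  have h := Real.log_lt_sub_one_of_pos (show 0 < a / b from div_pos (hb.trans hab) hb)
    ((one_lt_div hb).2 hab).ne'
  have h2 := mul_lt_mul_of_pos_left h hb
  rw [mul_sub, mul_div_cancel₀ _ hb.ne', mul_one] at h2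
  exact h2

theorem lt_mul_Tab (hb : 0 < b) (hab : b < a) : a - b < a * Tab a b := by
  have ha := hb.trans hab
  have h := Real.log_lt_sub_one_of_pos (show 0 < b / a from div_pos hb ha)
    ((div_lt_one ha).2 hab).ne
  have h2 := mul_lt_mul_of_pos_left h ha
  rw [mul_sub, mul_div_cancel₀ _ ha.ne', mul_one, ← inv_div, Real.log_inv] at h2
  unfold Tab
  linarith

/-- The tilt `s` with `a ^ (1 - s) b ^ s = x`. -/
noncomputable def tiltParam (a b x : ℝ) : ℝ := 1 - Real.log (x / b) / Tab a b

theorem tiltParam_mem (hb : 0 < b) (hab : b < a) {x : ℝ} (hbx : b < x) (hxa : x < a) :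
    tiltParam a b x ∈ Set.Ioo (0 : ℝ) 1 := by
  have hT := Tab_pos hb hab
  have hx := hb.trans hbx
  unfold tiltParam
  constructor
  · rw [sub_pos, div_lt_one hT]
    exact Real.log_lt_log (by positivity) (div_lt_div_of_pos_right hxa hb)
  · have : 0 < Real.log (x / b) := Real.log_pos (by rwa [one_lt_div hb])
    have := div_pos this hT
    linarith

theorem chernoffGap_tiltParam (hb : 0 < b) (hab : b < a) {x : ℝ} (hx : 0 < x) :
    chernoffGap a b (tiltParam a b x) = b - x + Real.log (x / b) * (a - b) / Tab a b := by
  have hT := Tab_pos hb hab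
  have ha := hb.trans hab
  have h1 : a ^ (1 - tiltParam a b x) * b ^ tiltParam a b x = x := by
    rw [Real.rpow_def_of_pos ha, Real.rpow_def_of_pos hb, ← Real.exp_add]
    nth_rw 3 [← Real.exp_log hx]
    congr 1
    have e1 : Real.log a = Tab a b + Real.log b := by
      unfold Tab; rw [Real.log_div ha.ne' hb.ne']; ring
    unfold tiltParam
    rw [Real.log_div hx.ne' hb.ne', e1]
    field_simp
    ring
  unfold chernoffGap
  rw [h1]
  unfold tiltParam
  ring

/-- The critical number of community neighbours, in units of `log n`. -/
noncomputable def critLevel (ρ a b β : ℝ) : ℝ := (ρ * (a - b) - β) / Tab a b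

/-- The upper bound on `β` is exactly the condition that the level exceed `ρ * b`; the other side
follows from `a - b < a * Tab a b`. Together they put the tilt strictly between 0 and 1. -/
theorem critLevel_div_mem (hρ : 0 < ρ) (hb : 0 < b) (hab : b < a) (hβ0 : 0 ≤ β)
    (hβ : β < ρ * (a - b - b * Tab a b)) :
    b < critLevel ρ a b β / ρ ∧ critLevel ρ a b β / ρ < a := by
  have hT := Tab_pos hb hab
  have h1 := mul_lt_mul_of_pos_left (lt_mul_Tab hb hab) hρ
  unfold critLevel
  constructor
  · rw [lt_div_iff₀ hρ, lt_div_iff₀ hT]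
    linarith
  · rw [div_lt_iff₀ hρ, div_lt_iff₀ hT]
    linarith

theorem eta2_eq (hρ : 0 < ρ) (hb : 0 < b) (hx : 0 < critLevel ρ a b β / ρ) (hT : 0 < Tab a b) :
    eta2 ρ a b β = ρ * b + critLevel ρ a b β * Real.log (critLevel ρ a b β / ρ / b) -
      critLevel ρ a b β + β := by
  have hc : 0 < critLevel ρ a b β := by
    have := mul_pos hx hρ
    rwa [div_mul_cancel₀ _ hρ.ne'] at this
  have h1 : (ρ * (a - b) - β) / (ρ * Real.exp 1 * b * Tab a b) =
      critLevel ρ a b β / ρ / b / Real.exp 1 := by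
    unfold critLevel; field_simp
  unfold eta2
  rw [h1, Real.log_div (by positivity) (Real.exp_pos 1).ne', Real.log_exp]
  change ρ * b + critLevel ρ a b β * _ + β = _
  ring

theorem eta1_eq_eta2 (hρ : 0 < ρ) : eta1 ρ a b = eta2 ρ a b 0 := by
  have h1 : (ρ * (a - b) - 0) / (ρ * Real.exp 1 * b * Tab a b) =
      (a - b) / (Real.exp 1 * b * Tab a b) := by
    rw [sub_zero, mul_assoc, mul_assoc, ← mul_assoc (Real.exp 1), mul_div_mul_left _ _ hρ.ne']
  unfold eta1 eta2
  rw [h1]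
  ring

/-- The summand `β` is the price for a non-member to show the misleading label. -/
theorem poissonRate_critLevel_right (hρ : 0 < ρ) (hb : 0 < b)
    (hx : 0 < critLevel ρ a b β / ρ) (hT : 0 < Tab a b) :
    poissonRate (ρ * b) (critLevel ρ a b β) + β = eta2 ρ a b β := by
  rw [eta2_eq hρ hb hx hT, poissonRate, div_div]
  ring

/-- Changing the mean from `ρ * b` to `ρ * a` changes the rate by `ρ * (a - b) - critLevel * Tab a
b`, which is `β` by the choice of level. Members need no label cost. -/
theorem poissonRate_critLevel_left (hρ : 0 < ρ) (hb : 0 < b) (hab : b < a)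
    (hx : 0 < critLevel ρ a b β / ρ) (hT : 0 < Tab a b) :
    poissonRate (ρ * a) (critLevel ρ a b β) = eta2 ρ a b β := by
  have ha := hb.trans hab
  have h1 : Real.log (critLevel ρ a b β / (ρ * a)) =
      Real.log (critLevel ρ a b β / ρ / b) - Tab a b := by
    rw [← div_div, Real.log_div hx.ne' ha.ne', Real.log_div hx.ne' hb.ne', Tab,
      Real.log_div ha.ne' hb.ne']
    ring
  have h2 : critLevel ρ a b β * Tab a b = ρ * (a - b) - β := by
    unfold critLevel; field_simp
  rw [eta2_eq hρ hb hx hT, poissonRate, h1]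
  linear_combination -h2

theorem chernoffGap_critLevel (hρ : 0 < ρ) (hb : 0 < b) (hab : b < a)
    (hx : 0 < critLevel ρ a b β / ρ) :
    ρ * chernoffGap a b (tiltParam a b (critLevel ρ a b β / ρ)) +
      tiltParam a b (critLevel ρ a b β / ρ) * β = eta2 ρ a b β := by
  have hT := Tab_pos hb hab
  have h2 : critLevel ρ a b β * Tab a b = ρ * (a - b) - β := by
    unfold critLevel; field_simp
  rw [chernoffGap_tiltParam hb hab hx, eta2_eq hρ hb hx hT, tiltParam]
  field_simp
  linear_combination (-Real.log (critLevel ρ a b β / (ρ * b))) * h2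

theorem sinh_mul_le {u v : ℝ} (hu0 : 0 ≤ u) (hu1 : u ≤ 1) (hv : 0 ≤ v) :
    Real.sinh (u * v) ≤ u * Real.sinh v := by
  have hconv : ConvexOn ℝ (Set.Ici 0) Real.sinh := by
    refine MonotoneOn.convexOn_of_deriv (convex_Ici 0) Real.continuous_sinh.continuousOn
      Real.differentiable_sinh.differentiableOn ?_
    rw [Real.deriv_sinh, interior_Ici]
    intro x hx y _ hxy
    rw [Real.cosh_le_cosh, abs_of_pos hx, abs_of_pos (lt_of_lt_of_le hx hxy)]
    exact hxy
  have := hconv.2 (Set.mem_Ici.2 hv) (Set.mem_Ici.2 le_rfl) hu0 (sub_nonneg.2 hu1) (by ring)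
  simpa using this

/-- In terms of the geometric mean `c` of `a` and `b`, the difference of the two gaps is `2 * c *
((2 * s - 1) * sinh (T / 2) - sinh ((2 * s - 1) * T / 2))`, nonnegative by convexity of `sinh`. -/
theorem chernoffGap_le_one_sub (hb : 0 < b) (hab : b < a) {s : ℝ} (hs : 1 / 2 ≤ s) (hs1 : s ≤ 1) :
    chernoffGap a b s ≤ chernoffGap a b (1 - s) := by
  have ha := hb.trans hab
  have hT := Tab_pos hb hab
  have h := sinh_mul_le (u := 2 * s - 1) (v := Tab a b / 2) (by linarith) (by linarith)
    (by positivity)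
  rw [Real.sinh_eq, Real.sinh_eq] at h
  set c := Real.exp ((Real.log a + Real.log b) / 2) with hc
  have hpow : ∀ z : ℝ, a ^ (1 - z) * b ^ z = c * Real.exp (-((2 * z - 1) * (Tab a b / 2))) := by
    intro z
    rw [Real.rpow_def_of_pos ha, Real.rpow_def_of_pos hb, ← Real.exp_add, hc, ← Real.exp_add]
    congr 1
    unfold Tab
    rw [Real.log_div ha.ne' hb.ne']
    ring
  have h0 : a = c * Real.exp (Tab a b / 2) := by
    have := hpow 0
    simp only [sub_zero, Real.rpow_one, Real.rpow_zero, mul_one, mul_zero, zero_sub, neg_mul,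
      one_mul, neg_neg] at this
    exact this
  have h1 : b = c * Real.exp (-(Tab a b / 2)) := by
    have := hpow 1
    norm_num at this
    convert this using 3
  have e1 := hpow s
  have e2 := hpow (1 - s)
  have e3 : -((2 * (1 - s) - 1) * (Tab a b / 2)) = (2 * s - 1) * (Tab a b / 2) := by ring
  rw [e3] at e2
  have hcpos : 0 < c := Real.exp_pos _
  have h' := mul_le_mul_of_nonneg_left h hcpos.le
  unfold chernoffGap
  rw [e1, e2]
  nlinarith

end

/-! ### The two kinds of side information. -/

theorem eventually_abs_sub_le_of_isLittleO {f : ℕ → ℝ} {β ζ : ℝ} (hζ : 0 < ζ)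
    (h : (fun n => f n - β * Real.log n) =o[atTop] fun n : ℕ => Real.log n) :
    ∀ᶠ n : ℕ in atTop, |f n - β * Real.log n| ≤ ζ * Real.log n := by
  filter_upwards [h.def hζ, tendsto_log_nat.eventually_gt_atTop 0] with n hn hL
  rwa [Real.norm_eq_abs, Real.norm_of_nonneg hL.le] at hn

theorem noisyLabel_nonneg {α : ℝ} (h : 0 < α ∧ α < 1 / 2) (x s : Bool) :
    0 ≤ noisyLabel α x s := by
  unfold noisyLabel; split_ifs <;> linarith

theorem sum_noisyLabel (α : ℝ) (x : Bool) : ∑ s, noisyLabel α x s = 1 := by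
  cases x <;> simp [noisyLabel]

theorem revealedLabel_nonneg {ε : ℝ} (h : 0 < ε ∧ ε ≤ 1) (x : Bool) (s : Option Bool) :
    0 ≤ revealedLabel ε x s := by
  rcases s with _ | s
  · exact h.1.le
  · simp only [revealedLabel]; split_ifs <;> linarith

theorem sum_revealedLabel (ε : ℝ) (x : Bool) : ∑ s, revealedLabel ε x s = 1 := by
  rw [Fintype.sum_option]
  cases x <;> simp [revealedLabel]

theorem rpow_mul_rpow_le_exp {u v s c : ℝ} (hu : 0 < u) (hv : 0 < v) (hu1 : u ≤ 1)
    (hs : 0 ≤ s) (h : c ≤ Real.log (u / v)) :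
    u ^ (1 - s) * v ^ s ≤ Real.exp (- (s * c)) := by
  have e : u ^ (1 - s) * v ^ s = u * Real.exp (-s * Real.log (u / v)) := by
    rw [mul_exp_neg_log_div hu hv]
  rw [e]
  calc _ ≤ 1 * Real.exp (-s * Real.log (u / v)) :=
        mul_le_mul_of_nonneg_right hu1 (Real.exp_pos _).le
    _ ≤ _ := by
        rw [one_mul]
        refine Real.exp_le_exp.2 ?_
        nlinarith

/-- The critical symbol is `true`: members show it with probability at least 1/2, non-members with
probability `n ^ (-β + o(1))`. Allowing `β = 0` covers the uninformative regime as well. -/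
theorem exactRecovery_noisyLabel_iff {ρ a b β : ℝ} (hρ : 0 < ρ) (hb : 0 < b) (hab : b < a)
    {K : ℕ → ℕ} (hK : ∀ᶠ n : ℕ in atTop, |(K n : ℝ) - ρ * n / Real.log n| < 1) {α : ℕ → ℝ}
    (hβ0 : 0 ≤ β) (hβ : β < ρ * (a - b - b * Tab a b)) (hα : ∀ n, 0 < α n ∧ α n < 1 / 2)
    (ho : (fun n => Real.log ((1 - α n) / α n) - β * Real.log n) =o[atTop]
      fun n : ℕ => Real.log n) (hne : eta2 ρ a b β ≠ 1) :
    ExactRecovery K (edgeScale a) (edgeScale b) (fun n => noisyLabel (α n)) ↔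
      1 < eta2 ρ a b β := by
  have hT := Tab_pos hb hab
  obtain ⟨hbx, hxa⟩ := critLevel_div_mem hρ hb hab hβ0 hβ
  have hx := hb.trans hbx
  constructor
  · intro hrec
    by_contra hcon
    have hlt : eta2 ρ a b β < 1 := lt_of_le_of_ne (not_lt.1 hcon) hne
    have hτ : 0 < critLevel ρ a b β := by
      have := mul_pos hx hρ
      rwa [div_mul_cancel₀ _ hρ.ne'] at this
    set δ := (1 - eta2 ρ a b β) / 2 with hδ
    have hδpos : 0 < δ := by linarith
    have hrate := poissonRate_critLevel_right hρ hb hx hT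
    have hhalf : ∀ᶠ n : ℕ in atTop, Real.log 2 ≤ δ / 2 * Real.log n :=
      (tendsto_log_nat.const_mul_atTop (show 0 < δ / 2 by positivity)).eventually_ge_atTop _
    refine not_exactRecovery_of_exponent hρ hb hab hK (fun n => noisyLabel_nonneg (hα n))
      (fun n => sum_noisyLabel (α n)) true hτ hδpos ?_ ?_ hrec
    · filter_upwards [hhalf, tendsto_log_nat.eventually_gt_atTop 0] with n hn hL
      have h1 : Real.exp (-(δ / 2 * Real.log n)) ≤ noisyLabel (α n) true true := by
        have e1 : Real.exp (- Real.log 2) = 1 / 2 := by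
          rw [Real.exp_neg, Real.exp_log two_pos]; norm_num
        have e2 := Real.exp_le_exp.2 (neg_le_neg hn)
        rw [e1] at e2
        simp only [noisyLabel, if_true]
        linarith [(hα n).2]
      refine le_trans ?_ (mul_le_mul_of_nonneg_right h1 (Real.exp_pos _).le)
      rw [poissonRate_critLevel_left hρ hb hab hx hT, ← Real.exp_add]
      refine Real.exp_le_exp.2 ?_
      nlinarith
    · filter_upwards [hhalf, eventually_abs_sub_le_of_isLittleO (show 0 < δ / 2 by positivity) ho,
        tendsto_log_nat.eventually_gt_atTop 0] with n hn hn2 hL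
      have hα1 : 0 < 1 - α n := by linarith [(hα n).2]
      rw [Real.log_div hα1.ne' (hα n).1.ne'] at hn2
      have hl : - Real.log 2 ≤ Real.log (1 - α n) := by
        rw [← Real.log_inv]
        exact Real.log_le_log (by norm_num) (by linarith [(hα n).2])
      have h1 : Real.exp (-((β + δ) * Real.log n)) ≤ noisyLabel (α n) false true := by
        have : noisyLabel (α n) false true = α n := by simp [noisyLabel]
        rw [this]
        nth_rw 1 [← Real.exp_log (hα n).1]
        refine Real.exp_le_exp.2 ?_
        have := (abs_le.1 hn2).2
        linarith
      refine le_trans ?_ (mul_le_mul_of_nonneg_right h1 (Real.exp_pos _).le)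
      rw [← Real.exp_add]
      refine Real.exp_le_exp.2 ?_
      have : poissonRate (ρ * b) (critLevel ρ a b β) = eta2 ρ a b β - β := by linarith
      rw [this]
      nlinarith
  · intro hgt
    set s := tiltParam a b (critLevel ρ a b β / ρ) with hs
    have hsm : s ∈ Set.Ioo (0 : ℝ) 1 := tiltParam_mem hb hab hbx hxa
    have hval := chernoffGap_critLevel hρ hb hab hx
    rw [← hs] at hval
    -- For the symbol `false` the label factor is worth `(1 - s') * β`. The tilt `s` is kept if it
    -- is at most 1/2 and reflected to `1 - s` otherwise, so this symbol is never the bottleneck.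
    obtain ⟨s', hs'm, hs'⟩ : ∃ s' ∈ Set.Icc (0 : ℝ) 1,
        eta2 ρ a b β ≤ ρ * chernoffGap a b s' + (1 - s') * β := by
      by_cases h : s ≤ 1 / 2
      · exact ⟨s, Set.Ioo_subset_Icc_self hsm, by nlinarith⟩
      · rw [not_le] at h
        refine ⟨1 - s, ⟨by linarith [hsm.2], by linarith [hsm.1]⟩, ?_⟩
        have := mul_le_mul_of_nonneg_left (chernoffGap_le_one_sub hb hab h.le hsm.2.le) hρ.le
        linarith
    set δ := (eta2 ρ a b β - 1) / 2 with hδ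
    have hδpos : 0 < δ := by linarith
    refine exactRecovery_of_exponent hρ hb hab hK (fun n => noisyLabel_nonneg (hα n))
      (fun n => sum_noisyLabel (α n)) (s := fun y => if y then s else s') ?_ hδpos ?_
    · intro y
      cases y
      · simpa using hs'm
      · simpa using Set.Ioo_subset_Icc_self hsm
    · filter_upwards [eventually_abs_sub_le_of_isLittleO hδpos ho,
        tendsto_log_nat.eventually_gt_atTop 0] with n hn hL
      have hα0 := (hα n).1
      have hα1 : 0 < 1 - α n := by linarith [(hα n).2]
      have hlog : (β - δ) * Real.log n ≤ Real.log ((1 - α n) / α n) := by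
        have := (abs_le.1 hn).1
        linarith
      intro y
      cases y
      · simp only [noisyLabel, Bool.false_eq_true, if_false, if_true]
        have h1 := rpow_mul_rpow_le_exp (s := 1 - s') hα1 hα0 (by linarith)
          (by linarith [hs'm.2]) hlog
        rw [sub_sub_cancel, mul_comm] at h1
        refine (mul_le_mul_of_nonneg_right h1 (Real.exp_pos _).le).trans ?_
        rw [← Real.exp_add]
        refine Real.exp_le_exp.2 ?_
        have h2 : (1 - s') * δ ≤ δ := by nlinarith [hs'm.1]
        have h3 : 1 + δ ≤ (1 - s') * (β - δ) + ρ * chernoffGap a b s' := by linarith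
        nlinarith
      · simp only [noisyLabel, Bool.true_eq_false, if_false, if_true]
        have h1 := rpow_mul_rpow_le_exp (s := s) hα1 hα0 (by linarith) hsm.1.le hlog
        refine (mul_le_mul_of_nonneg_right h1 (Real.exp_pos _).le).trans ?_
        rw [← Real.exp_add]
        refine Real.exp_le_exp.2 ?_
        have h2 : s * δ ≤ δ := by nlinarith [hsm.2]
        have h3 : 1 + δ ≤ s * (β - δ) + ρ * chernoffGap a b s := by linarith
        nlinarith

/-- Only erased nodes can be mistaken. An erasure is equally likely inside and outside, so level and
tilt are those of `β = 0`, and its probability `n ^ (-β + o(1))` is added to the exponent. -/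
theorem exactRecovery_revealedLabel_iff {ρ a b β : ℝ} (hρ : 0 < ρ) (hb : 0 < b) (hab : b < a)
    {K : ℕ → ℕ} (hK : ∀ᶠ n : ℕ in atTop, |(K n : ℝ) - ρ * n / Real.log n| < 1) {ε : ℕ → ℝ}
    (hε : ∀ n, 0 < ε n ∧ ε n ≤ 1)
    (ho : (fun n => Real.log (ε n) - -β * Real.log n) =o[atTop]
      fun n : ℕ => Real.log n) (hne : eta1 ρ a b + β ≠ 1) :
    ExactRecovery K (edgeScale a) (edgeScale b) (fun n => revealedLabel (ε n)) ↔
      1 < eta1 ρ a b + β := by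
  have hT := Tab_pos hb hab
  obtain ⟨hbx, hxa⟩ := critLevel_div_mem hρ hb hab (le_refl (0 : ℝ))
    (mul_pos hρ (by linarith [mul_Tab_lt hb hab]))
  have hx := hb.trans hbx
  rw [eta1_eq_eta2 hρ] at hne ⊢
  constructor
  · intro hrec
    by_contra hcon
    have hlt : eta2 ρ a b 0 + β < 1 := lt_of_le_of_ne (not_lt.1 hcon) hne
    have hτ : 0 < critLevel ρ a b 0 := by
      have := mul_pos hx hρ
      rwa [div_mul_cancel₀ _ hρ.ne'] at this
    set δ := (1 - (eta2 ρ a b 0 + β)) / 2 with hδ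
    have hδpos : 0 < δ := by linarith
    have hrate := poissonRate_critLevel_right hρ hb hx hT
    rw [add_zero] at hrate
    have key : ∀ᶠ n : ℕ in atTop, ∀ x, Real.exp (- (1 - δ) * Real.log n) ≤
        revealedLabel (ε n) x none * Real.exp (- eta2 ρ a b 0 * Real.log n) := by
      filter_upwards [eventually_abs_sub_le_of_isLittleO hδpos ho] with n hn x
      have : revealedLabel (ε n) x none = ε n := rfl
      rw [this]
      nth_rw 1 [← Real.exp_log (hε n).1]
      rw [← Real.exp_add]
      refine Real.exp_le_exp.2 ?_
      have h1 := (abs_le.1 hn).1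
      have h2 : eta2 ρ a b 0 = 1 - 2 * δ - β := by linarith
      rw [h2]
      linarith
    refine not_exactRecovery_of_exponent hρ hb hab hK (fun n => revealedLabel_nonneg (hε n))
      (fun n => sum_revealedLabel (ε n)) none hτ hδpos ?_ ?_ hrec
    · rw [poissonRate_critLevel_left hρ hb hab hx hT]
      exact key.mono fun n hn => hn true
    · rw [hrate]
      exact key.mono fun n hn => hn false
  · intro hgt
    set s := tiltParam a b (critLevel ρ a b 0 / ρ) with hs
    have hsm : s ∈ Set.Ioo (0 : ℝ) 1 := tiltParam_mem hb hab hbx hxa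
    have hval := chernoffGap_critLevel hρ hb hab hx
    rw [← hs, mul_zero, add_zero] at hval
    set δ := (eta2 ρ a b 0 + β - 1) / 2 with hδ
    have hδpos : 0 < δ := by linarith
    refine exactRecovery_of_exponent hρ hb hab hK (fun n => revealedLabel_nonneg (hε n))
      (fun n => sum_revealedLabel (ε n)) (s := fun _ => s)
      (fun _ => Set.Ioo_subset_Icc_self hsm) hδpos ?_
    filter_upwards [eventually_abs_sub_le_of_isLittleO hδpos ho] with n hn y
    -- The tilt must be interior: a revealed symbol is impossible under one of the hypotheses, and
    -- its product vanishes only if both powers are nonzero.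
    have hs0 : s ≠ 0 := hsm.1.ne'
    have hs1 : 1 - s ≠ 0 := by linarith [hsm.2]
    rcases y with _ | y
    · have e1 : revealedLabel (ε n) true none ^ (1 - s) * revealedLabel (ε n) false none ^ s =
          Real.exp (Real.log (ε n)) := by
        simp only [revealedLabel]
        rw [← Real.rpow_add (hε n).1, sub_add_cancel, Real.rpow_one, Real.exp_log (hε n).1]
      rw [e1, ← Real.exp_add, hval]
      refine Real.exp_le_exp.2 ?_
      have h1 := (abs_le.1 hn).2
      have h2 : eta2 ρ a b 0 = 1 + 2 * δ - β := by linarith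
      rw [h2]
      linarith
    · have e1 : revealedLabel (ε n) true (some y) ^ (1 - s) *
          revealedLabel (ε n) false (some y) ^ s = 0 := by
        cases y <;> simp [revealedLabel, Real.zero_rpow hs0, Real.zero_rpow hs1]
      rw [e1, zero_mul]
      exact (Real.exp_pos _).le

theorem mainTheorem10 (ρ a b : ℝ) (hρ0 : 0 < ρ) (hρ1 : ρ < 1) (hb : 0 < b) (hab : b < a)
    (K : ℕ → ℕ) (hK : ∀ᶠ n : ℕ in atTop, |(K n : ℝ) - ρ * n / Real.log n| < 1) :
    -- noisy labels, `log ((1 - α) / α) = o(log n)`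
    (∀ α : ℕ → ℝ, (∀ n, 0 < α n ∧ α n < 1 / 2) →
      ((fun n => Real.log ((1 - α n) / α n)) =o[atTop] fun n : ℕ => Real.log n) →
      eta1 ρ a b ≠ 1 →
      (ExactRecovery K (edgeScale a) (edgeScale b) (fun n => noisyLabel (α n)) ↔
        1 < eta1 ρ a b)) ∧
    -- noisy labels, `log ((1 - α) / α) = (β + o(1)) log n`
    (∀ (β : ℝ) (α : ℕ → ℝ), 0 < β → β < ρ * (a - b - b * Tab a b) →
      (∀ n, 0 < α n ∧ α n < 1 / 2) →
      ((fun n => Real.log ((1 - α n) / α n) - β * Real.log n) =o[atTop]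
        fun n : ℕ => Real.log n) →
      eta2 ρ a b β ≠ 1 →
      (ExactRecovery K (edgeScale a) (edgeScale b) (fun n => noisyLabel (α n)) ↔
        1 < eta2 ρ a b β)) ∧
    -- partially revealed labels, `log ε = o(log n)`
    (∀ ε : ℕ → ℝ, (∀ n, 0 < ε n ∧ ε n ≤ 1) →
      ((fun n => Real.log (ε n)) =o[atTop] fun n : ℕ => Real.log n) →
      eta1 ρ a b ≠ 1 →
      (ExactRecovery K (edgeScale a) (edgeScale b) (fun n => revealedLabel (ε n)) ↔
        1 < eta1 ρ a b)) ∧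
    -- partially revealed labels, `log ε = (-β + o(1)) log n`
    (∀ (β : ℝ) (ε : ℕ → ℝ), 0 < β → (∀ n, 0 < ε n ∧ ε n ≤ 1) →
      ((fun n => Real.log (ε n) - -β * Real.log n) =o[atTop] fun n : ℕ => Real.log n) →
      eta1 ρ a b + β ≠ 1 →
      (ExactRecovery K (edgeScale a) (edgeScale b) (fun n => revealedLabel (ε n)) ↔
        1 < eta1 ρ a b + β)) := by
  have h0 : 0 < ρ * (a - b - b * Tab a b) := mul_pos hρ0 (by linarith [mul_Tab_lt hb hab])
  refine ⟨?_, ?_, ?_, ?_⟩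
  · intro α hα ho hne
    rw [eta1_eq_eta2 hρ0] at hne ⊢
    refine exactRecovery_noisyLabel_iff hρ0 hb hab hK le_rfl h0 hα ?_ hne
    simpa using ho
  · intro β α hβ0 hβ hα ho hne
    exact exactRecovery_noisyLabel_iff hρ0 hb hab hK hβ0.le hβ hα ho hne
  · intro ε hε ho hne
    have h := exactRecovery_revealedLabel_iff (β := 0) hρ0 hb hab hK hε (by simpa using ho)
      (by simpa using hne)
    simpa using h
  · intro β ε _ hε ho hne
    exact exactRecovery_revealedLabel_iff hρ0 hb hab hK hε ho hne
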